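/- Let $n,m\ge 1$ be integers and $A$ a real number. There is a constant $C=C_{m,n,A}>0$, depending only on $m$, $n$ and $A$, such that the following holds. Let $\psi:\mathbb{R}^n\to\mathbb{C}$ be twice differentiable with $\int_{\mathbb{R}^n}\psi(x)\,dx=0$, and suppose that $|\psi(x)|$, $\|D\psi(x)\|$ and $\|D^2\psi(x)\|$ (Euclidean operator norms) are all at most $A(1+|x|)^{-n-2}$ for every $x\in\mathbb{R}^n$. For $\lambda>0$ put $\psi_\lambda(x)=\lambda^{-n/2}\psi(\lambda^{-1}x)$, and for $f\in L^2(\mathbb{R}^n)$ (complex-valued) and $\lambda_1,\dots,\lambda_m>0$ put $$S^m_{\mathrm{cont},2}f(\lambda_1,\dots,\lambda_m)=\big\|\,||f*\psi_{\lambda_1}|*\psi_{\lambda_2}|*\cdots|*\psi_{\lambda_m}\big\|_{L^2(\mathbb{R}^n)}^2 .$$ For a function $F$ on $\mathbb{R}_+^m=(0,\infty)^m$ put $$\|F\|_{L^1(\mathbb{R}_+^m)}=\int_0^\infty\!\!\cdots\int_0^\infty |F(\lambda_1,\dots,\lambda_m)|\,\frac{d\lambda_1}{\lambda_1^{n+1}}\cdots\frac{d\lambda_m}{\lambda_m^{n+1}}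 .$$ For $\tau\in C^2(\mathbb{R}^n;\mathbb{R}^n)$ put $L_\tau f(x)=f(x-\tau(x))$, and $$\|D\tau\|_\infty=\sup_x\max_{i,j}|\partial_j\tau_i(x)|,\qquad \|D^2\tau\|_\infty=\sup_x\max_{i,j,k}|\partial_k\partial_j\tau_i(x)|,\qquad \|\Delta\tau\|_\infty=\sup_{x,y}|\tau(x)-\tau(y)| .$$ Then for every $\tau\in C^2(\mathbb{R}^n;\mathbb{R}^n)$ with $\|D\tau\|_\infty\le\frac1{2n}$ and every $f\in L^2(\mathbb{R}^n)$, $$\big\|S^m_{\mathrm{cont},2}f-S^m_{\mathrm{cont},2}L_\tau f\big\|_{L^1(\mathbb{R}_+^m)}\le C\left(\|D\tau\|_\infty+\Big(\|D\tau\|_\infty\Big(\log\frac{\|\Delta\tau\|_\infty}{\|D\tau\|_\infty}\vee 1\Big)+\|D^2\tau\|_\infty\Big)^2\right)\|f\|_2^2 .$$ Here $a\vee b=\max(a,b)$. The right-hand side is read in $[0,\infty]$: it may be infinite if $\|\Delta\tau\|_\infty$ or $\|D^2\tau\|_\infty$ is, and for constant $\tau$ it is $0$. -/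

import Mathlib

open MeasureTheory
open scoped ENNReal

noncomputable section

namespace WaveletScattering

variable {n : ℕ}

/-- `ψ` is twice differentiable, and `ψ` and its first and second derivatives are bounded by
`A (1 + |x|)^{-n-2}`. -/
structure HasDecay (A : ℝ) (ψ : EuclideanSpace ℝ (Fin n) → ℂ) : Prop where
  differentiable : Differentiable ℝ ψ
  differentiable_fderiv : Differentiable ℝ (fderiv ℝ ψ)
  bound_zero : ∀ x, ‖ψ x‖ ≤ A / (1 + ‖x‖) ^ (n + 2)
  bound_one : ∀ x, ‖fderiv ℝ ψ x‖ ≤ A / (1 + ‖x‖) ^ (n + 2)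
  bound_two : ∀ x, ‖fderiv ℝ (fderiv ℝ ψ) x‖ ≤ A / (1 + ‖x‖) ^ (n + 2)

/-- The dilation `ψ_s(x) = s^{-n/2} ψ(s⁻¹ x)`, for `s > 0`. -/
def dilate (ψ : EuclideanSpace ℝ (Fin n) → ℂ) (s : ℝ) : EuclideanSpace ℝ (Fin n) → ℂ :=
  fun x => ((s ^ (-(n : ℝ) / 2) : ℝ) : ℂ) * ψ (s⁻¹ • x)

/-- The wavelet transform at scale `s`, i.e. `f ∗ ψ_s`. -/
def waveletTransform (ψ : EuclideanSpace ℝ (Fin n) → ℂ) (s : ℝ)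
    (f : EuclideanSpace ℝ (Fin n) → ℂ) : EuclideanSpace ℝ (Fin n) → ℂ :=
  convolution f (dilate ψ s) (ContinuousLinearMap.mul ℝ ℂ) volume

/-- The cascade `| ⋯ ||f ∗ ψ_{s_1}| ∗ ψ_{s_2}| ⋯ ∗ ψ_{s_m}|`; the component `s 0` is the scale of
the layer that acts first. -/
def cascade (ψ : EuclideanSpace ℝ (Fin n) → ℂ) :
    (m : ℕ) → (Fin m → ℝ) → (EuclideanSpace ℝ (Fin n) → ℂ) → EuclideanSpace ℝ (Fin n) → ℂ
  | 0, _, f => f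
  | m + 1, s, f =>
      cascade ψ m (fun i => s i.succ) (fun x => ((‖waveletTransform ψ (s 0) f x‖ : ℝ) : ℂ))

/-- The `m`-layer continuous wavelet scattering transform with `q = 2`: the squared `L²` norm of
the cascade (the outermost modulus does not affect this norm). -/
def scattering (ψ : EuclideanSpace ℝ (Fin n) → ℂ) (m : ℕ)
    (f : EuclideanSpace ℝ (Fin n) → ℂ) (s : Fin m → ℝ) : ℝ :=
  ∫ x, ‖cascade ψ m s f x‖ ^ 2

/-- The norm of `L¹(ℝ_+^m)` for the measure `∏ᵢ dsᵢ / sᵢ^{n+1}`, as an extended real. -/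
def scaleNorm (n : ℕ) {m : ℕ} (F : (Fin m → ℝ) → ℝ) : ℝ≥0∞ :=
  ∫⁻ s in {s : Fin m → ℝ | ∀ i, 0 < s i}, ‖F s‖ₑ * ENNReal.ofReal (∏ i, 1 / s i ^ (n + 1))

/-- The deformation `L_τ f(x) = f(x - τ(x))`. -/
def deform (τ : EuclideanSpace ℝ (Fin n) → EuclideanSpace ℝ (Fin n))
    (f : EuclideanSpace ℝ (Fin n) → ℂ) : EuclideanSpace ℝ (Fin n) → ℂ :=
  fun x => f (x - τ x)

/-- `‖Dτ‖_∞ = sup_x max_{i,j} |∂_j τ_i(x)|`. -/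
def supJacobian (τ : EuclideanSpace ℝ (Fin n) → EuclideanSpace ℝ (Fin n)) : ℝ≥0∞ :=
  ⨆ (x) (i : Fin n) (j : Fin n), ‖(fderiv ℝ τ x (EuclideanSpace.single j 1)) i‖ₑ

/-- `‖D²τ‖_∞ = sup_x max_{i,j,k} |∂_k ∂_j τ_i(x)|`. -/
def supHessian (τ : EuclideanSpace ℝ (Fin n) → EuclideanSpace ℝ (Fin n)) : ℝ≥0∞ :=
  ⨆ (x) (i : Fin n) (j : Fin n) (k : Fin n),
    ‖(fderiv ℝ (fun y => fderiv ℝ τ y (EuclideanSpace.single j 1)) x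
      (EuclideanSpace.single k 1)) i‖ₑ

/-- `‖Δτ‖_∞ = sup_{x,y} |τ(x) - τ(y)|`. -/
def supDifference (τ : EuclideanSpace ℝ (Fin n) → EuclideanSpace ℝ (Fin n)) : ℝ≥0∞ :=
  ⨆ (x) (y), ‖τ x - τ y‖ₑ

/-- `log(‖Δτ‖_∞ / ‖Dτ‖_∞) ∨ 1`, an extended nonnegative number (it is `1` for constant `τ`, and
`∞` for unbounded `τ` with bounded derivative). -/
def logFactor (τ : EuclideanSpace ℝ (Fin n) → EuclideanSpace ℝ (Fin n)) : ℝ≥0∞ :=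
  (max (ENNReal.log (supDifference τ / supJacobian τ)) 1).toENNReal

end WaveletScattering

end

open Filter Topology ComplexConjugate

namespace WaveletScattering

/-! ### Schur's test and integral operators on L². -/

section Schur

variable {α : Type*} [MeasurableSpace α] {μ : Measure α}

/-! The scattering difference is bounded linearly in `‖Dτ‖_∞` alone
(`exists_scaleNorm_le_supJacobian`); the squared term with the logarithm and the Hessian is then
added as a nonnegative summand. Write `G = id - τ`, with Jacobian `J`, let `W_t` be convolution with
`t⁻ⁿ ψ(·/t)`, and let `ε ≤ 1/2` bound the operator norm of `Dτ`. After rescaling, the weights `ds /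
s^{n+1}` turn one layer into the square function of `W_t` for `dt / t`.

The heart is the commutator bound `exists_commutator_le`: `W_t(f ∘ G) - (W_t f) ∘ G` has square
function at most `C ε ‖f‖`. A change of variables writes it as an operator with kernel `K_t(x,y) =
ψ_t(x-y) - ψ_t(Gx-Gy)` applied to `f ∘ G`, plus the transported wavelet operator applied to `(1 -
J)(f ∘ G)`. The second part is harmless because `1 - J = O(ε)`. The kernels `K_t` have size and
Hölder constants `O(ε)` but do not annihilate constants, so a T1 theorem for square functions is
needed (`exists_squareFn_le_of_carleson`). Since `ψ` has mean zero, `K_t 1` is minus the transported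
operator applied to the bounded function `1 - J`, hence it gives a Carleson measure of size `ε²`. No
second derivative of `τ` and no logarithm arises.

The T1 theorem rests on two tools. Kernels annihilating constants are almost orthogonal across
scales (`exists_squareFn_le_of_cancel`). The part carried by `T_t 1` is controlled by the Carleson
embedding theorem (`IsCarleson.lintegral_sq_le`), proved with a Vitali covering.

The modulus is nonexpansive, so the commutator bound passes to the cascade by telescoping over the
layers (`exists_cascade_comp_sub_le`). Finally `‖u‖² - ‖v‖²` is compared after the change of
variables `G`: with Young's inequality weighted by `ε`, the Jacobian and cross terms cost `ε`, and
the commutator costs `ε⁻¹ ε²`. -/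

theorem sq_lintegral_mul_le {f g : α → ℝ≥0∞} (hf : AEMeasurable f μ) (hg : AEMeasurable g μ) :
    (∫⁻ x, f x * g x ∂μ) ^ 2 ≤ (∫⁻ x, f x ^ 2 ∂μ) * ∫⁻ x, g x ^ 2 ∂μ := by
  have h := ENNReal.lintegral_mul_le_Lp_mul_Lq μ Real.HolderConjugate.two_two hf hg
  have h2 := pow_le_pow_left₀ zero_le h 2
  have e : ∀ a : ℝ≥0∞, (a ^ (1 / (2 : ℝ))) ^ 2 = a := fun a => by
    rw [← ENNReal.rpow_natCast, ← ENNReal.rpow_mul]; norm_num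
  rw [mul_pow, e, e] at h2
  simpa [ENNReal.rpow_two] using h2

/-- Cauchy–Schwarz applied to `N^{1/2} · (N^{1/2} g)` uses the row bound; Tonelli then brings in the
column bound. -/
theorem schur_test [SFinite μ] {N : α → α → ℝ≥0∞} (hN : Measurable (Function.uncurry N))
    {a b : ℝ≥0∞} (hrow : ∀ x, ∫⁻ y, N x y ∂μ ≤ a) (hcol : ∀ y, ∫⁻ x, N x y ∂μ ≤ b)
    {g : α → ℝ≥0∞} (hg : AEMeasurable g μ) :
    ∫⁻ x, (∫⁻ y, N x y * g y ∂μ) ^ 2 ∂μ ≤ a * b * ∫⁻ y, g y ^ 2 ∂μ := by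
  have e : ∀ c : ℝ≥0∞, (c ^ (1 / (2 : ℝ))) ^ 2 = c := fun a => by
    rw [← ENNReal.rpow_natCast, ← ENNReal.rpow_mul]; norm_num
  have hNx : ∀ x, Measurable (N x) := fun x => hN.of_uncurry_left
  have h1 : ∀ x, (∫⁻ y, N x y * g y ∂μ) ^ 2 ≤ a * ∫⁻ y, N x y * g y ^ 2 ∂μ := fun x => by
    have h := sq_lintegral_mul_le (μ := μ) (f := fun y => N x y ^ (1 / (2 : ℝ)))
      (g := fun y => N x y ^ (1 / (2 : ℝ)) * g y) ((hNx x).pow_const _).aemeasurable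
      (((hNx x).pow_const _).aemeasurable.mul hg)
    simp only [mul_pow, e, ← mul_assoc, ← sq] at h
    exact h.trans (mul_le_mul_left (hrow x) _)
  calc ∫⁻ x, (∫⁻ y, N x y * g y ∂μ) ^ 2 ∂μ
      ≤ ∫⁻ x, a * ∫⁻ y, N x y * g y ^ 2 ∂μ ∂μ := lintegral_mono h1
    _ = a * ∫⁻ y, ∫⁻ x, N x y * g y ^ 2 ∂μ ∂μ := by
        have hm : AEMeasurable (fun p : α × α => N p.1 p.2 * g p.2 ^ 2) (μ.prod μ) :=
          hN.aemeasurable.mul ((hg.comp_snd).pow_const 2)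
        rw [lintegral_const_mul'' _ hm.lintegral_prod_right', lintegral_lintegral_swap hm]
    _ ≤ a * ∫⁻ y, b * g y ^ 2 ∂μ := by
        gcongr with y
        rw [lintegral_mul_const _ hN.of_uncurry_right]
        gcongr
        exact hcol y
    _ = a * b * ∫⁻ y, g y ^ 2 ∂μ := by
        rw [lintegral_const_mul'' _ (hg.pow_const 2), mul_assoc]

/-- The integral operator with kernel `k`. -/
noncomputable def kernelOp (μ : Measure α) (k : α → α → ℂ) (f : α → ℂ) : α → ℂ :=
  fun x => ∫ y, k x y * f y ∂μ

/-- A measurable kernel whose rows and columns have `L¹` norm at most `a`. -/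
structure IsSchur (μ : Measure α) (k : α → α → ℂ) (a : ℝ≥0∞) : Prop where
  meas : Measurable (Function.uncurry k)
  row : ∀ x, ∫⁻ y, ‖k x y‖ₑ ∂μ ≤ a
  col : ∀ y, ∫⁻ x, ‖k x y‖ₑ ∂μ ≤ a

/-- The kernel of the adjoint operator. -/
def adjKernel (k : α → α → ℂ) : α → α → ℂ := fun x y => conj (k y x)

theorem lintegral_enorm_sq_lt_top {f : α → ℂ} (hf : MemLp f 2 μ) : ∫⁻ x, ‖f x‖ₑ ^ 2 ∂μ < ⊤ := by
  have h := lintegral_rpow_enorm_lt_top_of_eLpNorm_lt_top (by norm_num) (by norm_num) hf.2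
  simpa using h

theorem memLp_two_of_lintegral {f : α → ℂ} (hf : AEStronglyMeasurable f μ)
    (h : ∫⁻ x, ‖f x‖ₑ ^ 2 ∂μ < ⊤) : MemLp f 2 μ := by
  refine ⟨hf, ?_⟩
  rw [eLpNorm_lt_top_iff_lintegral_rpow_enorm_lt_top (by norm_num) (by norm_num)]
  simpa using h

theorem eLpNorm_two_sq (f : α → ℂ) : eLpNorm f 2 μ ^ 2 = ∫⁻ x, ‖f x‖ₑ ^ 2 ∂μ := by
  rw [eLpNorm_eq_lintegral_rpow_enorm_toReal (by norm_num) (by norm_num), ← ENNReal.rpow_natCast,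
    ← ENNReal.rpow_mul]
  simp

variable {k : α → α → ℂ} {a : ℝ≥0∞}

theorem IsSchur.adj (hk : IsSchur μ k a) : IsSchur μ (adjKernel k) a where
  meas := (Complex.continuous_conj.measurable.comp hk.meas).comp measurable_swap
  row x := by simpa [adjKernel, enorm_eq_nnnorm] using hk.col x
  col x := by simpa [adjKernel, enorm_eq_nnnorm] using hk.row x

theorem IsSchur.measurable_enorm (hk : IsSchur μ k a) :
    Measurable (Function.uncurry fun x y => ‖k x y‖ₑ) := hk.meas.enorm

variable [SFinite μ]

theorem IsSchur.lintegral_sq_le (hk : IsSchur μ k a) {f : α → ℂ}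
    (hf : AEStronglyMeasurable f μ) :
    ∫⁻ x, (∫⁻ y, ‖k x y‖ₑ * ‖f y‖ₑ ∂μ) ^ 2 ∂μ ≤ a ^ 2 * ∫⁻ y, ‖f y‖ₑ ^ 2 ∂μ := by
  rw [sq a]
  exact schur_test hk.measurable_enorm hk.row hk.col hf.enorm

theorem IsSchur.lintegral_kernelOp_sq_le (hk : IsSchur μ k a) {f : α → ℂ}
    (hf : AEStronglyMeasurable f μ) :
    ∫⁻ x, ‖kernelOp μ k f x‖ₑ ^ 2 ∂μ ≤ a ^ 2 * ∫⁻ y, ‖f y‖ₑ ^ 2 ∂μ := by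
  refine le_trans (lintegral_mono fun x => ?_) (hk.lintegral_sq_le hf)
  gcongr
  refine (enorm_integral_le_lintegral_enorm _).trans_eq ?_
  simp [enorm_mul]

theorem IsSchur.ae_integrable (hk : IsSchur μ k a) (ha : a ≠ ⊤) {f : α → ℂ} (hf : MemLp f 2 μ) :
    ∀ᵐ x ∂μ, Integrable (fun y => k x y * f y) μ := by
  have hm : AEMeasurable (fun p : α × α => ‖k p.1 p.2‖ₑ * ‖f p.2‖ₑ) (μ.prod μ) :=
    hk.measurable_enorm.aemeasurable.mul hf.1.enorm.comp_snd
  have h := (hk.lintegral_sq_le hf.1).trans_lt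
    (ENNReal.mul_lt_top (by simp [ha, lt_top_iff_ne_top]) (lintegral_enorm_sq_lt_top hf))
  filter_upwards [ae_lt_top' (hm.lintegral_prod_right'.pow_const 2) h.ne] with x hx
  refine ⟨hk.meas.of_uncurry_left.aestronglyMeasurable.mul hf.1, ?_⟩
  rw [hasFiniteIntegral_iff_enorm]
  simp only [enorm_mul]
  simpa using hx

theorem IsSchur.aestronglyMeasurable_kernelOp (hk : Measurable (Function.uncurry k)) {f : α → ℂ}
    (hf : AEStronglyMeasurable f μ) : AEStronglyMeasurable (kernelOp μ k f) μ := by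
  have hm : AEStronglyMeasurable (fun p : α × α => k p.1 p.2 * f p.2) (μ.prod μ) :=
    hk.aestronglyMeasurable.mul hf.comp_snd
  exact hm.integral_prod_right'

theorem IsSchur.memLp_kernelOp (hk : IsSchur μ k a) (ha : a ≠ ⊤) {f : α → ℂ} (hf : MemLp f 2 μ) :
    MemLp (kernelOp μ k f) 2 μ :=
  memLp_two_of_lintegral (IsSchur.aestronglyMeasurable_kernelOp hk.meas hf.1)
    ((hk.lintegral_kernelOp_sq_le hf.1).trans_lt
      (ENNReal.mul_lt_top (by simp [ha, lt_top_iff_ne_top]) (lintegral_enorm_sq_lt_top hf)))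

/-- This is Fubini; absolute integrability on the product follows from Cauchy–Schwarz and the Schur
bound for `|k|` acting on `|f|`. -/
theorem IsSchur.integral_conj_kernelOp_mul (hk : IsSchur μ k a) (ha : a ≠ ⊤) {f g : α → ℂ}
    (hf : MemLp f 2 μ) (hg : MemLp g 2 μ) :
    ∫ x, conj (kernelOp μ k f x) * g x ∂μ = ∫ y, conj (f y) * kernelOp μ (adjKernel k) g y ∂μ := by
  have hint : Integrable (Function.uncurry fun x y => conj (k x y) * conj (f y) * g x)
      (μ.prod μ) := by
    refine ⟨((Complex.continuous_conj.measurable.comp hk.meas).aestronglyMeasurable.mul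
      (Complex.continuous_conj.comp_aestronglyMeasurable hf.1.comp_snd)).mul hg.1.comp_fst, ?_⟩
    rw [hasFiniteIntegral_iff_enorm]
    refine (lintegral_prod_le _).trans_lt ?_
    have h1 : ∀ x, ∫⁻ y, ‖Function.uncurry (fun x y => conj (k x y) * conj (f y) * g x) (x, y)‖ₑ ∂μ
        = (∫⁻ y, ‖k x y‖ₑ * ‖f y‖ₑ ∂μ) * ‖g x‖ₑ := fun x => by
      rw [← lintegral_mul_const' _ _ (by simp)]
      simp [enorm_eq_nnnorm]
    simp only [h1]
    have hm : AEMeasurable (fun p : α × α => ‖k p.1 p.2‖ₑ * ‖f p.2‖ₑ) (μ.prod μ) :=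
      hk.measurable_enorm.aemeasurable.mul hf.1.enorm.comp_snd
    have h2 := sq_lintegral_mul_le hm.lintegral_prod_right' hg.1.enorm
    have h3 := h2.trans (mul_le_mul_left (hk.lintegral_sq_le hf.1) _)
    have h4 := h3.trans_lt (ENNReal.mul_lt_top (ENNReal.mul_lt_top (by simp [ha, lt_top_iff_ne_top])
      (lintegral_enorm_sq_lt_top hf)) (lintegral_enorm_sq_lt_top hg))
    simpa using h4
  calc ∫ x, conj (kernelOp μ k f x) * g x ∂μ
      = ∫ x, ∫ y, conj (k x y) * conj (f y) * g x ∂μ ∂μ := by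
        congr 1 with x
        rw [integral_mul_const]
        simp only [kernelOp, ← integral_conj, map_mul]
    _ = ∫ y, ∫ x, conj (k x y) * conj (f y) * g x ∂μ ∂μ := integral_integral_swap hint
    _ = _ := by
        congr 1 with y
        rw [kernelOp, ← integral_const_mul]
        congr 1 with x
        simp only [adjKernel]
        ring

/-- The composition `T S` of a kernel `k` annihilating constants with a kernel `s` is dominated
by the oscillation of `s` in its first variable. -/
theorem lintegral_kernelOp_comp_sq_le (hk : IsSchur μ k a) (ha : a ≠ ⊤)
    (hk0 : ∀ x, ∫ y, k x y ∂μ = 0) {s : α → α → ℂ} {b : ℝ≥0∞} (hs : IsSchur μ s b) (hb : b ≠ ⊤)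
    {c d : ℝ≥0∞}
    (hrow : ∀ x, ∫⁻ y, ‖k x y‖ₑ * ∫⁻ z, ‖s y z - s x z‖ₑ ∂μ ∂μ ≤ c)
    (hcol : ∀ z, ∫⁻ x, ∫⁻ y, ‖k x y‖ₑ * ‖s y z - s x z‖ₑ ∂μ ∂μ ≤ d)
    {h : α → ℂ} (hh : MemLp h 2 μ) :
    ∫⁻ x, ‖kernelOp μ k (kernelOp μ s h) x‖ₑ ^ 2 ∂μ ≤ c * d * ∫⁻ z, ‖h z‖ₑ ^ 2 ∂μ := by
  set N : α → α → ℝ≥0∞ := fun x z => ∫⁻ y, ‖k x y‖ₑ * ‖s y z - s x z‖ₑ ∂μ with hNdef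
  have hm3 : Measurable fun p : (α × α) × α =>
      ‖k p.1.1 p.2‖ₑ * ‖s p.2 p.1.2 - s p.1.1 p.1.2‖ₑ := by
    have h1 : Measurable fun p : (α × α) × α => k p.1.1 p.2 :=
      hk.meas.comp (measurable_fst.fst.prodMk measurable_snd)
    have h2 : Measurable fun p : (α × α) × α => s p.2 p.1.2 :=
      hs.meas.comp (measurable_snd.prodMk measurable_fst.snd)
    have h3 : Measurable fun p : (α × α) × α => s p.1.1 p.1.2 :=
      hs.meas.comp (measurable_fst.fst.prodMk measurable_fst.snd)
    exact h1.enorm.mul (h2.sub h3).enorm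
  have hN : Measurable (Function.uncurry N) := hm3.lintegral_prod_right'
  have hm3' : ∀ x, Measurable (Function.uncurry fun z y => ‖k x y‖ₑ * ‖s y z - s x z‖ₑ) := fun x =>
    hm3.comp ((measurable_const.prodMk measurable_fst).prodMk measurable_snd)
  refine le_trans ?_ (schur_test hN (a := c) (b := d) (fun x => ?_) hcol hh.1.enorm)
  · have hSh := hs.memLp_kernelOp hb hh
    refine lintegral_mono_ae ?_
    have hsae := hs.ae_integrable hb hh
    filter_upwards [hk.ae_integrable ha hSh, hsae] with x hx hsx
    gcongr
    have hkx : Integrable (k x) μ := by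
      refine ⟨hk.meas.of_uncurry_left.aestronglyMeasurable, ?_⟩
      rw [hasFiniteIntegral_iff_enorm]
      exact (hk.row x).trans_lt ha.lt_top
    -- As `k x` has integral zero, the value of `S h` at `x` may be subtracted under the integral;
    -- this creates the difference `s y z - s x z`.
    have e1 : kernelOp μ k (kernelOp μ s h) x
        = ∫ y, k x y * (kernelOp μ s h y - kernelOp μ s h x) ∂μ := by
      simp only [mul_sub]
      rw [integral_sub hx (hkx.mul_const _), integral_mul_const, hk0 x, zero_mul, sub_zero]
      rfl
    rw [e1]
    calc ‖∫ y, k x y * (kernelOp μ s h y - kernelOp μ s h x) ∂μ‖ₑ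
        ≤ ∫⁻ y, ‖k x y * (kernelOp μ s h y - kernelOp μ s h x)‖ₑ ∂μ :=
          enorm_integral_le_lintegral_enorm _
      _ ≤ ∫⁻ y, ∫⁻ z, ‖k x y‖ₑ * ‖s y z - s x z‖ₑ * ‖h z‖ₑ ∂μ ∂μ := by
          refine lintegral_mono_ae ?_
          filter_upwards [hsae] with y hsy
          rw [enorm_mul]
          simp only [mul_assoc]
          rw [lintegral_const_mul' _ _ (by simp)]
          gcongr
          rw [kernelOp, kernelOp, ← integral_sub hsy hsx]
          refine (enorm_integral_le_lintegral_enorm _).trans_eq ?_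
          simp only [← sub_mul, enorm_mul]
      _ = ∫⁻ z, N x z * ‖h z‖ₑ ∂μ := by
          rw [lintegral_lintegral_swap]
          · congr 1 with z
            rw [lintegral_mul_const' _ _ (by simp)]
          · exact ((hm3' x).comp measurable_swap).aemeasurable.mul hh.1.enorm.comp_snd
  · simp only [hNdef]
    rw [lintegral_lintegral_swap (hm3' x).aemeasurable]
    refine le_trans (le_of_eq ?_) (hrow x)
    congr 1 with y
    rw [lintegral_const_mul' _ _ (by simp)]

end Schur

/-! ### Almost orthogonality in a Hilbert space. -/

section AlmostOrthogonality

/-- Meant for `u i = T_i* T_i f` and `a i = ‖T_i f‖`. With `X = ∑ a_i²`, Cauchy–Schwarz gives `X ≤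
‖∑ u_i‖ ‖f‖`, while expanding the square gives `‖∑ u_i‖² ≤ c K X`; one factor `X` then cancels. -/
theorem sum_sq_le_of_almost_orthogonal {ι H : Type*} [NormedAddCommGroup H]
    [InnerProductSpace ℂ H] (s : Finset ι) (u : ι → H) (f : H) (a : ι → ℝ) (w : ι → ι → ℝ)
    (hw : ∀ i j, w i j = w j i) (hw0 : ∀ i j, 0 ≤ w i j) {c K : ℝ} (hc : 0 ≤ c) (hK0 : 0 ≤ K)
    (hK : ∀ i, ∑ j ∈ s, w i j ≤ K)
    (h1 : ∀ i, a i ^ 2 = (inner ℂ (u i) f).re)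
    (h2 : ∀ i j, ‖inner ℂ (u i) (u j)‖ ≤ c * w i j * (a i * a j)) :
    ∑ i ∈ s, a i ^ 2 ≤ c * K * ‖f‖ ^ 2 := by
  set X := ∑ i ∈ s, a i ^ 2 with hX
  have hX0 : 0 ≤ X := Finset.sum_nonneg fun i _ => sq_nonneg _
  have e1 : X ≤ ‖∑ i ∈ s, u i‖ * ‖f‖ := by
    have : X = (inner ℂ (∑ i ∈ s, u i) f).re := by
      rw [sum_inner, Complex.re_sum]
      exact Finset.sum_congr rfl fun i _ => h1 i
    rw [this]
    exact (Complex.re_le_norm _).trans (norm_inner_le_norm _ _)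
  have e2 : ‖∑ i ∈ s, u i‖ ^ 2 ≤ c * K * X := by
    have : ((‖∑ i ∈ s, u i‖ ^ 2 : ℝ) : ℂ) = inner ℂ (∑ i ∈ s, u i) (∑ i ∈ s, u i) := by
      rw [inner_self_eq_norm_sq_to_K]; norm_cast
    calc ‖∑ i ∈ s, u i‖ ^ 2 = ‖inner ℂ (∑ i ∈ s, u i) (∑ i ∈ s, u i)‖ := by
          rw [← this, Complex.norm_real]; simp
      _ ≤ ∑ i ∈ s, ∑ j ∈ s, ‖inner ℂ (u i) (u j)‖ := by
          rw [sum_inner]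
          refine (norm_sum_le _ _).trans (Finset.sum_le_sum fun i _ => ?_)
          rw [inner_sum]
          exact norm_sum_le _ _
      -- Uses `2 a_i a_j ≤ a_i² + a_j²`, so that only the row sums of `w` remain.
      _ ≤ ∑ i ∈ s, ∑ j ∈ s, (c / 2 * (w i j * a i ^ 2) + c / 2 * (w i j * a j ^ 2)) := by
          refine Finset.sum_le_sum fun i _ => Finset.sum_le_sum fun j _ => (h2 i j).trans ?_
          have := mul_nonneg (mul_nonneg hc (hw0 i j)) (sq_nonneg (a i - a j))
          nlinarith
      _ = c * ∑ i ∈ s, (∑ j ∈ s, w i j) * a i ^ 2 := by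
          simp only [Finset.sum_add_distrib, ← Finset.mul_sum]
          rw [Finset.sum_comm (f := fun i j => w i j * a j ^ 2)]
          simp only [← Finset.sum_mul, hw _ _]
          ring
      _ ≤ c * ∑ i ∈ s, K * a i ^ 2 := by
          gcongr with i
          exact hK i
      _ = c * K * X := by rw [← Finset.mul_sum, hX]; ring
  rcases hX0.eq_or_lt with h | h
  · rw [← h]
    positivity
  · have h3 : X ^ 2 ≤ c * K * X * ‖f‖ ^ 2 := by
      calc X ^ 2 ≤ (‖∑ i ∈ s, u i‖ * ‖f‖) ^ 2 := by gcongr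
        _ = ‖∑ i ∈ s, u i‖ ^ 2 * ‖f‖ ^ 2 := by ring
        _ ≤ _ := by gcongr
    nlinarith

end AlmostOrthogonality

section LTwo

variable {α : Type*} [MeasurableSpace α] {μ : Measure α}

theorem inner_toLp {f g : α → ℂ} (hf : MemLp f 2 μ) (hg : MemLp g 2 μ) :
    inner ℂ (hf.toLp f) (hg.toLp g) = ∫ x, conj (f x) * g x ∂μ := by
  rw [L2.inner_def]
  refine integral_congr_ae ?_
  filter_upwards [hf.coeFn_toLp, hg.coeFn_toLp] with x h1 h2
  rw [h1, h2, RCLike.inner_apply, mul_comm]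

theorem norm_toLp_sq {f : α → ℂ} (hf : MemLp f 2 μ) :
    ENNReal.ofReal (‖hf.toLp f‖ ^ 2) = ∫⁻ x, ‖f x‖ₑ ^ 2 ∂μ := by
  rw [Lp.norm_toLp, ENNReal.ofReal_pow (by positivity), ENNReal.ofReal_toReal hf.2.ne,
    eLpNorm_two_sq]

theorem norm_toLp_le {f g : α → ℂ} (hf : MemLp f 2 μ) (hg : MemLp g 2 μ) {c : ℝ} (hc : 0 ≤ c)
    (h : ∫⁻ x, ‖f x‖ₑ ^ 2 ∂μ ≤ ENNReal.ofReal c ^ 2 * ∫⁻ x, ‖g x‖ₑ ^ 2 ∂μ) :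
    ‖hf.toLp f‖ ≤ c * ‖hg.toLp g‖ := by
  rw [← norm_toLp_sq hf, ← norm_toLp_sq hg, ← ENNReal.ofReal_pow hc,
    ← ENNReal.ofReal_mul (by positivity), ENNReal.ofReal_le_ofReal_iff (by positivity),
    ← mul_pow] at h
  exact le_of_sq_le_sq h (by positivity)

end LTwo

/-! ### From dyadic sums to integrals over all scales. -/

section Dyadic

theorem setLIntegral_Ioc_mul {c : ℝ} (hc : 0 < c) (φ : ℝ → ℝ≥0∞) :
    ∫⁻ t in Set.Ioc c (2 * c), φ t * ENNReal.ofReal t⁻¹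
      = ∫⁻ u in Set.Ioc (1 : ℝ) 2, φ (c * u) * ENNReal.ofReal u⁻¹ := by
  have h : (fun u : ℝ => c * u) '' Set.Ioc (1 : ℝ) 2 = Set.Ioc c (2 * c) := by
    rw [Set.image_mul_left_Ioc hc]; congr 1 <;> ring
  rw [← h, lintegral_image_eq_lintegral_abs_deriv_mul measurableSet_Ioc (f' := fun _ => c)
    (fun x _ => by simpa using ((hasDerivAt_id x).const_mul c).hasDerivWithinAt)
    (mul_right_injective₀ hc.ne').injOn]
  refine setLIntegral_congr_fun measurableSet_Ioc fun u hu => ?_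
  have hu0 : 0 < u := lt_trans one_pos hu.1
  rw [abs_of_pos hc, mul_left_comm, ← ENNReal.ofReal_mul hc.le]
  congr 2
  field_simp

/-- By dilation invariance of `dt / t`, the integral over all scales is an average over `u ∈ (1, 2]`
of the sums over the scales `2^j u`. -/
theorem lintegral_Ioi_le_of_dyadic {φ : ℝ → ℝ≥0∞} (hφ : Measurable φ) {M : ℝ≥0∞}
    (h : ∀ u : ℝ, 0 < u → ∑' j : ℤ, φ ((2 : ℝ) ^ j * u) ≤ M) :
    ∫⁻ t in Set.Ioi (0 : ℝ), φ t * ENNReal.ofReal t⁻¹ ≤ M := by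
  have hU : Set.Ioi (0 : ℝ) ⊆ ⋃ j : ℤ, Set.Ioc ((2 : ℝ) ^ j) (2 * 2 ^ j) := fun t ht => by
    obtain ⟨j, hj⟩ := exists_mem_Ioc_zpow (show (0 : ℝ) < t from ht) (one_lt_two)
    refine Set.mem_iUnion.2 ⟨j, hj.1, ?_⟩
    have := hj.2
    rwa [zpow_add_one₀ two_ne_zero, mul_comm] at this
  calc ∫⁻ t in Set.Ioi (0 : ℝ), φ t * ENNReal.ofReal t⁻¹
      ≤ ∫⁻ t in ⋃ j : ℤ, Set.Ioc ((2 : ℝ) ^ j) (2 * 2 ^ j), φ t * ENNReal.ofReal t⁻¹ :=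
        lintegral_mono_set hU
    _ ≤ ∑' j : ℤ, ∫⁻ t in Set.Ioc ((2 : ℝ) ^ j) (2 * 2 ^ j), φ t * ENNReal.ofReal t⁻¹ :=
        lintegral_iUnion_le _ _
    _ = ∫⁻ u in Set.Ioc (1 : ℝ) 2, ∑' j : ℤ, φ ((2 : ℝ) ^ j * u) * ENNReal.ofReal u⁻¹ := by
        rw [lintegral_tsum]
        · congr 1 with j
          exact setLIntegral_Ioc_mul (by positivity) φ
        · intro j
          fun_prop
    _ ≤ ∫⁻ u in Set.Ioc (1 : ℝ) 2, M := by
        refine setLIntegral_mono' measurableSet_Ioc fun u hu => ?_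
        have hu0 : 0 < u := lt_trans one_pos hu.1
        rw [ENNReal.tsum_mul_right]
        refine (mul_le_mul' (h u hu0) ?_).trans_eq (mul_one M)
        rw [ENNReal.ofReal_le_one]
        exact inv_le_one_of_one_le₀ hu.1.le
    _ = M := by simp; norm_num

theorem exists_sum_pow_natAbs_le {ρ : ℝ} (h0 : 0 ≤ ρ) (h1 : ρ < 1) :
    ∃ K : ℝ, 0 ≤ K ∧ ∀ (s : Finset ℤ) (i : ℤ), ∑ j ∈ s, ρ ^ (i - j).natAbs ≤ K := by
  have hs : Summable fun d : ℤ => ρ ^ d.natAbs := by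
    refine Summable.of_nat_of_neg ?_ ?_ <;> simpa using summable_geometric_of_lt_one h0 h1
  refine ⟨∑' d : ℤ, ρ ^ d.natAbs, tsum_nonneg fun d => by positivity, fun s i => ?_⟩
  have := (hs.comp_injective (sub_right_injective (b := i))).sum_le_tsum s
    (fun j _ => by simp only [Function.comp]; positivity)
  refine this.trans_eq ?_
  exact (Equiv.subLeft i).tsum_eq fun d : ℤ => ρ ^ d.natAbs

end Dyadic

/-- Euclidean space. -/
notation "𝔼" d:max => EuclideanSpace ℝ (Fin d)

/-! ### Standard kernels and their interaction across scales. -/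

section StandardKernel

variable {n : ℕ}

/-- The envelope `t⁻ⁿ (1 + |w| / t)⁻⁽ⁿ⁺¹⁾`. -/
noncomputable def envelope (t : ℝ) (w : 𝔼 n) : ℝ := (t ^ n)⁻¹ * ((1 + ‖w‖ / t) ^ (n + 1))⁻¹

theorem envelope_nonneg {t : ℝ} (ht : 0 < t) (w : 𝔼 n) : 0 ≤ envelope t w := by
  unfold envelope; positivity

theorem measurable_envelope (t : ℝ) : Measurable (envelope t : 𝔼 n → ℝ) := by
  unfold envelope; fun_prop

theorem envelope_neg (t : ℝ) (w : 𝔼 n) : envelope t (-w) = envelope t w := by simp [envelope]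

theorem envelope_sub_comm (t : ℝ) (x y : 𝔼 n) : envelope t (x - y) = envelope t (y - x) := by
  rw [← envelope_neg, neg_sub]

theorem lintegral_dilation {t : ℝ} (ht : 0 < t) {F : 𝔼 n → ℝ≥0∞} (hF : Measurable F) :
    ∫⁻ w : 𝔼 n, ENNReal.ofReal ((t ^ n)⁻¹) * F (t⁻¹ • w) = ∫⁻ w, F w := by
  have h : Measurable fun w : 𝔼 n => F (t⁻¹ • w) := hF.comp (measurable_const_smul _)
  rw [lintegral_const_mul _ h, ← lintegral_map hF (measurable_const_smul t⁻¹),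
    Measure.map_addHaar_smul volume (inv_ne_zero ht.ne'), lintegral_smul_measure, smul_eq_mul,
    ← mul_assoc, ← ENNReal.ofReal_mul (by positivity)]
  simp [ht.ne', abs_of_pos ht]

/-- The total mass of the envelope with the weight `|w|^{1/2}`. -/
noncomputable def envMoment (n : ℕ) : ℝ≥0∞ :=
  ∫⁻ w : 𝔼 n, ENNReal.ofReal (((1 + ‖w‖) ^ (n + 1))⁻¹ * √(1 + ‖w‖))

/-- The weight leaves decay of order `n + 1/2`, which is integrable. A full power of `|w|` would
leave order `n` and diverge logarithmically; hence the Hölder exponent `1/2` throughout. -/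
theorem envMoment_lt_top (n : ℕ) : envMoment n < ⊤ := by
  have h := integrable_one_add_norm (E := 𝔼 n) (μ := volume)
    (r := (n : ℝ) + 1 / 2) (by simp)
  have h2 := h.lintegral_lt_top
  refine lt_of_eq_of_lt (lintegral_congr fun w => ?_) h2
  congr 1
  have hp : 0 < 1 + ‖w‖ := by positivity
  rw [Real.sqrt_eq_rpow, ← Real.rpow_natCast, ← Real.rpow_neg hp.le, ← Real.rpow_add hp]
  congr 1
  push_cast
  ring

theorem lintegral_envelope_mul_sqrt_le {t : ℝ} (ht : 0 < t) :
    ∫⁻ w : 𝔼 n, ENNReal.ofReal (envelope t w * √(1 + ‖w‖ / t)) = envMoment n := by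
  rw [envMoment]
  refine Eq.trans ?_ (lintegral_dilation (n := n) ht
    (F := fun w => ENNReal.ofReal (((1 + ‖w‖) ^ (n + 1))⁻¹ * √(1 + ‖w‖))) (by fun_prop))
  · refine lintegral_congr fun w => ?_
    rw [← ENNReal.ofReal_mul (by positivity), norm_smul, Real.norm_of_nonneg (by positivity),
      envelope, mul_assoc, div_eq_inv_mul]

theorem lintegral_envelope_le {t : ℝ} (ht : 0 < t) :
    ∫⁻ w : 𝔼 n, ENNReal.ofReal (envelope t w) ≤ envMoment n := by
  rw [← lintegral_envelope_mul_sqrt_le ht]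
  refine lintegral_mono fun w => ENNReal.ofReal_le_ofReal ?_
  refine le_mul_of_one_le_right (envelope_nonneg ht w) ?_
  rw [Real.one_le_sqrt]
  have : 0 ≤ ‖w‖ / t := by positivity
  linarith

theorem lintegral_envelope_sub_left {t : ℝ} (ht : 0 < t) (x : 𝔼 n) :
    ∫⁻ y : 𝔼 n, ENNReal.ofReal (envelope t (x - y)) ≤ envMoment n := by
  rw [lintegral_sub_left_eq_self (fun w => ENNReal.ofReal (envelope t w)) x]
  exact lintegral_envelope_le ht

theorem lintegral_envelope_sub_right {t : ℝ} (ht : 0 < t) (y : 𝔼 n) :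
    ∫⁻ x : 𝔼 n, ENNReal.ofReal (envelope t (x - y)) ≤ envMoment n := by
  simp only [fun x => envelope_sub_comm t x y]
  exact lintegral_envelope_sub_left ht y

theorem lintegral_envelope_sqrt_left {t r : ℝ} (ht : 0 < t) (hr : 0 < r) (x : 𝔼 n) :
    ∫⁻ y : 𝔼 n, ENNReal.ofReal (envelope t (x - y) * √(‖x - y‖ / r))
      ≤ ENNReal.ofReal √(t / r) * envMoment n := by
  rw [lintegral_sub_left_eq_self (fun w => ENNReal.ofReal (envelope t w * √(‖w‖ / r))) x,
    ← lintegral_envelope_mul_sqrt_le ht, ← lintegral_const_mul' _ _ (by simp)]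
  refine lintegral_mono fun w => ?_
  rw [← ENNReal.ofReal_mul (by positivity)]
  refine ENNReal.ofReal_le_ofReal ?_
  rw [mul_left_comm]
  refine mul_le_mul_of_nonneg_left ?_ (envelope_nonneg ht w)
  rw [← Real.sqrt_mul (by positivity)]
  refine Real.sqrt_le_sqrt ?_
  have : ‖w‖ / r = t / r * (‖w‖ / t) := by field_simp
  rw [this]
  gcongr
  linarith

theorem lintegral_envelope_sqrt_right {t r : ℝ} (ht : 0 < t) (hr : 0 < r) (y : 𝔼 n) :
    ∫⁻ x : 𝔼 n, ENNReal.ofReal (envelope t (x - y) * √(‖x - y‖ / r))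
      ≤ ENNReal.ofReal √(t / r) * envMoment n := by
  simp only [fun x => envelope_sub_comm t x y, fun x => norm_sub_rev x y]
  exact lintegral_envelope_sqrt_left ht hr y

/-- A family of kernels `k_t(x, y)` adapted to the scales `t > 0`, of size at most `B` times the
envelope and Hölder continuous of exponent `1/2` in the second variable. -/
structure IsStdKernel (k : ℝ → 𝔼 n → 𝔼 n → ℂ) (B : ℝ) : Prop where
  nonneg : 0 ≤ B
  meas : Measurable fun p : ℝ × 𝔼 n × 𝔼 n => k p.1 p.2.1 p.2.2
  size : ∀ t, 0 < t → ∀ x y, ‖k t x y‖ ≤ B * envelope t (x - y)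
  reg : ∀ t, 0 < t → ∀ x y y', ‖k t x y - k t x y'‖ ≤
    B * √(‖y - y'‖ / t) * (envelope t (x - y) + envelope t (x - y'))

variable {k : ℝ → 𝔼 n → 𝔼 n → ℂ} {B : ℝ}

theorem enorm_le_ofReal {z : ℂ} {r : ℝ} (h : ‖z‖ ≤ r) : ‖z‖ₑ ≤ ENNReal.ofReal r := by
  rw [← ofReal_norm]; exact ENNReal.ofReal_le_ofReal h

theorem isSchur_of_size {k : 𝔼 n → 𝔼 n → ℂ} (hm : Measurable (Function.uncurry k)) {t : ℝ} (ht : 0 < t)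
    (hB : 0 ≤ B) (h : ∀ x y, ‖k x y‖ ≤ B * envelope t (x - y)) :
    IsSchur volume k (ENNReal.ofReal B * envMoment n) where
  meas := hm
  row x := by
    refine (lintegral_mono fun y => enorm_le_ofReal (h x y)).trans ?_
    simp only [ENNReal.ofReal_mul hB]
    rw [lintegral_const_mul' _ _ (by simp)]
    gcongr
    exact lintegral_envelope_sub_left ht x
  col y := by
    refine (lintegral_mono fun x => enorm_le_ofReal (h x y)).trans ?_
    simp only [ENNReal.ofReal_mul hB]
    rw [lintegral_const_mul' _ _ (by simp)]
    gcongr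
    exact lintegral_envelope_sub_right ht y

theorem IsStdKernel.isSchur (hk : IsStdKernel k B) {t : ℝ} (ht : 0 < t) :
    IsSchur volume (k t) (ENNReal.ofReal B * envMoment n) :=
  isSchur_of_size (hk.meas.comp (measurable_const.prodMk measurable_id)) ht hk.nonneg
    (hk.size t ht)

theorem schurConst_ne_top (B : ℝ) : ENNReal.ofReal B * envMoment n ≠ ⊤ :=
  ENNReal.mul_ne_top (by simp) (envMoment_lt_top n).ne

/-- The cancellation of `T_t` is played against the Hölder continuity of `k r` in its second
variable, which is the first variable of the adjoint. The factor `√(|x - y| / r)` averages to `√(t /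
r)` against the envelope at scale `t`, a gain when `t ≤ r`. -/
theorem IsStdKernel.lintegral_comp_adj_le (hk : IsStdKernel k B)
    (hk0 : ∀ t, 0 < t → ∀ x, ∫ y, k t x y = 0) {t r : ℝ} (ht : 0 < t) (hr : 0 < r)
    {h : 𝔼 n → ℂ} (hh : MemLp h 2 volume) :
    ∫⁻ x, ‖kernelOp volume (k t) (kernelOp volume (adjKernel (k r)) h) x‖ₑ ^ 2 ≤
      ENNReal.ofReal (2 * B ^ 2 * (envMoment n).toReal ^ 2 * √(t / r)) ^ 2 *
        ∫⁻ x, ‖h x‖ₑ ^ 2 := by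
  have hB := hk.nonneg
  set I := envMoment n with hI
  set e : 𝔼 n → 𝔼 n → ℝ≥0∞ := fun x y => ENNReal.ofReal (envelope t (x - y) * √(‖x - y‖ / r)) with he
  set q : 𝔼 n → 𝔼 n → ℝ≥0∞ := fun z y => ENNReal.ofReal (envelope r (z - y)) with hq
  have hem : Measurable (Function.uncurry e) := by
    have := measurable_envelope (n := n) t
    simp only [he, Function.uncurry_def]
    fun_prop
  have hqm : Measurable (Function.uncurry q) := by
    have := measurable_envelope (n := n) r
    simp only [hq, Function.uncurry_def]
    fun_prop
  have hqx : ∀ y, Measurable fun z => q z y := fun y => hqm.of_uncurry_right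
  have hqz : ∀ y, Measurable fun z => q y z := fun y => hqm.of_uncurry_left
  have hb : ∀ x y z, ‖k t x y‖ₑ * ‖adjKernel (k r) y z - adjKernel (k r) x z‖ₑ ≤
      ENNReal.ofReal (B ^ 2) * (e x y * (q z y + q z x)) := fun x y z => by
    have h1 : ‖adjKernel (k r) y z - adjKernel (k r) x z‖ = ‖k r z y - k r z x‖ := by
      simp only [adjKernel]
      rw [← map_sub, RCLike.norm_conj]
    have h2 := hk.size t ht x y
    have h3 := hk.reg r hr z y x
    rw [← ofReal_norm, ← ofReal_norm, h1, ← ENNReal.ofReal_mul (norm_nonneg _)]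
    simp only [he, hq]
    rw [← ENNReal.ofReal_add (envelope_nonneg hr _) (envelope_nonneg hr _),
      ← ENNReal.ofReal_mul (mul_nonneg (envelope_nonneg ht _) (Real.sqrt_nonneg _)),
      ← ENNReal.ofReal_mul (by positivity)]
    refine ENNReal.ofReal_le_ofReal ?_
    calc ‖k t x y‖ * ‖k r z y - k r z x‖ ≤ _ :=
          mul_le_mul h2 h3 (norm_nonneg _) (mul_nonneg hB (envelope_nonneg ht _))
      _ = _ := by rw [norm_sub_rev y x]; ring
  have hc : ENNReal.ofReal (B ^ 2) * (2 * (ENNReal.ofReal √(t / r) * I * I)) =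
      ENNReal.ofReal (2 * B ^ 2 * I.toReal ^ 2 * √(t / r)) := by
    rw [ENNReal.ofReal_mul (by positivity), ENNReal.ofReal_mul (by positivity),
      ENNReal.ofReal_mul (by positivity), ENNReal.ofReal_pow (by positivity) (n := 2) (p := I.toReal),
      ENNReal.ofReal_toReal (envMoment_lt_top n).ne]
    simp
    ring
  rw [sq (ENNReal.ofReal _), ← hc]
  refine lintegral_kernelOp_comp_sq_le (hk.isSchur ht) (schurConst_ne_top B) (hk0 t ht)
    (hk.isSchur hr).adj (schurConst_ne_top B) (fun x => ?_) (fun z => ?_) hh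
  · calc ∫⁻ y, ‖k t x y‖ₑ * ∫⁻ z, ‖adjKernel (k r) y z - adjKernel (k r) x z‖ₑ
        = ∫⁻ y, ∫⁻ z, ‖k t x y‖ₑ * ‖adjKernel (k r) y z - adjKernel (k r) x z‖ₑ := by
          congr 1 with y
          rw [lintegral_const_mul' _ _ (by simp)]
      _ ≤ ∫⁻ y, ENNReal.ofReal (B ^ 2) * (e x y * (I + I)) := by
          refine lintegral_mono fun y => (lintegral_mono fun z => hb x y z).trans ?_
          rw [lintegral_const_mul' _ _ (by simp), lintegral_const_mul' _ _ (by simp [he]),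
            lintegral_add_left (hqx y)]
          gcongr
          exacts [lintegral_envelope_sub_right hr y, lintegral_envelope_sub_right hr x]
      _ ≤ _ := by
          rw [lintegral_const_mul' _ _ (by simp), lintegral_mul_const _ hem.of_uncurry_left]
          calc ENNReal.ofReal (B ^ 2) * ((∫⁻ y, e x y) * (I + I))
              ≤ ENNReal.ofReal (B ^ 2) * ((ENNReal.ofReal √(t / r) * I) * (I + I)) := by
                gcongr
                exact lintegral_envelope_sqrt_left ht hr x
            _ = _ := by ring
  · calc ∫⁻ x, ∫⁻ y, ‖k t x y‖ₑ * ‖adjKernel (k r) y z - adjKernel (k r) x z‖ₑ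
        ≤ ∫⁻ x, ∫⁻ y, ENNReal.ofReal (B ^ 2) * (e x y * (q z y + q z x)) :=
          lintegral_mono fun x => lintegral_mono fun y => hb x y z
      _ = ENNReal.ofReal (B ^ 2) * ((∫⁻ x, ∫⁻ y, e x y * q z y) + ∫⁻ x, ∫⁻ y, e x y * q z x) := by
          rw [← lintegral_add_left, ← lintegral_const_mul' _ _ (by simp)]
          · congr 1 with x
            rw [← lintegral_add_left, ← lintegral_const_mul' _ _ (by simp)]
            · simp only [mul_add]
            · exact hem.of_uncurry_left.mul (hqz z)
          · exact (hem.mul ((hqz z).comp measurable_snd)).lintegral_prod_right'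
      _ ≤ ENNReal.ofReal (B ^ 2) * (ENNReal.ofReal √(t / r) * I * I +
            ENNReal.ofReal √(t / r) * I * I) := by
          gcongr
          · rw [lintegral_lintegral_swap (hem.mul ((hqz z).comp measurable_snd)).aemeasurable]
            calc ∫⁻ y, ∫⁻ x, e x y * q z y
                = ∫⁻ y, (∫⁻ x, e x y) * q z y := by
                  congr 1 with y
                  rw [lintegral_mul_const _ hem.of_uncurry_right]
              _ ≤ ∫⁻ y, (ENNReal.ofReal √(t / r) * I) * q z y := by
                  gcongr with y
                  exact lintegral_envelope_sqrt_right ht hr y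
              _ ≤ _ := by
                  rw [lintegral_const_mul _ (hqz z)]
                  gcongr
                  exact lintegral_envelope_sub_left hr z
          · calc ∫⁻ x, ∫⁻ y, e x y * q z x
                = ∫⁻ x, (∫⁻ y, e x y) * q z x := by
                  congr 1 with x
                  rw [lintegral_mul_const _ hem.of_uncurry_left]
              _ ≤ ∫⁻ x, (ENNReal.ofReal √(t / r) * I) * q z x := by
                  gcongr with x
                  exact lintegral_envelope_sqrt_left ht hr x
              _ ≤ _ := by
                  rw [lintegral_const_mul _ (hqz z)]
                  gcongr
                  exact lintegral_envelope_sub_left hr z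
      _ = _ := by rw [two_mul]

end StandardKernel

/-! ### The square function estimate under cancellation. -/

section SquareFunction

variable {n : ℕ} {k : ℝ → 𝔼 n → 𝔼 n → ℂ} {B : ℝ}

/-- The square function `∫ ‖T_t f‖² dt / t` of a family of integral operators. -/
noncomputable def squareFn (k : ℝ → 𝔼 n → 𝔼 n → ℂ) (f : 𝔼 n → ℂ) : ℝ≥0∞ :=
  ∫⁻ t in Set.Ioi (0 : ℝ), (∫⁻ x, ‖kernelOp volume (k t) f x‖ₑ ^ 2) * ENNReal.ofReal t⁻¹

theorem measurable_kernelOp_uncurry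
    (hk : Measurable fun p : ℝ × 𝔼 n × 𝔼 n => k p.1 p.2.1 p.2.2) {f : 𝔼 n → ℂ}
    (hf : AEStronglyMeasurable f volume) :
    Measurable fun p : ℝ × 𝔼 n => kernelOp volume (k p.1) f p.2 := by
  have h : (fun p : ℝ × 𝔼 n => kernelOp volume (k p.1) f p.2) =
      fun p : ℝ × 𝔼 n => ∫ y, k p.1 p.2 y * hf.mk f y := by
    funext p
    refine integral_congr_ae ?_
    filter_upwards [hf.ae_eq_mk] with y hy
    rw [hy]
  rw [h]
  have hm : Measurable fun q : (ℝ × 𝔼 n) × 𝔼 n => k q.1.1 q.1.2 q.2 * hf.mk f q.2 :=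
    (hk.comp (measurable_fst.fst.prodMk (measurable_fst.snd.prodMk measurable_snd))).mul
      (hf.stronglyMeasurable_mk.measurable.comp measurable_snd)
  exact hm.stronglyMeasurable.integral_prod_right'.measurable

theorem measurable_lintegral_kernelOp
    (hk : Measurable fun p : ℝ × 𝔼 n × 𝔼 n => k p.1 p.2.1 p.2.2) {f : 𝔼 n → ℂ}
    (hf : AEStronglyMeasurable f volume) :
    Measurable fun t => ∫⁻ x, ‖kernelOp volume (k t) f x‖ₑ ^ 2 :=
  ((measurable_kernelOp_uncurry hk hf).enorm.pow_const 2).lintegral_prod_right'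

theorem adjKernel_adjKernel {α : Type*} (k : α → α → ℂ) : adjKernel (adjKernel k) = k := by
  funext x y
  simp [adjKernel]

/-- Moving one adjoint across leaves `⟨g, T_t T_r* h⟩`, to which the composition estimate applies.
-/
theorem norm_inner_adj_adj_le (hk : IsStdKernel k B)
    (hk0 : ∀ t, 0 < t → ∀ x, ∫ y, k t x y = 0) {t r : ℝ} (ht : 0 < t) (hr : 0 < r)
    {g h : 𝔼 n → ℂ} (hg : MemLp g 2 volume) (hh : MemLp h 2 volume)
    (hg' : MemLp (kernelOp volume (adjKernel (k t)) g) 2 volume)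
    (hh' : MemLp (kernelOp volume (adjKernel (k r)) h) 2 volume) :
    ‖inner ℂ (hg'.toLp _) (hh'.toLp _)‖ ≤
      2 * B ^ 2 * (envMoment n).toReal ^ 2 * √(t / r) * (‖hg.toLp g‖ * ‖hh.toLp h‖) := by
  have hS := hk.isSchur ht
  have hS' := schurConst_ne_top (n := n) B
  have e : inner ℂ (hg'.toLp _) (hh'.toLp _) =
      inner ℂ (hg.toLp g) ((hS.memLp_kernelOp hS' hh').toLp _) := by
    rw [inner_toLp, inner_toLp, hS.adj.integral_conj_kernelOp_mul hS' hg hh', adjKernel_adjKernel]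
  rw [e]
  refine (norm_inner_le_norm _ _).trans ?_
  rw [mul_left_comm]
  gcongr
  refine norm_toLp_le _ hh (by positivity) ?_
  exact hk.lintegral_comp_adj_le hk0 ht hr hh

theorem sqrt_two_zpow_div {u : ℝ} (hu : 0 < u) {i j : ℤ} (hij : i ≤ j) :
    √((2 : ℝ) ^ i * u / (2 ^ j * u)) = √(1 / 2) ^ (i - j).natAbs := by
  obtain ⟨m, rfl⟩ := Int.le.dest hij
  have : (2 : ℝ) ^ i * u / (2 ^ (i + (m : ℤ)) * u) = (1 / 2) ^ m := by
    rw [zpow_add₀ two_ne_zero, zpow_natCast]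
    have : (2 : ℝ) ^ i ≠ 0 := by positivity
    field_simp
    rw [← mul_pow]; norm_num
  rw [this]
  have h2 : (i - (i + (m : ℤ))).natAbs = m := by omega
  rw [h2]
  rw [Real.sqrt_eq_iff_mul_self_eq (by positivity) (by positivity), ← mul_pow,
    Real.mul_self_sqrt (by positivity)]

/-- Square function estimate for standard kernels annihilating constants. -/
theorem exists_squareFn_le_of_cancel (n : ℕ) :
    ∃ C : ℝ, 0 ≤ C ∧ ∀ (k : ℝ → 𝔼 n → 𝔼 n → ℂ) (B : ℝ),
      IsStdKernel k B → (∀ t, 0 < t → ∀ x, ∫ y, k t x y = 0) →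
      ∀ f : 𝔼 n → ℂ, MemLp f 2 volume →
      squareFn k f ≤ ENNReal.ofReal (C * B ^ 2) * ∫⁻ x, ‖f x‖ₑ ^ 2 := by
  obtain ⟨K, hK0, hK⟩ := exists_sum_pow_natAbs_le (ρ := √(1 / 2)) (by positivity)
    (by rw [Real.sqrt_lt' one_pos]; norm_num)
  refine ⟨2 * (envMoment n).toReal ^ 2 * K, by positivity, fun k B hk hk0 f hf => ?_⟩
  have hS' := schurConst_ne_top (n := n) B
  refine lintegral_Ioi_le_of_dyadic (measurable_lintegral_kernelOp hk.meas hf.1) fun u hu => ?_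
  refine ENNReal.summable.tsum_le_of_sum_le fun s => ?_
  have hsc : ∀ j : ℤ, (0 : ℝ) < 2 ^ j * u := fun j => by positivity
  have hS := fun j => hk.isSchur (hsc j)
  have hF := fun j => (hS j).memLp_kernelOp hS' hf
  have hG := fun j => (hS j).adj.memLp_kernelOp hS' (hF j)
  -- Almost orthogonality with `u_j = T_j* T_j f`, `a_j = ‖T_j f‖` and weights `2^{-|i-j|/2}`.
  have key := sum_sq_le_of_almost_orthogonal s (fun j => (hG j).toLp _) (hf.toLp f)
    (fun j => ‖(hF j).toLp _‖) (fun i j => √(1 / 2) ^ (i - j).natAbs)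
    (fun i j => by rw [← Int.natAbs_neg, neg_sub]) (fun i j => by positivity)
    (c := 2 * B ^ 2 * (envMoment n).toReal ^ 2) (by positivity) hK0 (hK s)
    (fun j => by
      rw [inner_toLp, (hS j).adj.integral_conj_kernelOp_mul hS' (hF j) hf]
      rw [adjKernel_adjKernel, ← inner_toLp (hF j) (hF j), inner_self_eq_norm_sq_to_K]
      norm_cast)
    (fun i j => by
      rcases le_total i j with hij | hij
      · rw [← sqrt_two_zpow_div hu hij]
        exact norm_inner_adj_adj_le hk hk0 (hsc i) (hsc j) (hF i) (hF j) (hG i) (hG j)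
      -- The factor `√(t / r)` helps only when the smaller scale comes first, so the inner product
      -- is flipped.
      · rw [norm_inner_symm, ← Int.natAbs_neg, neg_sub, ← sqrt_two_zpow_div hu hij,
          mul_comm ‖(hF i).toLp _‖]
        exact norm_inner_adj_adj_le hk hk0 (hsc j) (hsc i) (hF j) (hF i) (hG j) (hG i))
  have key2 := ENNReal.ofReal_le_ofReal key
  rw [ENNReal.ofReal_sum_of_nonneg fun _ _ => by positivity, ENNReal.ofReal_mul (by positivity),
    norm_toLp_sq hf] at key2
  simp only [norm_toLp_sq (hF _)] at key2
  refine key2.trans_eq ?_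
  congr 2
  ring

end SquareFunction

/-! ### Carleson measures and the embedding theorem. -/

section Carleson

variable {n : ℕ}

/-- Averages of `g` over closed balls, normalised by the `n`-th power of the radius. -/
noncomputable def ballAverage (g : 𝔼 n → ℝ≥0∞) (p : ℝ × 𝔼 n) : ℝ≥0∞ :=
  ENNReal.ofReal (p.1 ^ n)⁻¹ * ∫⁻ y in Metric.closedBall p.2 p.1, g y

theorem measurable_ballAverage {g : 𝔼 n → ℝ≥0∞} (hg : Measurable g) : Measurable (ballAverage g) := by
  have hs : MeasurableSet {q : (ℝ × 𝔼 n) × 𝔼 n | dist q.2 q.1.2 ≤ q.1.1} :=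
    measurableSet_le (by fun_prop) (by fun_prop)
  have h : ∀ p : ℝ × 𝔼 n, ∫⁻ y in Metric.closedBall p.2 p.1, g y =
      ∫⁻ y, {q : (ℝ × 𝔼 n) × 𝔼 n | dist q.2 q.1.2 ≤ q.1.1}.indicator (fun q => g q.2) (p, y) := fun p => by
    rw [← lintegral_indicator Metric.isClosed_closedBall.measurableSet]
    rfl
  unfold ballAverage
  simp only [h]
  have hm := ((hg.comp measurable_snd).indicator hs).lintegral_prod_right' (ν := (volume : Measure (𝔼 n)))
  refine Measurable.mul (by fun_prop) hm

/-- `ν` is a Carleson measure with constant `c`. -/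
def IsCarleson (ν : Measure (ℝ × 𝔼 n)) (c : ℝ≥0∞) : Prop :=
  ∀ (x : 𝔼 n) (r : ℝ), 0 < r →
    ν (Set.Ioc 0 r ×ˢ Metric.closedBall x r) ≤ c * ENNReal.ofReal (r ^ n)

/-- Each ball `B(x, r)` in play satisfies `r^n ≤ s⁻¹ ∫_B h`. Vitali's lemma selects disjoint balls
whose threefold tents cover the set; the Carleson condition bounds each tent, and disjointness sums
the integrals of `h`. -/
theorem IsCarleson.weak_type (hn : n ≠ 0) {ν : Measure (ℝ × 𝔼 n)} {c : ℝ≥0∞} (hν : IsCarleson ν c)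
    {h : 𝔼 n → ℝ≥0∞} (hi : ∫⁻ y, h y ≠ ⊤) {s : ℝ≥0∞} (hs : s ≠ 0) (hs' : s ≠ ⊤) :
    ν {p | 0 < p.1 ∧ s < ballAverage h p} ≤ c * 3 ^ n * (s⁻¹ * ∫⁻ y, h y) := by
  set U : Set (ℝ × 𝔼 n) := {p | 0 < p.1 ∧ s < ballAverage h p} with hU
  set B : ℝ × 𝔼 n → Set (𝔼 n) := fun p => Metric.closedBall p.2 p.1 with hB
  have h1 : ∀ p ∈ U, ENNReal.ofReal (p.1 ^ n) ≤ s⁻¹ * ∫⁻ y in B p, h y := fun p hp => by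
    have h2 := hp.2.le
    have h0 : ENNReal.ofReal (p.1 ^ n) ≠ 0 := by
      have := pow_pos hp.1 n
      simpa using this
    rw [ballAverage, ENNReal.ofReal_inv_of_pos (pow_pos hp.1 n), ← ENNReal.div_eq_inv_mul,
      ENNReal.le_div_iff_mul_le (Or.inl h0) (Or.inl (by simp))] at h2
    rw [← ENNReal.div_eq_inv_mul, ENNReal.le_div_iff_mul_le (Or.inl hs) (Or.inl hs'), mul_comm]
    exact h2
  set M : ℝ := (s⁻¹ * ∫⁻ y, h y).toReal with hM
  have hMt : s⁻¹ * ∫⁻ y, h y ≠ ⊤ := ENNReal.mul_ne_top (ENNReal.inv_ne_top.2 hs) hi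
  -- Vitali's lemma needs bounded radii: `r^n ≤ M`, and `r ≤ r^n` when `r ≥ 1` and `n ≠ 0`.
  have hR : ∀ p ∈ U, p.1 ≤ 1 + M := fun p hp => by
    by_contra! hcon
    have h3 : ENNReal.ofReal (p.1 ^ n) ≤ s⁻¹ * ∫⁻ y, h y :=
      (h1 p hp).trans (by gcongr; exact Measure.restrict_le_self)
    rw [← ENNReal.ofReal_toReal hMt, ENNReal.ofReal_le_ofReal_iff ENNReal.toReal_nonneg] at h3
    have hM0 : 0 ≤ M := ENNReal.toReal_nonneg
    have h4 := le_self_pow₀ (show 1 ≤ p.1 by linarith) hn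
    linarith
  obtain ⟨u, huU, hdisj, hcov⟩ := Vitali.exists_disjoint_subfamily_covering_enlargement B U
    (fun p => p.1) 2 one_lt_two (fun p hp => hp.1.le) (1 + M) hR
    (fun p hp => Metric.nonempty_closedBall.2 hp.1.le)
  have hcount : u.Countable := hdisj.countable_of_nonempty_interior fun p hp =>
    ⟨p.2, Metric.ball_subset_interior_closedBall (Metric.mem_ball_self (huU hp).1)⟩
  -- The radius of `a` is at most twice that of `b` and the balls meet, so the centres are within `2
  -- + 1 = 3` radii of `b`.
  have hsub : U ⊆ ⋃ b ∈ u, Set.Ioc 0 (3 * b.1) ×ˢ Metric.closedBall b.2 (3 * b.1) := fun a ha => by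
    obtain ⟨b, hb, ⟨z, hz1, hz2⟩, hab⟩ := hcov a ha
    have hb0 := (huU hb).1
    refine Set.mem_biUnion hb ⟨⟨ha.1, by linarith⟩, ?_⟩
    rw [Metric.mem_closedBall] at hz1 hz2 ⊢
    have := dist_triangle_left a.2 b.2 z
    linarith
  have : Countable u := hcount.to_subtype
  calc ν U ≤ ν (⋃ b ∈ u, Set.Ioc 0 (3 * b.1) ×ˢ Metric.closedBall b.2 (3 * b.1)) :=
        measure_mono hsub
    _ ≤ ∑' b : u, ν (Set.Ioc 0 (3 * b.1.1) ×ˢ Metric.closedBall b.1.2 (3 * b.1.1)) :=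
        measure_biUnion_le _ hcount _
    _ ≤ ∑' b : u, c * 3 ^ n * (s⁻¹ * ∫⁻ y in B b, h y) := by
        refine ENNReal.tsum_le_tsum fun b => ?_
        have hb0 := (huU b.2).1
        refine (hν b.1.2 (3 * b.1.1) (by linarith)).trans ?_
        rw [mul_pow, ENNReal.ofReal_mul (by positivity), ENNReal.ofReal_pow (by norm_num),
          ← mul_assoc]
        simp only [ENNReal.ofReal_ofNat]
        gcongr
        exact h1 b.1 (huU b.2)
    _ = c * 3 ^ n * (s⁻¹ * ∫⁻ y in ⋃ b ∈ u, B b, h y) := by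
        rw [ENNReal.tsum_mul_left, ENNReal.tsum_mul_left, lintegral_biUnion hcount
          (fun b _ => Metric.isClosed_closedBall.measurableSet) hdisj]
    _ ≤ _ := by
        gcongr
        exact Measure.restrict_le_self

theorem volume_closedBall_eq (x : 𝔼 n) {t : ℝ} (ht : 0 ≤ t) :
    volume (Metric.closedBall x t) = ENNReal.ofReal (t ^ n) * volume (Metric.closedBall (0 : 𝔼 n) 1) := by
  rw [Measure.addHaar_closedBall' volume x ht]
  simp

/-- The Carleson embedding theorem. -/
theorem IsCarleson.lintegral_sq_le (hn : n ≠ 0) {ν : Measure (ℝ × 𝔼 n)} {c : ℝ≥0∞}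
    (hν : IsCarleson ν c) {g : 𝔼 n → ℝ≥0∞} (hg : Measurable g) (hgi : ∫⁻ y, g y ^ 2 ≠ ⊤) :
    ∫⁻ p in Set.Ioi 0 ×ˢ Set.univ, ballAverage g p ^ 2 ∂ν ≤
      8 * 3 ^ n * volume (Metric.closedBall (0 : 𝔼 n) 1) * c * ∫⁻ y, g y ^ 2 := by
  set v := volume (Metric.closedBall (0 : 𝔼 n) 1) with hv
  have hv0 : v ≠ 0 := (Metric.measure_closedBall_pos volume _ one_pos).ne'
  have hvt : v ≠ ⊤ := measure_closedBall_lt_top.ne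
  set T : Set (ℝ × 𝔼 n) := Set.Ioi 0 ×ˢ Set.univ with hT
  have hTm : MeasurableSet T := measurableSet_Ioi.prod MeasurableSet.univ
  have hfin : ∀ p, ballAverage g p ≠ ⊤ := fun p => by
    refine ENNReal.mul_ne_top (by simp) (ne_of_lt ?_)
    have h := sq_lintegral_mul_le (μ := volume.restrict (Metric.closedBall p.2 p.1))
      hg.aemeasurable (aemeasurable_const (b := (1 : ℝ≥0∞)))
    simp only [mul_one, one_pow, lintegral_one, Measure.restrict_apply_univ] at h
    have h2 := h.trans_lt (ENNReal.mul_lt_top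
      ((setLIntegral_le_lintegral _ _).trans_lt hgi.lt_top) measure_closedBall_lt_top)
    by_contra hcon
    rw [not_lt_top_iff] at hcon
    simp [hcon] at h2
  -- Where `2 v g ≤ s` the function contributes at most `s / 2` to any average, since a ball has
  -- volume `v r^n`. So an average above `s` forces the average of the truncation to `A` above `s /
  -- 2`, and the weak-type bound applies to the truncation.
  have hkey : ∀ s : ℝ, 0 < s → ν.restrict T {p | s < (ballAverage g p).toReal} ≤
      c * 3 ^ n * ((ENNReal.ofReal (s / 2))⁻¹ *
        ∫⁻ y, {y | ENNReal.ofReal s < 2 * v * g y}.indicator g y) := fun s hs => by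
    set A : Set (𝔼 n) := {y | ENNReal.ofReal s < 2 * v * g y} with hA
    have hAm : MeasurableSet A := measurableSet_lt measurable_const (hg.const_mul _)
    have hs0 : ENNReal.ofReal s ≠ 0 := by simpa using hs
    refine le_trans ?_ (hν.weak_type hn (h := A.indicator g) ?_ (s := ENNReal.ofReal (s / 2))
      (by simpa using hs) (by simp))
    · rw [Measure.restrict_apply (measurableSet_lt measurable_const
        (measurable_ballAverage hg).ennreal_toReal)]
      refine measure_mono fun p hp => ?_
      have hp0 : 0 < p.1 := hp.2.1
      refine ⟨hp0, ?_⟩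
      have hp1 : ENNReal.ofReal s < ballAverage g p :=
        (ENNReal.ofReal_lt_iff_lt_toReal hs.le (hfin p)).2 hp.1
      have hsplit : ballAverage g p ≤ ballAverage (A.indicator g) p + ENNReal.ofReal (s / 2) := by
        have hle : ∀ y, g y ≤ A.indicator g y + ENNReal.ofReal s / (2 * v) := fun y => by
          by_cases hy : y ∈ A
          · rw [Set.indicator_of_mem hy]; exact le_self_add
          · rw [Set.indicator_of_notMem hy, zero_add, ENNReal.le_div_iff_mul_le
              (Or.inl (by simp [hv0])) (Or.inl (ENNReal.mul_ne_top (by simp) hvt)), mul_comm]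
            exact not_lt.1 hy
        calc ballAverage g p
            ≤ ENNReal.ofReal (p.1 ^ n)⁻¹ * ∫⁻ y in Metric.closedBall p.2 p.1,
                (A.indicator g y + ENNReal.ofReal s / (2 * v)) := by
              unfold ballAverage; gcongr with y; exact hle y
          _ = ballAverage (A.indicator g) p + ENNReal.ofReal (p.1 ^ n)⁻¹ *
                (ENNReal.ofReal s / (2 * v) * (ENNReal.ofReal (p.1 ^ n) * v)) := by
              rw [lintegral_add_right _ measurable_const, mul_add, setLIntegral_const,
                volume_closedBall_eq _ hp0.le]
              rfl
          _ = _ := by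
              congr 1
              rw [ENNReal.ofReal_inv_of_pos (pow_pos hp0 n), div_eq_mul_inv,
                ENNReal.mul_inv (Or.inl (by simp)) (Or.inl (by simp)),
                ENNReal.ofReal_div_of_pos two_pos, div_eq_mul_inv]
              have h0 : ENNReal.ofReal (p.1 ^ n) ≠ 0 := by
                have := pow_pos hp0 n
                simpa using this
              calc _ = ((ENNReal.ofReal (p.1 ^ n))⁻¹ * ENNReal.ofReal (p.1 ^ n)) * (v⁻¹ * v) *
                    (ENNReal.ofReal s * 2⁻¹) := by ring
                _ = _ := by
                  rw [ENNReal.inv_mul_cancel h0 (by simp), ENNReal.inv_mul_cancel hv0 hvt]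
                  simp
      have h2 := hp1.trans_le hsplit
      have h3 : ENNReal.ofReal s = ENNReal.ofReal (s / 2) + ENNReal.ofReal (s / 2) := by
        rw [← ENNReal.ofReal_add (by positivity) (by positivity)]; congr 1; ring
      rw [h3] at h2
      exact lt_of_add_lt_add_right h2
    -- The truncation is integrable because on `A` one has `g ≤ s⁻¹ · 2 v g²`.
    · refine ne_top_of_le_ne_top (ENNReal.mul_ne_top
        (ENNReal.mul_ne_top (ENNReal.inv_ne_top.2 hs0) (ENNReal.mul_ne_top (by simp) hvt)) hgi)
        (b := (ENNReal.ofReal s)⁻¹ * (2 * v) * ∫⁻ y, g y ^ 2) ?_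
      rw [← lintegral_const_mul _ (hg.pow_const 2)]
      refine lintegral_mono fun y => ?_
      by_cases hy : y ∈ A
      · rw [Set.indicator_of_mem hy]
        calc g y = (ENNReal.ofReal s)⁻¹ * ENNReal.ofReal s * g y := by
              rw [ENNReal.inv_mul_cancel hs0 (by simp), one_mul]
          _ ≤ (ENNReal.ofReal s)⁻¹ * (2 * v * g y) * g y := by
              gcongr; exact le_of_lt hy
          _ = _ := by ring
      · rw [Set.indicator_of_notMem hy]; exact zero_le
  -- Layer cake for the square; the factor `s` it carries cancels the `s⁻¹` of the weak-type bound.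
  have hlayer := lintegral_rpow_eq_lintegral_meas_lt_mul (ν.restrict T)
    (f := fun p => (ballAverage g p).toReal) (Eventually.of_forall fun p => ENNReal.toReal_nonneg)
    (measurable_ballAverage hg).ennreal_toReal.aemeasurable (p := 2) two_pos
  have hind : Measurable (Function.uncurry fun (s : ℝ) (y : 𝔼 n) =>
      {y | ENNReal.ofReal s < 2 * v * g y}.indicator g y) := by
    have hs : MeasurableSet {q : ℝ × 𝔼 n | ENNReal.ofReal q.1 < 2 * v * g q.2} :=
      measurableSet_lt (by fun_prop) (by fun_prop)
    exact (hg.comp measurable_snd).indicator hs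
  calc ∫⁻ p in T, ballAverage g p ^ 2 ∂ν
      = ∫⁻ p in T, ENNReal.ofReal ((ballAverage g p).toReal ^ (2 : ℝ)) ∂ν := by
        congr 1 with p
        rw [Real.rpow_two, ENNReal.ofReal_pow ENNReal.toReal_nonneg, ENNReal.ofReal_toReal (hfin p)]
    _ = ENNReal.ofReal 2 * ∫⁻ s in Set.Ioi (0 : ℝ),
          ν.restrict T {p | s < (ballAverage g p).toReal} * ENNReal.ofReal (s ^ ((2 : ℝ) - 1)) :=
        hlayer
    _ ≤ ENNReal.ofReal 2 * ∫⁻ s in Set.Ioi (0 : ℝ), c * 3 ^ n * 2 *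
          ∫⁻ y, {y | ENNReal.ofReal s < 2 * v * g y}.indicator g y := by
        refine mul_le_mul_right ?_ _
        refine setLIntegral_mono' measurableSet_Ioi fun s hs => ?_
        have hs : 0 < s := hs
        have e : (2 : ℝ) - 1 = 1 := by norm_num
        rw [e, Real.rpow_one]
        refine (mul_le_mul_left (hkey s hs) _).trans_eq ?_
        have h0 : ENNReal.ofReal s ≠ 0 := by simpa using hs
        rw [ENNReal.ofReal_div_of_pos two_pos, ENNReal.inv_div (by simp) (by simp), div_eq_mul_inv]
        simp only [ENNReal.ofReal_ofNat]
        set X := ∫⁻ y, {y | ENNReal.ofReal s < 2 * v * g y}.indicator g y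
        calc _ = ((ENNReal.ofReal s)⁻¹ * ENNReal.ofReal s) * (c * 3 ^ n * 2 * X) := by ring
          _ = _ := by rw [ENNReal.inv_mul_cancel h0 (by simp), one_mul]
    _ = 4 * 3 ^ n * c * ∫⁻ y, ∫⁻ s in Set.Ioi (0 : ℝ),
          {y | ENNReal.ofReal s < 2 * v * g y}.indicator g y := by
        rw [lintegral_const_mul _ hind.lintegral_prod_right, lintegral_lintegral_swap
          hind.aemeasurable]
        simp only [ENNReal.ofReal_ofNat]
        ring
    _ ≤ 4 * 3 ^ n * c * ∫⁻ y, 2 * v * g y ^ 2 := by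
        gcongr with y
        -- For fixed `y` the admissible levels form an interval of length `2 v g(y)`, so the inner
        -- integral yields `2 v g(y)²`.
        have h1 : ∀ s : ℝ, {y | ENNReal.ofReal s < 2 * v * g y}.indicator g y =
            {s : ℝ | ENNReal.ofReal s < 2 * v * g y}.indicator (fun _ => g y) s := fun s => rfl
        simp only [h1]
        rw [lintegral_indicator_const (measurableSet_lt (by fun_prop) measurable_const)]
        rcases eq_or_ne (2 * v * g y) ⊤ with ht | ht
        · rcases eq_or_ne (g y) 0 with h0 | h0
          · simp [h0]
          · calc _ ≤ (⊤ : ℝ≥0∞) := le_top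
              _ = _ := by rw [sq, ← mul_assoc, ht, ENNReal.top_mul h0]
        · rw [Measure.restrict_apply (measurableSet_lt (by fun_prop) measurable_const)]
          have h2 : {s : ℝ | ENNReal.ofReal s < 2 * v * g y} ∩ Set.Ioi 0 ⊆
              Set.Ioo 0 (2 * v * g y).toReal := fun s hs =>
            ⟨hs.2, (ENNReal.ofReal_lt_iff_lt_toReal (le_of_lt hs.2) ht).1 hs.1⟩
          calc _ ≤ g y * volume (Set.Ioo 0 (2 * v * g y).toReal) := by gcongr
            _ = g y * (2 * v * g y) := by
              rw [Real.volume_Ioo, sub_zero, ENNReal.ofReal_toReal ht]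
            _ = _ := by ring
    _ = _ := by
        rw [lintegral_const_mul _ (hg.pow_const 2)]
        ring

end Carleson

theorem add_sq_le_two_mul (a b : ℝ≥0∞) : (a + b) ^ 2 ≤ 2 * a ^ 2 + 2 * b ^ 2 := by
  have h := ENNReal.rpow_add_le_mul_rpow_add_rpow a b (p := 2) one_le_two
  norm_num at h
  rwa [mul_add] at h

/-! ### A compactly supported approximation of the identity. -/

section HatKernel

variable {n : ℕ}

/-- The integral of the hat function `max (0, 1 - |w|)`. -/
noncomputable def hatMass (n : ℕ) : ℝ := ∫ w : 𝔼 n, max 0 (1 - ‖w‖)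

theorem hatMass_pos (n : ℕ) : 0 < hatMass n := by
  have hc : Continuous fun w : 𝔼 n => max 0 (1 - ‖w‖) := by fun_prop
  refine hc.integral_pos_of_hasCompactSupport_nonneg_nonzero ?_ (fun w => le_max_left _ _)
    (x := 0) (by simp)
  refine HasCompactSupport.of_support_subset_isCompact
    (isCompact_closedBall (0 : 𝔼 n) 1) ?_
  intro w hw
  by_contra hcon
  refine hw (max_eq_left ?_)
  simp at hcon
  linarith

/-- A compactly supported Lipschitz approximation of the identity. -/
noncomputable def hatKernel (n : ℕ) (t : ℝ) (x y : 𝔼 n) : ℂ :=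
  (((hatMass n)⁻¹ * ((t ^ n)⁻¹ * max 0 (1 - ‖t⁻¹ • (x - y)‖)) : ℝ) : ℂ)

theorem hat_le {a : ℝ} (ha : 0 ≤ a) : max 0 (1 - a) ≤ 2 ^ (n + 1) * ((1 + a) ^ (n + 1))⁻¹ := by
  refine max_le (by positivity) ?_
  rcases le_or_gt 1 a with h | h
  · exact (sub_nonpos.2 h).trans (by positivity)
  · rw [← div_eq_mul_inv, le_div_iff₀ (by positivity)]
    have : (1 + a) ^ (n + 1) ≤ 2 ^ (n + 1) := by gcongr; linarith
    nlinarith [pow_pos (show 0 < 1 + a by linarith) (n + 1)]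

/-- The hat is 1-Lipschitz with values in `[0, 1]`, hence its increments are at most `min(d, 1) ≤
√d`. They vanish unless the smaller argument is below `1`, and there the decay weight is at least
`2^{-(n+1)}`. -/
theorem hat_sub_hat_le {a b d : ℝ} (ha : 0 ≤ a) (hb : 0 ≤ b) (hd : |a - b| ≤ d) :
    |max 0 (1 - a) - max 0 (1 - b)| ≤
      2 ^ (n + 1) * √d * (((1 + a) ^ (n + 1))⁻¹ + ((1 + b) ^ (n + 1))⁻¹) := by
  wlog hab : a ≤ b generalizing a b
  · rw [abs_sub_comm, add_comm (((1 + a) ^ (n + 1))⁻¹)]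
    exact this hb ha (by rwa [abs_sub_comm]) (le_of_not_ge hab)
  have hd0 : 0 ≤ d := (abs_nonneg _).trans hd
  rcases le_or_gt 1 a with h | h
  · rw [max_eq_left (by linarith), max_eq_left (by linarith)]
    simp only [sub_self, abs_zero]
    positivity
  have h1 : |max 0 (1 - a) - max 0 (1 - b)| ≤ d := by
    refine (abs_max_sub_max_le_max _ _ _ _).trans ?_
    simp only [sub_self, abs_zero, sub_sub_sub_cancel_left]
    exact max_le hd0 (by rwa [abs_sub_comm])
  have h2 : |max 0 (1 - a) - max 0 (1 - b)| ≤ 1 := by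
    rw [abs_le]
    constructor
    · have : max 0 (1 - b) ≤ 1 := max_le zero_le_one (by linarith)
      have := le_max_left 0 (1 - a)
      linarith
    · have : max 0 (1 - a) ≤ 1 := max_le zero_le_one (by linarith)
      have := le_max_left 0 (1 - b)
      linarith
  have h3 : |max 0 (1 - a) - max 0 (1 - b)| ≤ √d := by
    rcases le_total d 1 with hd1 | hd1
    · refine h1.trans ?_
      exact Real.le_sqrt_of_sq_le (by nlinarith)
    · exact h2.trans (by rwa [Real.one_le_sqrt])
  have h4 : 1 ≤ 2 ^ (n + 1) * ((1 + a) ^ (n + 1))⁻¹ := by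
    rw [← div_eq_mul_inv, le_div_iff₀ (by positivity), one_mul]
    gcongr
    linarith
  have h5 : 0 ≤ 2 ^ (n + 1) * √d * ((1 + b) ^ (n + 1))⁻¹ := by positivity
  calc _ ≤ √d * 1 := by rw [mul_one]; exact h3
    _ ≤ √d * (2 ^ (n + 1) * ((1 + a) ^ (n + 1))⁻¹) := by gcongr
    _ ≤ _ := by nlinarith

theorem norm_smul_inv {t : ℝ} (ht : 0 < t) (w : 𝔼 n) : ‖t⁻¹ • w‖ = ‖w‖ / t := by
  rw [norm_smul, Real.norm_of_nonneg (by positivity), inv_mul_eq_div]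

theorem isStdKernel_hatKernel (n : ℕ) : IsStdKernel (hatKernel n) ((hatMass n)⁻¹ * 2 ^ (n + 1)) where
  nonneg := by have := hatMass_pos n; positivity
  meas := by unfold hatKernel; fun_prop
  size t ht x y := by
    have hm := hatMass_pos n
    rw [hatKernel, Complex.norm_real, Real.norm_of_nonneg (by positivity), envelope,
      norm_smul_inv ht, mul_assoc, mul_left_comm (2 ^ (n + 1))]
    gcongr
    exact hat_le (by positivity)
  reg t ht x y y' := by
    have hm := hatMass_pos n
    rw [hatKernel, hatKernel, ← Complex.ofReal_sub, Complex.norm_real, ← mul_sub, ← mul_sub,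
      norm_mul, norm_mul, Real.norm_of_nonneg (by positivity), Real.norm_of_nonneg (by positivity),
      Real.norm_eq_abs, envelope, envelope, norm_smul_inv ht, norm_smul_inv ht]
    have h : |‖x - y‖ / t - ‖x - y'‖ / t| ≤ ‖y - y'‖ / t := by
      rw [← sub_div, abs_div, abs_of_pos ht]
      gcongr
      refine (abs_norm_sub_norm_le _ _).trans_eq ?_
      rw [sub_sub_sub_cancel_left, norm_sub_rev]
    have := hat_sub_hat_le (n := n) (by positivity) (by positivity) h
    calc _ ≤ (hatMass n)⁻¹ * ((t ^ n)⁻¹ * (2 ^ (n + 1) * √(‖y - y'‖ / t) *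
          (((1 + ‖x - y‖ / t) ^ (n + 1))⁻¹ + ((1 + ‖x - y'‖ / t) ^ (n + 1))⁻¹))) := by gcongr
      _ = _ := by ring

theorem integral_hatKernel {t : ℝ} (ht : 0 < t) (x : 𝔼 n) : ∫ y, hatKernel n t x y = 1 := by
  have h1 : ∫ y, hatKernel n t x y = ((∫ y : 𝔼 n, (hatMass n)⁻¹ * ((t ^ n)⁻¹ *
      max 0 (1 - ‖t⁻¹ • (x - y)‖)) : ℝ) : ℂ) := integral_ofReal
  rw [h1, integral_const_mul, integral_const_mul,
    integral_sub_left_eq_self (fun w => max 0 (1 - ‖t⁻¹ • w‖)) volume x,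
    Measure.integral_comp_inv_smul_of_nonneg volume (fun w => max 0 (1 - ‖w‖)) ht.le]
  rw [← hatMass]
  have := hatMass_pos n
  simp only [finrank_euclideanSpace, Fintype.card_fin, smul_eq_mul]
  have ht' : t ^ n ≠ 0 := by positivity
  field_simp
  simp

/-- Compact support lets plain ball averages dominate, which is the form the Carleson embedding
accepts. -/
theorem enorm_kernelOp_hatKernel_le {t : ℝ} (ht : 0 < t) (f : 𝔼 n → ℂ) (x : 𝔼 n) :
    ‖kernelOp volume (hatKernel n t) f x‖ₑ ≤
      ENNReal.ofReal (hatMass n)⁻¹ * ballAverage (fun y => ‖f y‖ₑ) (t, x) := by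
  have hm := hatMass_pos n
  refine (enorm_integral_le_lintegral_enorm _).trans ?_
  rw [ballAverage, ← mul_assoc, ← ENNReal.ofReal_mul (by positivity),
    ← lintegral_const_mul' _ _ (by simp),
    ← lintegral_indicator Metric.isClosed_closedBall.measurableSet]
  refine lintegral_mono fun y => ?_
  rw [enorm_mul]
  by_cases hy : y ∈ Metric.closedBall x t
  · rw [Set.indicator_of_mem hy]
    gcongr
    refine enorm_le_ofReal ?_
    rw [hatKernel, Complex.norm_real, Real.norm_of_nonneg (by positivity), ← mul_assoc]
    refine mul_le_of_le_one_right (by positivity) (max_le zero_le_one ?_)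
    have := norm_nonneg (t⁻¹ • (x - y))
    linarith
  · rw [Set.indicator_of_notMem hy]
    have : hatKernel n t x y = 0 := by
      rw [hatKernel, norm_smul_inv ht, max_eq_left]
      · simp
      · rw [Metric.mem_closedBall, dist_comm, dist_eq_norm, not_le] at hy
        have := (one_lt_div ht).2 hy
        linarith
    simp [this]

end HatKernel

/-! ### The T1 theorem for square functions. -/

section TOne

variable {n : ℕ} {k : ℝ → 𝔼 n → 𝔼 n → ℂ} {B : ℝ}

theorem IsStdKernel.measurable_integral (hk : IsStdKernel k B) :
    Measurable fun p : ℝ × 𝔼 n => ∫ y, k p.1 p.2 y := by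
  have hm : Measurable fun q : (ℝ × 𝔼 n) × 𝔼 n => k q.1.1 q.1.2 q.2 :=
    hk.meas.comp (measurable_fst.fst.prodMk (measurable_fst.snd.prodMk measurable_snd))
  exact hm.stronglyMeasurable.integral_prod_right'.measurable

theorem IsStdKernel.measurable_kernelOp (hk : IsStdKernel k B) (t : ℝ) {f : 𝔼 n → ℂ}
    (hf : AEStronglyMeasurable f volume) : Measurable (kernelOp volume (k t) f) :=
  (measurable_kernelOp_uncurry hk.meas hf).comp measurable_prodMk_left

theorem IsStdKernel.integrable (hk : IsStdKernel k B) {t : ℝ} (ht : 0 < t) (x : 𝔼 n) :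
    Integrable (k t x) := by
  refine ⟨(hk.isSchur ht).meas.of_uncurry_left.aestronglyMeasurable, ?_⟩
  rw [hasFiniteIntegral_iff_enorm]
  exact ((hk.isSchur ht).row x).trans_lt (schurConst_ne_top B).lt_top

theorem IsStdKernel.norm_integral_le (hk : IsStdKernel k B) {t : ℝ} (ht : 0 < t) (x : 𝔼 n) :
    ‖∫ y, k t x y‖ ≤ B * (envMoment n).toReal := by
  have h := (enorm_integral_le_lintegral_enorm _).trans ((hk.isSchur ht).row x)
  have h2 := ENNReal.toReal_mono (schurConst_ne_top B) h
  simpa [ENNReal.toReal_ofReal hk.nonneg] using h2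

/-- The measure `|T_t 1 (x)|² dx dt / t`. -/
noncomputable def carlesonMeasure (k : ℝ → 𝔼 n → 𝔼 n → ℂ) : Measure (ℝ × 𝔼 n) :=
  ((volume.restrict (Set.Ioi 0)).prod volume).withDensity
    fun p => ‖∫ y, k p.1 p.2 y‖ₑ ^ 2 * ENNReal.ofReal p.1⁻¹

/-- A `T1` theorem for square functions: a family of standard kernels is bounded as soon as it
sends the constant function `1` to a Carleson measure. -/
theorem exists_squareFn_le_of_carleson (n : ℕ) (hn : n ≠ 0) (D : ℝ) (hD : 0 ≤ D) :
    ∃ C : ℝ, 0 ≤ C ∧ ∀ (k : ℝ → 𝔼 n → 𝔼 n → ℂ) (B : ℝ),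
      IsStdKernel k B → IsCarleson (carlesonMeasure k) (ENNReal.ofReal (D * B ^ 2)) →
      ∀ f : 𝔼 n → ℂ, Measurable f → MemLp f 2 volume →
      squareFn k f ≤ ENNReal.ofReal (C * B ^ 2) * ∫⁻ x, ‖f x‖ₑ ^ 2 := by
  obtain ⟨C₀, hC₀, hcancel⟩ := exists_squareFn_le_of_cancel n
  set h := (hatMass n)⁻¹ with hh
  have hh0 : 0 ≤ h := by have := hatMass_pos n; positivity
  set I := (envMoment n).toReal with hI
  set v := (volume (Metric.closedBall (0 : 𝔼 n) 1)).toReal with hv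
  have hvt : volume (Metric.closedBall (0 : 𝔼 n) 1) = ENNReal.ofReal v :=
    (ENNReal.ofReal_toReal measure_closedBall_lt_top.ne).symm
  refine ⟨2 * (C₀ * (1 + I * (h * 2 ^ (n + 1))) ^ 2) + 2 * (h ^ 2 * (8 * 3 ^ n * v * D)),
    by positivity, fun k B hk hcar f hf hf2 => ?_⟩
  have hB := hk.nonneg
  have hβ := hk.measurable_integral
  have hP := isStdKernel_hatKernel n
  -- `R_t = T_t - (T_t 1) P_t` kills constants because `P_t 1 = 1`. It is still standard: regularity
  -- is asked only in the second variable, so the coefficient `T_t 1 (x)` need only be measurable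
  -- and bounded.
  set R : ℝ → 𝔼 n → 𝔼 n → ℂ := fun t x y => k t x y - (∫ z, k t x z) * hatKernel n t x y with hR
  have hRstd : IsStdKernel R (B * (1 + I * (h * 2 ^ (n + 1)))) := by
    refine ⟨by positivity, ?_, fun t ht x y => ?_, fun t ht x y y' => ?_⟩
    · exact hk.meas.sub ((hβ.comp (measurable_fst.prodMk measurable_snd.fst)).mul hP.meas)
    · refine (norm_sub_le _ _).trans ?_
      rw [norm_mul]
      have := mul_le_mul (hk.norm_integral_le ht x) (hP.size t ht x y) (norm_nonneg _)
        (by positivity)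
      have := hk.size t ht x y
      calc _ ≤ B * envelope t (x - y) + B * I * (h * 2 ^ (n + 1) * envelope t (x - y)) := by
            gcongr
        _ = _ := by ring
    · have e : R t x y - R t x y' = (k t x y - k t x y') -
          (∫ z, k t x z) * (hatKernel n t x y - hatKernel n t x y') := by simp only [hR]; ring
      rw [e]
      refine (norm_sub_le _ _).trans ?_
      rw [norm_mul]
      have h1 := mul_le_mul (hk.norm_integral_le ht x) (hP.reg t ht x y y') (norm_nonneg _)
        (by positivity)
      have h2 := hk.reg t ht x y y'
      refine (add_le_add h2 h1).trans_eq ?_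
      ring
  have hRcancel : ∀ t, 0 < t → ∀ x, ∫ y, R t x y = 0 := fun t ht x => by
    simp only [hR]
    rw [integral_sub (hk.integrable ht x) ((hP.integrable ht x).const_mul _), integral_const_mul,
      integral_hatKernel ht, mul_one, sub_self]
  have hsplit : ∀ t, 0 < t → ∫⁻ x, ‖kernelOp volume (k t) f x‖ₑ ^ 2 ≤
      2 * (∫⁻ x, ‖kernelOp volume (R t) f x‖ₑ ^ 2) + 2 * (ENNReal.ofReal (h ^ 2) *
        ∫⁻ x, ‖∫ y, k t x y‖ₑ ^ 2 * ballAverage (fun y => ‖f y‖ₑ) (t, x) ^ 2) := fun t ht => by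
    have hm := hRstd.measurable_kernelOp t hf.aestronglyMeasurable
    rw [← lintegral_const_mul' _ _ (by simp), ← lintegral_const_mul' _ _ (by simp),
      ← lintegral_const_mul' 2 _ (by simp), ← lintegral_add_left ((hm.enorm.pow_const 2).const_mul 2)]
    refine lintegral_mono_ae ?_
    filter_upwards [(hk.isSchur ht).ae_integrable (schurConst_ne_top B) hf2,
      (hP.isSchur ht).ae_integrable (schurConst_ne_top _) hf2] with x hx1 hx2
    have e : kernelOp volume (k t) f x = kernelOp volume (R t) f x +
        (∫ y, k t x y) * kernelOp volume (hatKernel n t) f x := by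
      simp only [kernelOp, hR, sub_mul, mul_assoc]
      rw [integral_sub hx1 (hx2.const_mul _), integral_const_mul]
      ring
    rw [e]
    refine (pow_le_pow_left₀ zero_le (enorm_add_le _ _) 2).trans ((add_sq_le_two_mul _ _).trans ?_)
    gcongr
    calc ‖(∫ y, k t x y) * kernelOp volume (hatKernel n t) f x‖ₑ ^ 2
        ≤ (‖∫ y, k t x y‖ₑ * (ENNReal.ofReal h * ballAverage (fun y => ‖f y‖ₑ) (t, x))) ^ 2 := by
          rw [enorm_mul]
          gcongr
          exact enorm_kernelOp_hatKernel_le ht f x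
      _ = _ := by
          rw [ENNReal.ofReal_pow hh0]
          ring
  have hfin := lintegral_enorm_sq_lt_top hf2
  -- The term `(T_t 1) P_t f` is bounded by ball averages of `|f|` in `L²` of the Carleson measure.
  have hcarl : ∫⁻ t in Set.Ioi (0 : ℝ), (∫⁻ x, ‖∫ y, k t x y‖ₑ ^ 2 *
      ballAverage (fun y => ‖f y‖ₑ) (t, x) ^ 2) * ENNReal.ofReal t⁻¹ ≤
      ENNReal.ofReal (8 * 3 ^ n * v * D * B ^ 2) * ∫⁻ x, ‖f x‖ₑ ^ 2 := by
    have h1 := hcar.lintegral_sq_le hn hf.enorm hfin.ne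
    have hd : Measurable fun p : ℝ × 𝔼 n => ‖∫ y, k p.1 p.2 y‖ₑ ^ 2 * ENNReal.ofReal p.1⁻¹ :=
      (hβ.enorm.pow_const 2).mul (by fun_prop)
    have hb := (measurable_ballAverage hf.enorm).pow_const 2
    have e : ((volume.restrict (Set.Ioi (0 : ℝ))).prod (volume : Measure (𝔼 n))).restrict
        (Set.Ioi 0 ×ˢ Set.univ) = (volume.restrict (Set.Ioi (0 : ℝ))).prod volume := by
      rw [← Measure.prod_restrict, Measure.restrict_univ,
        Measure.restrict_restrict measurableSet_Ioi, Set.inter_self]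
    rw [carlesonMeasure, restrict_withDensity (measurableSet_Ioi.prod MeasurableSet.univ), e,
      lintegral_withDensity_eq_lintegral_mul _ hd hb,
      lintegral_prod _ (hd.mul hb).aemeasurable] at h1
    refine le_trans (le_of_eq ?_) (h1.trans_eq ?_)
    · refine lintegral_congr fun t => ?_
      rw [← lintegral_mul_const' _ _ (by simp)]
      refine lintegral_congr fun x => ?_
      simp only [Pi.mul_apply]
      ring
    · rw [hvt, mul_assoc (8 * 3 ^ n * v), ENNReal.ofReal_mul (p := 8 * 3 ^ n * v) (by positivity),
        ENNReal.ofReal_mul (p := 8 * 3 ^ n) (by positivity),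
        ENNReal.ofReal_mul (p := 8) (by positivity), ENNReal.ofReal_pow (p := 3) (by positivity)]
      simp only [ENNReal.ofReal_ofNat]
  have hR0 := hcancel R _ hRstd hRcancel f hf2
  have hmeas : Measurable fun t => 2 * (∫⁻ x, ‖kernelOp volume (R t) f x‖ₑ ^ 2) *
      ENNReal.ofReal t⁻¹ :=
    ((measurable_lintegral_kernelOp hRstd.meas hf.aestronglyMeasurable).const_mul 2).mul
      (by fun_prop)
  calc squareFn k f
      ≤ ∫⁻ t in Set.Ioi (0 : ℝ), (2 * (∫⁻ x, ‖kernelOp volume (R t) f x‖ₑ ^ 2) *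
          ENNReal.ofReal t⁻¹ + 2 * ENNReal.ofReal (h ^ 2) * ((∫⁻ x, ‖∫ y, k t x y‖ₑ ^ 2 *
            ballAverage (fun y => ‖f y‖ₑ) (t, x) ^ 2) * ENNReal.ofReal t⁻¹)) := by
        refine setLIntegral_mono' measurableSet_Ioi fun t ht => ?_
        refine (mul_le_mul_left (hsplit t ht) _).trans_eq ?_
        ring
    _ = 2 * squareFn R f + 2 * ENNReal.ofReal (h ^ 2) * ∫⁻ t in Set.Ioi (0 : ℝ),
          (∫⁻ x, ‖∫ y, k t x y‖ₑ ^ 2 * ballAverage (fun y => ‖f y‖ₑ) (t, x) ^ 2) *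
            ENNReal.ofReal t⁻¹ := by
        rw [lintegral_add_left hmeas, lintegral_const_mul' _ _ (by finiteness), squareFn,
          ← lintegral_const_mul' 2 _ (by simp)]
        simp only [mul_assoc]
    _ ≤ 2 * (ENNReal.ofReal (C₀ * (B * (1 + I * (h * 2 ^ (n + 1)))) ^ 2) * ∫⁻ x, ‖f x‖ₑ ^ 2) +
          2 * ENNReal.ofReal (h ^ 2) *
            (ENNReal.ofReal (8 * 3 ^ n * v * D * B ^ 2) * ∫⁻ x, ‖f x‖ₑ ^ 2) := by
        gcongr
    _ = _ := by
        generalize ∫⁻ x, ‖f x‖ₑ ^ 2 = F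
        have h2 : (2 : ℝ≥0∞) = ENNReal.ofReal 2 := by simp
        rw [h2, ← mul_assoc, ← mul_assoc (_ * _), ← add_mul, ← ENNReal.ofReal_mul (by positivity),
          ← ENNReal.ofReal_mul (by positivity), ← ENNReal.ofReal_mul (by positivity),
          ← ENNReal.ofReal_add (by positivity) (by positivity)]
        congr 2
        ring

end TOne

/-! ### The deformation `id - τ` and its Jacobian. -/

section Deformation

variable {n : ℕ}

/-- `|det A|` is the volume ratio of the image of the unit ball, and this image lies between the
balls of radii `1 - ε` and `1 + ε`. -/
theorem abs_det_bounds {A : 𝔼 n →L[ℝ] 𝔼 n} {ε : ℝ} (hε0 : 0 ≤ ε) (hε : ε ≤ 1 / 2)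
    (hA : ∀ x, ‖A x - x‖ ≤ ε * ‖x‖) : (1 - ε) ^ n ≤ |A.det| ∧ |A.det| ≤ (1 + ε) ^ n := by
  set v := volume (Metric.closedBall (0 : 𝔼 n) 1) with hv
  have hv0 : v ≠ 0 := (Metric.measure_closedBall_pos volume _ one_pos).ne'
  have hvt : v ≠ ⊤ := measure_closedBall_lt_top.ne
  have himg : volume (A '' Metric.closedBall 0 1) = ENNReal.ofReal |A.det| * v :=
    Measure.addHaar_image_continuousLinearMap _ _ _
  have hlow : ∀ x, (1 - ε) * ‖x‖ ≤ ‖A x‖ := fun x => by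
    have h1 := norm_sub_norm_le x (A x)
    rw [norm_sub_rev] at h1
    linarith [hA x]
  have hinj : Function.Injective A := by
    rw [injective_iff_map_eq_zero]
    intro x hx
    have h1 := hlow x
    rw [hx, norm_zero] at h1
    by_contra hne
    have := norm_pos_iff.2 hne
    nlinarith
  have hsurj : Function.Surjective A :=
    (LinearMap.injective_iff_surjective (f := (A : 𝔼 n →ₗ[ℝ] 𝔼 n))).1 hinj
  constructor
  · have hsub : Metric.closedBall (0 : 𝔼 n) (1 - ε) ⊆ A '' Metric.closedBall 0 1 := fun y hy => by
      obtain ⟨x, rfl⟩ := hsurj y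
      refine ⟨x, ?_, rfl⟩
      rw [mem_closedBall_zero_iff] at hy ⊢
      have := (hlow x).trans hy
      by_contra! hcon
      nlinarith
    have h := measure_mono (μ := volume) hsub
    rw [himg, volume_closedBall_eq _ (by linarith)] at h
    have h2 := (ENNReal.mul_le_mul_iff_left hv0 hvt).1 h
    rwa [ENNReal.ofReal_le_ofReal_iff (abs_nonneg _)] at h2
  · have hsub : A '' Metric.closedBall 0 1 ⊆ Metric.closedBall (0 : 𝔼 n) (1 + ε) := by
      rintro _ ⟨x, hx, rfl⟩
      rw [mem_closedBall_zero_iff] at hx ⊢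
      have h1 := norm_le_norm_add_norm_sub' (A x) x
      have := mul_le_mul_of_nonneg_left hx hε0
      linarith [hA x]
    have h := measure_mono (μ := volume) hsub
    rw [himg, volume_closedBall_eq _ (by linarith)] at h
    have h2 := (ENNReal.mul_le_mul_iff_left hv0 hvt).1 h
    rwa [ENNReal.ofReal_le_ofReal_iff (by positivity)] at h2

theorem one_add_pow_le {ε : ℝ} (hε0 : 0 ≤ ε) (hε : ε ≤ 1) (m : ℕ) :
    (1 + ε) ^ m ≤ 1 + m * 2 ^ m * ε := by
  induction m with
  | zero => simp
  | succ m ih =>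
    have h2 : (1 : ℝ) ≤ 2 ^ m := one_le_pow₀ one_le_two
    calc (1 + ε) ^ (m + 1) = (1 + ε) ^ m * (1 + ε) := pow_succ _ _
      _ ≤ (1 + m * 2 ^ m * ε) * (1 + ε) := by gcongr
      _ = 1 + ε + m * 2 ^ m * ε * (1 + ε) := by ring
      _ ≤ 1 + 2 ^ (m + 1) * ε + m * 2 ^ m * ε * 2 := by
          gcongr
          · have : ε ≤ 2 ^ (m + 1) * ε := le_mul_of_one_le_left hε0 (one_le_pow₀ one_le_two)
            exact this
          · linarith
      _ = _ := by push_cast; ring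

/-- A diffeomorphism `id - τ` with `‖Dτ‖ ≤ ε ≤ 1/2` in the operator norm. -/
structure IsSmallDeformation (τ : 𝔼 n → 𝔼 n) (ε : ℝ) : Prop where
  contDiff : ContDiff ℝ 1 τ
  nonneg : 0 ≤ ε
  le_half : ε ≤ 1 / 2
  norm_fderiv_le : ∀ x, ‖fderiv ℝ τ x‖ ≤ ε

/-- The map `x ↦ x - τ x`. -/
def warp (τ : 𝔼 n → 𝔼 n) (x : 𝔼 n) : 𝔼 n := x - τ x

/-- The derivative of `warp τ`. -/
noncomputable def warpDeriv (τ : 𝔼 n → 𝔼 n) (x : 𝔼 n) : 𝔼 n →L[ℝ] 𝔼 n :=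
  ContinuousLinearMap.id ℝ (𝔼 n) - fderiv ℝ τ x

/-- The Jacobian of `warp τ`. -/
noncomputable def jacobian (τ : 𝔼 n → 𝔼 n) (x : 𝔼 n) : ℝ := |(warpDeriv τ x).det|

namespace IsSmallDeformation

variable {τ : 𝔼 n → 𝔼 n} {ε : ℝ}

theorem differentiable (h : IsSmallDeformation τ ε) : Differentiable ℝ τ :=
  h.contDiff.differentiable (by norm_num)

theorem hasFDerivAt (h : IsSmallDeformation τ ε) (x : 𝔼 n) :
    HasFDerivAt (warp τ) (warpDeriv τ x) x :=
  (hasFDerivAt_id x).sub (h.differentiable x).hasFDerivAt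

theorem norm_sub_le (h : IsSmallDeformation τ ε) (x y : 𝔼 n) : ‖τ x - τ y‖ ≤ ε * ‖x - y‖ :=
  convex_univ.norm_image_sub_le_of_norm_fderiv_le (fun z _ => h.differentiable z)
    (fun z _ => h.norm_fderiv_le z) (Set.mem_univ y) (Set.mem_univ x)

theorem norm_warp_sub_le (h : IsSmallDeformation τ ε) (x y : 𝔼 n) :
    ‖(x - y) - (warp τ x - warp τ y)‖ ≤ ε * ‖x - y‖ := by
  have : (x - y) - (warp τ x - warp τ y) = τ x - τ y := by unfold warp; abel
  rw [this]
  exact h.norm_sub_le x y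

theorem continuous (h : IsSmallDeformation τ ε) : Continuous (warp τ) :=
  continuous_id.sub h.contDiff.continuous

theorem measurable (h : IsSmallDeformation τ ε) : Measurable (warp τ) := h.continuous.measurable

theorem antilipschitz (h : IsSmallDeformation τ ε) : AntilipschitzWith 2 (warp τ) := by
  refine AntilipschitzWith.of_le_mul_dist fun x y => ?_
  rw [dist_eq_norm, dist_eq_norm]
  have h1 := h.norm_warp_sub_le x y
  have h2 := norm_le_norm_add_norm_sub' (x - y) (warp τ x - warp τ y)
  have h3 := mul_le_mul_of_nonneg_right h.le_half (norm_nonneg (x - y))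
  simp only [NNReal.coe_ofNat]
  linarith

theorem injective (h : IsSmallDeformation τ ε) : Function.Injective (warp τ) :=
  h.antilipschitz.injective

/-- Solving `warp τ x = y` means finding a fixed point of the contraction `x ↦ y + τ x`. -/
theorem surjective (h : IsSmallDeformation τ ε) : Function.Surjective (warp τ) := fun y => by
  have hc : ContractingWith (1 / 2) fun x => y + τ x := by
    refine ⟨by rw [← NNReal.coe_lt_coe]; norm_num, LipschitzWith.of_dist_le_mul fun a b => ?_⟩
    rw [dist_eq_norm, dist_eq_norm, add_sub_add_left_eq_sub]
    refine (h.norm_sub_le a b).trans ?_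
    have := h.le_half
    push_cast
    gcongr
  refine ⟨hc.fixedPoint, ?_⟩
  have : y + τ hc.fixedPoint = hc.fixedPoint := hc.fixedPoint_isFixedPt
  rw [warp, sub_eq_iff_eq_add]
  exact this.symm

theorem exists_inverse (h : IsSmallDeformation τ ε) :
    ∃ H : 𝔼 n → 𝔼 n, Measurable H ∧ (∀ x, warp τ (H x) = x) ∧ ∀ x, H (warp τ x) = x := by
  refine ⟨Function.surjInv h.surjective, ?_, Function.surjInv_eq h.surjective,
    Function.leftInverse_surjInv ⟨h.injective, h.surjective⟩⟩
  exact (h.antilipschitz.to_rightInverse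
    (Function.rightInverse_surjInv h.surjective)).continuous.measurable

theorem continuous_jacobian (h : IsSmallDeformation τ ε) : Continuous (jacobian τ) := by
  have h1 : Continuous (warpDeriv τ) := continuous_const.sub (h.contDiff.continuous_fderiv (by norm_num))
  exact (ContinuousLinearMap.continuous_det.comp h1).abs

theorem jacobian_bounds (h : IsSmallDeformation τ ε) (x : 𝔼 n) :
    (1 - ε) ^ n ≤ jacobian τ x ∧ jacobian τ x ≤ (1 + ε) ^ n := by
  refine abs_det_bounds h.nonneg h.le_half fun w => ?_
  have : warpDeriv τ x w - w = -(fderiv ℝ τ x w) := by simp [warpDeriv]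
  rw [this, norm_neg]
  exact ContinuousLinearMap.le_of_opNorm_le _ (h.norm_fderiv_le x) w

/-- Bernoulli's inequality gives the lower side, `one_add_pow_le` the upper one. -/
theorem abs_jacobian_sub_one_le (h : IsSmallDeformation τ ε) (x : 𝔼 n) :
    |1 - jacobian τ x| ≤ n * 2 ^ n * ε := by
  have hε := h.nonneg
  have h2 := h.le_half
  have hb := h.jacobian_bounds x
  have h3 := one_add_pow_le hε (by linarith) n
  have h4 := one_add_mul_le_pow (show (-2 : ℝ) ≤ -ε by linarith) n
  rw [← sub_eq_add_neg] at h4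
  have h5 : n * ε ≤ n * 2 ^ n * ε := by
    gcongr
    exact le_mul_of_one_le_right (by positivity) (one_le_pow₀ one_le_two)
  rw [abs_le]
  constructor <;> linarith

theorem half_pow_le_jacobian (h : IsSmallDeformation τ ε) (x : 𝔼 n) :
    (1 / 2) ^ n ≤ jacobian τ x := by
  refine le_trans ?_ (h.jacobian_bounds x).1
  have := h.le_half
  gcongr
  linarith

theorem jacobian_pos (h : IsSmallDeformation τ ε) (x : 𝔼 n) : 0 < jacobian τ x :=
  lt_of_lt_of_le (by positivity) (h.half_pow_le_jacobian x)

theorem lintegral_comp (h : IsSmallDeformation τ ε) (F : 𝔼 n → ℝ≥0∞) :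
    ∫⁻ x, ENNReal.ofReal (jacobian τ x) * F (warp τ x) = ∫⁻ x, F x := by
  have := lintegral_image_eq_lintegral_abs_det_fderiv_mul volume MeasurableSet.univ
    (fun x _ => (h.hasFDerivAt x).hasFDerivWithinAt) h.injective.injOn F
  rw [Set.image_univ, h.surjective.range_eq, setLIntegral_univ, setLIntegral_univ] at this
  exact this.symm

theorem integral_comp (h : IsSmallDeformation τ ε) (F : 𝔼 n → ℂ) :
    ∫ x, (jacobian τ x : ℂ) * F (warp τ x) = ∫ x, F x := by
  have := integral_image_eq_integral_abs_det_fderiv_smul volume MeasurableSet.univ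
    (fun x _ => (h.hasFDerivAt x).hasFDerivWithinAt) h.injective.injOn F
  rw [Set.image_univ, h.surjective.range_eq, setIntegral_univ, setIntegral_univ] at this
  simpa [jacobian] using this.symm

theorem lintegral_comp_warp_le (h : IsSmallDeformation τ ε) (F : 𝔼 n → ℝ≥0∞) :
    ∫⁻ x, F (warp τ x) ≤ 2 ^ n * ∫⁻ x, F x := by
  rw [← h.lintegral_comp F, ← lintegral_const_mul' _ _ (by finiteness)]
  refine lintegral_mono fun x => ?_
  rw [← mul_assoc]
  refine le_mul_of_one_le_left zero_le ?_
  have h1 : (2 : ℝ≥0∞) ^ n = ENNReal.ofReal (2 ^ n) := by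
    rw [ENNReal.ofReal_pow (by norm_num)]; simp
  rw [h1, ← ENNReal.ofReal_mul (by positivity), ENNReal.one_le_ofReal]
  have := h.half_pow_le_jacobian x
  calc (1 : ℝ) = 2 ^ n * (1 / 2) ^ n := by rw [← mul_pow]; norm_num
    _ ≤ _ := by gcongr

end IsSmallDeformation

end Deformation

/-! ### Wavelet kernels, their transport and their difference. -/

section WaveletKernels

variable {n : ℕ}

theorem inv_one_add_pow_le {u v : ℝ} (hu : 0 ≤ u) (hv : 0 ≤ v) (h : u ≤ 2 * v + 1) (m : ℕ) :
    ((1 + v) ^ m)⁻¹ ≤ 2 ^ m * ((1 + u) ^ m)⁻¹ := by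
  rw [← div_eq_mul_inv, ← one_div, div_le_div_iff₀ (by positivity) (by positivity), one_mul,
    ← mul_pow]
  gcongr
  linarith

/-- Size and gradient bounds adapted to the scale `t` give Hölder continuity. -/
theorem norm_sub_le_of_fderiv_bound {g : 𝔼 n → ℂ} (hg : Differentiable ℝ g) {t b : ℝ} (ht : 0 < t)
    (hb : 0 ≤ b) (x : 𝔼 n) (h0 : ∀ y, ‖g y‖ ≤ b * ((1 + ‖x - y‖ / t) ^ (n + 1))⁻¹)
    (h1 : ∀ y, ‖fderiv ℝ g y‖ ≤ b / t * ((1 + ‖x - y‖ / t) ^ (n + 1))⁻¹) (y y' : 𝔼 n) :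
    ‖g y - g y'‖ ≤ b * 2 ^ (n + 1) * √(‖y - y'‖ / t) *
      (((1 + ‖x - y‖ / t) ^ (n + 1))⁻¹ + ((1 + ‖x - y'‖ / t) ^ (n + 1))⁻¹) := by
  set q : 𝔼 n → ℝ := fun y => ((1 + ‖x - y‖ / t) ^ (n + 1))⁻¹ with hq
  have hq0 : ∀ y, 0 ≤ q y := fun y => by positivity
  -- At distance at least `t` the size bound suffices; closer, the mean value inequality gives `|y -
  -- y'| / t`, which is below its square root.
  rcases le_or_gt t ‖y - y'‖ with hd | hd
  · have h2 : 1 ≤ √(‖y - y'‖ / t) := by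
      rw [Real.one_le_sqrt]
      exact (one_le_div ht).2 hd
    calc ‖g y - g y'‖ ≤ b * q y + b * q y' := (norm_sub_le _ _).trans (add_le_add (h0 y) (h0 y'))
      _ = b * 1 * 1 * (q y + q y') := by ring
      _ ≤ b * 2 ^ (n + 1) * √(‖y - y'‖ / t) * (q y + q y') := by
          have := hq0 y
          have := hq0 y'
          gcongr
          exact one_le_pow₀ one_le_two
  · have h2 : ‖g y - g y'‖ ≤ b / t * (2 ^ (n + 1) * q y) * ‖y - y'‖ := by
      refine (convex_closedBall y ‖y - y'‖).norm_image_sub_le_of_norm_fderiv_le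
        (fun z _ => hg z) (fun z hz => ?_) (x := y') (y := y) ?_ ?_
      · refine (h1 z).trans ?_
        gcongr
        refine inv_one_add_pow_le (by positivity) (by positivity) ?_ _
        rw [Metric.mem_closedBall, dist_eq_norm] at hz
        have h3 : ‖x - y‖ ≤ ‖x - z‖ + t := by
          have := norm_add_le (x - z) (z - y)
          rw [sub_add_sub_cancel] at this
          linarith
        have h4 : ‖x - y‖ / t ≤ ‖x - z‖ / t + 1 := by
          rw [div_add_one ht.ne']
          gcongr
        have : 0 ≤ ‖x - z‖ / t := by positivity
        linarith
      · rw [Metric.mem_closedBall, dist_comm, dist_eq_norm]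
      · rw [Metric.mem_closedBall, dist_self]
        positivity
    have h3 : ‖y - y'‖ / t ≤ √(‖y - y'‖ / t) := by
      refine Real.le_sqrt_of_sq_le ?_
      have h4 : ‖y - y'‖ / t ≤ 1 := (div_le_one ht).2 hd.le
      have : 0 ≤ ‖y - y'‖ / t := by positivity
      nlinarith
    calc ‖g y - g y'‖ ≤ b * 2 ^ (n + 1) * (‖y - y'‖ / t) * q y := h2.trans_eq (by ring)
      _ ≤ b * 2 ^ (n + 1) * √(‖y - y'‖ / t) * (q y + q y') := by
          have := hq0 y
          gcongr
          linarith [hq0 y']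

/-- Comparison of a decaying function at two nearby points. -/
theorem norm_sub_le_of_decay {F : Type*} [NormedAddCommGroup F] [NormedSpace ℝ F] {φ : 𝔼 n → F}
    (hφ : Differentiable ℝ φ) {A : ℝ} (hA : 0 ≤ A)
    (hd : ∀ x, ‖fderiv ℝ φ x‖ ≤ A / (1 + ‖x‖) ^ (n + 2)) {ε : ℝ} (hε0 : 0 ≤ ε) (hε : ε ≤ 1 / 2)
    {a b : 𝔼 n} (hab : ‖a - b‖ ≤ ε * ‖a‖) :
    ‖φ a - φ b‖ ≤ A * 2 ^ (n + 2) * ε * ((1 + ‖a‖) ^ (n + 1))⁻¹ := by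
  have h : ‖φ a - φ b‖ ≤ A * (2 ^ (n + 2) * ((1 + ‖a‖) ^ (n + 2))⁻¹) * ‖a - b‖ := by
    refine (convex_closedBall a (ε * ‖a‖)).norm_image_sub_le_of_norm_fderiv_le
      (fun z _ => hφ z) (fun z hz => ?_) (x := b) (y := a) ?_ ?_
    · refine (hd z).trans ?_
      rw [div_eq_mul_inv]
      gcongr
      refine inv_one_add_pow_le (by positivity) (by positivity) ?_ _
      rw [Metric.mem_closedBall, dist_comm, dist_eq_norm] at hz
      have h1 := norm_le_norm_add_norm_sub' a z
      have h2 := mul_le_mul_of_nonneg_right hε (norm_nonneg a)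
      linarith
    · rwa [Metric.mem_closedBall, dist_comm, dist_eq_norm]
    · rw [Metric.mem_closedBall, dist_self]
      positivity
  -- The displacement grows with `|a|` and costs one power of decay: from order `n + 2` to order `n
  -- + 1`.
  have h2 : ‖a - b‖ ≤ ε * (1 + ‖a‖) := hab.trans (by gcongr; linarith)
  calc _ ≤ A * (2 ^ (n + 2) * ((1 + ‖a‖) ^ (n + 2))⁻¹) * (ε * (1 + ‖a‖)) := h.trans (by gcongr)
    _ = _ := by
      have : (1 + ‖a‖) ≠ 0 := by positivity
      field_simp
      ring

/-- The kernel of the convolution with `t⁻ⁿ ψ(t⁻¹ ·)`. -/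
noncomputable def convKernel (ψ : 𝔼 n → ℂ) (t : ℝ) (x y : 𝔼 n) : ℂ :=
  (((t ^ n)⁻¹ : ℝ) : ℂ) * ψ (t⁻¹ • (x - y))

/-- The convolution kernel transported by the map `G`. -/
noncomputable def transportKernel (ψ : 𝔼 n → ℂ) (G : 𝔼 n → 𝔼 n) (t : ℝ) (x y : 𝔼 n) : ℂ :=
  convKernel ψ t (G x) (G y)

/-- The difference of the convolution kernel and its transport. -/
noncomputable def commKernel (ψ : 𝔼 n → ℂ) (G : 𝔼 n → 𝔼 n) (t : ℝ) (x y : 𝔼 n) : ℂ :=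
  convKernel ψ t x y - transportKernel ψ G t x y

namespace HasDecay

variable {A : ℝ} {ψ : 𝔼 n → ℂ}

theorem nonneg (h : HasDecay A ψ) : 0 ≤ A := by
  have := (norm_nonneg _).trans (h.bound_zero 0)
  simpa using this

theorem size (h : HasDecay A ψ) (w : 𝔼 n) : ‖ψ w‖ ≤ A * ((1 + ‖w‖) ^ (n + 1))⁻¹ := by
  have hA := h.nonneg
  refine (h.bound_zero w).trans ?_
  rw [div_eq_mul_inv]
  gcongr 2
  exact pow_le_pow_right₀ (by linarith [norm_nonneg w]) (by omega)

theorem grad_size (h : HasDecay A ψ) (w : 𝔼 n) :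
    ‖fderiv ℝ ψ w‖ ≤ A * ((1 + ‖w‖) ^ (n + 1))⁻¹ := by
  have hA := h.nonneg
  refine (h.bound_one w).trans ?_
  rw [div_eq_mul_inv]
  gcongr 2
  exact pow_le_pow_right₀ (by linarith [norm_nonneg w]) (by omega)

theorem hasFDerivAt_scaled (h : HasDecay A ψ) {G : 𝔼 n → 𝔼 n} {G' : 𝔼 n →L[ℝ] 𝔼 n} {y : 𝔼 n}
    (hG : HasFDerivAt G G' y) (t : ℝ) (z : 𝔼 n) :
    HasFDerivAt (fun y => ψ (t⁻¹ • (z - G y)))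
      ((fderiv ℝ ψ (t⁻¹ • (z - G y))).comp (t⁻¹ • (-G'))) y := by
  have h1 : HasFDerivAt (fun y => t⁻¹ • (z - G y)) (t⁻¹ • (-G')) y :=
    (hG.const_sub z).const_smul t⁻¹
  exact (h.differentiable _).hasFDerivAt.comp y h1

theorem measurable (h : HasDecay A ψ) : Measurable ψ := h.differentiable.continuous.measurable

theorem measurable_convKernel (h : HasDecay A ψ) :
    Measurable fun p : ℝ × 𝔼 n × 𝔼 n => convKernel ψ p.1 p.2.1 p.2.2 := by
  have := h.measurable
  unfold convKernel
  fun_prop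

theorem measurable_transportKernel (h : HasDecay A ψ) {G : 𝔼 n → 𝔼 n} (hG : Measurable G) :
    Measurable fun p : ℝ × 𝔼 n × 𝔼 n => transportKernel ψ G p.1 p.2.1 p.2.2 :=
  h.measurable_convKernel.comp (measurable_fst.prodMk
    ((hG.comp measurable_snd.fst).prodMk (hG.comp measurable_snd.snd)))

theorem isStdKernel_convKernel (h : HasDecay A ψ) :
    IsStdKernel (convKernel ψ) (A * 2 ^ (n + 1)) where
  nonneg := by have := h.nonneg; positivity
  meas := h.measurable_convKernel
  size t ht x y := by
    have hA := h.nonneg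
    rw [convKernel, norm_mul, Complex.norm_real, Real.norm_of_nonneg (by positivity), envelope,
      mul_left_comm]
    gcongr
    refine (h.size _).trans ?_
    rw [norm_smul_inv ht]
    gcongr
    exact le_mul_of_one_le_right hA (one_le_pow₀ one_le_two)
  reg t ht x y y' := by
    have hA := h.nonneg
    have hd : ∀ y, HasFDerivAt (fun y => ψ (t⁻¹ • (x - y)))
        ((fderiv ℝ ψ (t⁻¹ • (x - y))).comp (t⁻¹ • (-ContinuousLinearMap.id ℝ (𝔼 n)))) y := fun y =>
      h.hasFDerivAt_scaled (hasFDerivAt_id y) t x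
    have hreg := norm_sub_le_of_fderiv_bound (fun y => (hd y).differentiableAt) ht hA x
      (fun y => by rw [← norm_smul_inv ht]; exact h.size _)
      (fun y => by
        rw [(hd y).fderiv, ← norm_smul_inv ht]
        refine (ContinuousLinearMap.opNorm_comp_le _ _).trans ?_
        have h1 : ‖t⁻¹ • (-ContinuousLinearMap.id ℝ (𝔼 n))‖ ≤ t⁻¹ := by
          rw [norm_smul, norm_neg, Real.norm_of_nonneg (by positivity)]
          exact mul_le_of_le_one_right (by positivity) ContinuousLinearMap.norm_id_le
        calc _ ≤ A * ((1 + ‖t⁻¹ • (x - y)‖) ^ (n + 1))⁻¹ * t⁻¹ := by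
              gcongr
              exact h.grad_size _
          _ = _ := by ring) y y'
    rw [convKernel, convKernel, ← mul_sub, norm_mul, Complex.norm_real,
      Real.norm_of_nonneg (by positivity), envelope, envelope]
    refine (mul_le_mul_of_nonneg_left hreg (by positivity)).trans_eq ?_
    ring

theorem norm_scaled_sub_le {τ : 𝔼 n → 𝔼 n} {ε : ℝ} (hτ : IsSmallDeformation τ ε) {t : ℝ}
    (ht : 0 < t) (x y : 𝔼 n) :
    ‖t⁻¹ • (x - y) - t⁻¹ • (warp τ x - warp τ y)‖ ≤ ε * ‖t⁻¹ • (x - y)‖ := by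
  rw [← smul_sub, norm_smul_inv ht, norm_smul_inv ht, ← mul_div_assoc]
  gcongr
  exact hτ.norm_warp_sub_le x y

theorem le_two_mul_of_norm_sub_le {a b : 𝔼 n} {ε : ℝ} (hε : ε ≤ 1 / 2) (h : ‖a - b‖ ≤ ε * ‖a‖) :
    ‖a‖ ≤ 2 * ‖b‖ := by
  have h1 := norm_le_norm_add_norm_sub' a b
  have h2 := mul_le_mul_of_nonneg_right hε (norm_nonneg a)
  linarith

theorem norm_transportKernel_le (h : HasDecay A ψ) {τ : 𝔼 n → 𝔼 n} {ε : ℝ}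
    (hτ : IsSmallDeformation τ ε) {t : ℝ} (ht : 0 < t) (x y : 𝔼 n) :
    ‖transportKernel ψ (warp τ) t x y‖ ≤ A * 2 ^ (n + 1) * envelope t (x - y) := by
  have hA := h.nonneg
  rw [transportKernel, convKernel, norm_mul, Complex.norm_real,
    Real.norm_of_nonneg (by positivity), envelope, mul_left_comm, mul_assoc]
  gcongr
  refine (h.size _).trans ?_
  gcongr
  rw [← norm_smul_inv ht]
  refine inv_one_add_pow_le (by positivity) (by positivity) ?_ _
  linarith [le_two_mul_of_norm_sub_le hτ.le_half (norm_scaled_sub_le hτ ht x y)]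

/-- The two arguments of `ψ` differ by at most `ε` relative to their size, so the difference gains
`ε` from `Dψ`. Its `y`-gradient gains `ε` from `D²ψ` and from the term with `Dτ`; since only one
derivative in `y` is taken, `D²τ` never appears. -/
theorem isStdKernel_commKernel (h : HasDecay A ψ) {τ : 𝔼 n → 𝔼 n} {ε : ℝ}
    (hτ : IsSmallDeformation τ ε) :
    IsStdKernel (commKernel ψ (warp τ)) (A * 2 ^ (n + 3) * 2 ^ (n + 1) * ε) := by
  have hA := h.nonneg
  have hε := hτ.nonneg
  have hmain : ∀ t, 0 < t → ∀ x y, ‖ψ (t⁻¹ • (x - y)) - ψ (t⁻¹ • (warp τ x - warp τ y))‖ ≤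
      A * 2 ^ (n + 3) * ε * ((1 + ‖x - y‖ / t) ^ (n + 1))⁻¹ := fun t ht x y => by
    refine (norm_sub_le_of_decay h.differentiable hA h.bound_one hε hτ.le_half
      (norm_scaled_sub_le hτ ht x y)).trans ?_
    rw [norm_smul_inv ht]
    gcongr <;> norm_num
  have heq : ∀ t x y, commKernel ψ (warp τ) t x y = (((t ^ n)⁻¹ : ℝ) : ℂ) *
      (ψ (t⁻¹ • (x - y)) - ψ (t⁻¹ • (warp τ x - warp τ y))) := fun t x y => by
    simp only [commKernel, transportKernel, convKernel]
    ring
  refine ⟨by positivity, ?_, fun t ht x y => ?_, fun t ht x y y' => ?_⟩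
  · exact h.measurable_convKernel.sub (h.measurable_transportKernel hτ.measurable)
  · rw [heq, norm_mul, Complex.norm_real, Real.norm_of_nonneg (by positivity), envelope,
      mul_left_comm]
    refine mul_le_mul_of_nonneg_left ((hmain t ht x y).trans ?_) (by positivity)
    refine mul_le_mul_of_nonneg_right ?_ (by positivity)
    refine mul_le_mul_of_nonneg_right ?_ hε
    exact le_mul_of_one_le_right (by positivity) (one_le_pow₀ one_le_two)
  · have hd : ∀ y, HasFDerivAt (fun y => ψ (t⁻¹ • (x - y)) - ψ (t⁻¹ • (warp τ x - warp τ y)))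
        ((fderiv ℝ ψ (t⁻¹ • (x - y))).comp (t⁻¹ • (-ContinuousLinearMap.id ℝ (𝔼 n))) -
          (fderiv ℝ ψ (t⁻¹ • (warp τ x - warp τ y))).comp (t⁻¹ • (-warpDeriv τ y))) y := fun y =>
      (h.hasFDerivAt_scaled (hasFDerivAt_id y) t x).sub
        (h.hasFDerivAt_scaled (hτ.hasFDerivAt y) t (warp τ x))
    have hreg := norm_sub_le_of_fderiv_bound (fun y => (hd y).differentiableAt) ht
      (b := A * 2 ^ (n + 3) * ε) (by positivity) x (hmain t ht x)
      (fun y => by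
        rw [(hd y).fderiv]
        set a := t⁻¹ • (x - y) with ha
        set b := t⁻¹ • (warp τ x - warp τ y) with hb
        have hab : ‖a - b‖ ≤ ε * ‖a‖ := norm_scaled_sub_le hτ ht x y
        have e : (fderiv ℝ ψ a).comp (t⁻¹ • (-ContinuousLinearMap.id ℝ (𝔼 n))) -
            (fderiv ℝ ψ b).comp (t⁻¹ • (-warpDeriv τ y)) =
            t⁻¹ • (-(fderiv ℝ ψ a - fderiv ℝ ψ b) - (fderiv ℝ ψ b).comp (fderiv ℝ τ y)) := by
          ext w
          simp [warpDeriv]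
          ring
        have h1 : ‖fderiv ℝ ψ a - fderiv ℝ ψ b‖ ≤
            A * 2 ^ (n + 2) * ε * ((1 + ‖a‖) ^ (n + 1))⁻¹ :=
          norm_sub_le_of_decay h.differentiable_fderiv hA h.bound_two hε hτ.le_half hab
        have h2 : ‖(fderiv ℝ ψ b).comp (fderiv ℝ τ y)‖ ≤
            A * 2 ^ (n + 2) * ε * ((1 + ‖a‖) ^ (n + 1))⁻¹ := by
          refine (ContinuousLinearMap.opNorm_comp_le _ _).trans ?_
          have h3 : ‖fderiv ℝ ψ b‖ ≤ A * (2 ^ (n + 2) * ((1 + ‖a‖) ^ (n + 1))⁻¹) := by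
            refine (h.grad_size b).trans ?_
            gcongr
            refine (inv_one_add_pow_le (norm_nonneg a) (norm_nonneg b) ?_ _).trans ?_
            · linarith [le_two_mul_of_norm_sub_le hτ.le_half hab]
            · gcongr <;> norm_num
          calc _ ≤ A * (2 ^ (n + 2) * ((1 + ‖a‖) ^ (n + 1))⁻¹) * ε := by
                gcongr
                exact hτ.norm_fderiv_le y
            _ = _ := by ring
        rw [e, norm_smul, Real.norm_of_nonneg (by positivity), ← norm_smul_inv ht]
        calc _ ≤ t⁻¹ * (A * 2 ^ (n + 2) * ε * ((1 + ‖a‖) ^ (n + 1))⁻¹ +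
              A * 2 ^ (n + 2) * ε * ((1 + ‖a‖) ^ (n + 1))⁻¹) := by
              gcongr
              refine (norm_sub_le _ _).trans ?_
              rw [norm_neg]
              exact add_le_add h1 h2
          _ = _ := by ring) y y'
    rw [heq, heq, ← mul_sub, norm_mul, Complex.norm_real, Real.norm_of_nonneg (by positivity),
      envelope, envelope]
    refine (mul_le_mul_of_nonneg_left hreg (by positivity)).trans_eq ?_
    ring

end HasDecay

end WaveletKernels

/-! ### Transported operators and the action of the difference kernel on constants. -/

section Commutator

variable {n : ℕ}

theorem HasDecay.integral_convKernel {A : ℝ} {ψ : 𝔼 n → ℂ} (_h : HasDecay A ψ)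
    (h0 : ∫ x, ψ x = 0) {t : ℝ} (ht : 0 < t) (x : 𝔼 n) : ∫ y, convKernel ψ t x y = 0 := by
  simp only [convKernel]
  rw [integral_const_mul, integral_sub_left_eq_self (fun w => ψ (t⁻¹ • w)) volume x,
    Measure.integral_comp_inv_smul_of_nonneg volume ψ ht.le, h0]
  simp

theorem HasDecay.isSchur_transportKernel {A : ℝ} {ψ : 𝔼 n → ℂ} (h : HasDecay A ψ)
    {τ : 𝔼 n → 𝔼 n} {ε : ℝ} (hτ : IsSmallDeformation τ ε) {t : ℝ} (ht : 0 < t) :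
    IsSchur volume (transportKernel ψ (warp τ) t)
      (ENNReal.ofReal (A * 2 ^ (n + 1)) * envMoment n) :=
  isSchur_of_size ((h.measurable_transportKernel hτ.measurable).comp
    (measurable_const.prodMk measurable_id)) ht (by have := h.nonneg; positivity)
    (h.norm_transportKernel_le hτ ht)

theorem IsSmallDeformation.enorm_one_sub_jacobian_le {τ : 𝔼 n → 𝔼 n} {ε : ℝ}
    (hτ : IsSmallDeformation τ ε) (x : 𝔼 n) :
    ‖1 - (jacobian τ x : ℂ)‖ₑ ≤ ENNReal.ofReal (n * 2 ^ n * ε) := by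
  refine enorm_le_ofReal ?_
  rw [← Complex.ofReal_one, ← Complex.ofReal_sub, Complex.norm_real]
  exact hτ.abs_jacobian_sub_one_le x

theorem IsSmallDeformation.memLp_comp {τ : 𝔼 n → 𝔼 n} {ε : ℝ} (hτ : IsSmallDeformation τ ε)
    {f : 𝔼 n → ℂ} (hf : Measurable f) (hf2 : MemLp f 2 volume) :
    MemLp (fun x => f (warp τ x)) 2 volume := by
  refine memLp_two_of_lintegral (hf.comp hτ.measurable).aestronglyMeasurable ?_
  exact (hτ.lintegral_comp_warp_le fun u => ‖f u‖ₑ ^ 2).trans_lt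
    (ENNReal.mul_lt_top (by finiteness) (lintegral_enorm_sq_lt_top hf2))

/-- Square function estimate for the transported wavelet kernels. -/
theorem exists_squareFn_transport_le (n : ℕ) : ∃ C : ℝ, 0 ≤ C ∧
    ∀ (A : ℝ) (ψ : 𝔼 n → ℂ), HasDecay A ψ → ∫ x, ψ x = 0 →
    ∀ (τ : 𝔼 n → 𝔼 n) (ε : ℝ), IsSmallDeformation τ ε →
    ∀ h : 𝔼 n → ℂ, Measurable h → MemLp h 2 volume →
      squareFn (transportKernel ψ (warp τ)) h ≤ ENNReal.ofReal (C * A ^ 2) * ∫⁻ x, ‖h x‖ₑ ^ 2 := by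
  obtain ⟨C₀, hC₀, hcancel⟩ := exists_squareFn_le_of_cancel n
  refine ⟨2 ^ n * (C₀ * (2 ^ (n + 1)) ^ 2) * 2 ^ n, by positivity,
    fun A ψ hψ h0 τ ε hτ h hm h2 => ?_⟩
  have hA := hψ.nonneg
  obtain ⟨H, hHm, hGH, hHG⟩ := hτ.exists_inverse
  -- With `p = (h / J) ∘ G⁻¹`, the transported operator on `h` is `W_t p` evaluated at `G x`, so the
  -- mean-zero estimate for `W_t` applies.
  set p : 𝔼 n → ℂ := fun u => ((jacobian τ (H u) : ℂ))⁻¹ * h (H u) with hp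
  have hJm : Measurable (jacobian τ) := hτ.continuous_jacobian.measurable
  have hpm : Measurable p :=
    (Complex.measurable_ofReal.comp (hJm.comp hHm)).inv.mul (hm.comp hHm)
  have hJ0 : ∀ x, (jacobian τ x : ℂ) ≠ 0 := fun x => by
    exact_mod_cast (hτ.jacobian_pos x).ne'
  have hop : ∀ t x, kernelOp volume (transportKernel ψ (warp τ) t) h x =
      kernelOp volume (convKernel ψ t) p (warp τ x) := fun t x => by
    refine Eq.trans ?_ (hτ.integral_comp fun u => convKernel ψ t (warp τ x) u * p u)
    refine integral_congr_ae (Eventually.of_forall fun y => ?_)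
    simp only [hp, hHG, transportKernel]
    field_simp [hJ0 y]
  have hpL : ∫⁻ u, ‖p u‖ₑ ^ 2 ≤ 2 ^ n * ∫⁻ x, ‖h x‖ₑ ^ 2 := by
    rw [← hτ.lintegral_comp, ← lintegral_const_mul' _ _ (by finiteness)]
    refine lintegral_mono fun y => ?_
    simp only [hp, hHG]
    have hJ := hτ.jacobian_pos y
    have e : ‖((jacobian τ y : ℂ))⁻¹‖ₑ = ENNReal.ofReal (jacobian τ y)⁻¹ := by
      rw [← Complex.ofReal_inv, ← ofReal_norm, Complex.norm_real,
        Real.norm_of_nonneg (by positivity)]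
    rw [enorm_mul, mul_pow, e, ← mul_assoc, ← ENNReal.ofReal_pow (by positivity),
      ← ENNReal.ofReal_mul hJ.le]
    gcongr
    have h1 : (2 : ℝ≥0∞) ^ n = ENNReal.ofReal (2 ^ n) := by
      rw [ENNReal.ofReal_pow (by norm_num)]; simp
    rw [h1]
    refine ENNReal.ofReal_le_ofReal ?_
    have h3 : jacobian τ y * (jacobian τ y)⁻¹ ^ 2 = (jacobian τ y)⁻¹ := by field_simp
    rw [h3]
    refine inv_le_of_inv_le₀ (by positivity) ?_
    have := hτ.half_pow_le_jacobian y
    simpa using this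
  have hp2 : MemLp p 2 volume := memLp_two_of_lintegral hpm.aestronglyMeasurable
    (hpL.trans_lt (ENNReal.mul_lt_top (by finiteness) (lintegral_enorm_sq_lt_top h2)))
  calc squareFn (transportKernel ψ (warp τ)) h
      ≤ ∫⁻ t in Set.Ioi (0 : ℝ), 2 ^ n *
          ((∫⁻ x, ‖kernelOp volume (convKernel ψ t) p x‖ₑ ^ 2) * ENNReal.ofReal t⁻¹) := by
        refine lintegral_mono fun t => ?_
        simp only [hop]
        rw [← mul_assoc]
        gcongr
        exact hτ.lintegral_comp_warp_le fun u => ‖kernelOp volume (convKernel ψ t) p u‖ₑ ^ 2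
    _ = 2 ^ n * squareFn (convKernel ψ) p := lintegral_const_mul' _ _ (by finiteness)
    _ ≤ 2 ^ n * (ENNReal.ofReal (C₀ * (A * 2 ^ (n + 1)) ^ 2) *
          (2 ^ n * ∫⁻ x, ‖h x‖ₑ ^ 2)) := by
        gcongr
        exact (hcancel _ _ hψ.isStdKernel_convKernel
          (fun t ht x => hψ.integral_convKernel h0 ht x) p hp2).trans (by gcongr)
    _ = _ := by
        have h1 : (2 : ℝ≥0∞) ^ n = ENNReal.ofReal (2 ^ n) := by
          rw [ENNReal.ofReal_pow (by norm_num)]; simp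
        generalize ∫⁻ x, ‖h x‖ₑ ^ 2 = F
        rw [h1, ← mul_assoc, ← mul_assoc, ← ENNReal.ofReal_mul (by positivity),
          ← ENNReal.ofReal_mul (by positivity)]
        congr 2
        ring

theorem setLIntegral_Ioc_div_mul_inv {r : ℝ} (hr : 0 < r) :
    ∫⁻ t in Set.Ioc 0 r, ENNReal.ofReal (t / r) * ENNReal.ofReal t⁻¹ = 1 := by
  have h : ∫⁻ t in Set.Ioc 0 r, ENNReal.ofReal (t / r) * ENNReal.ofReal t⁻¹ =
      ∫⁻ _ in Set.Ioc 0 r, ENNReal.ofReal r⁻¹ := by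
    refine setLIntegral_congr_fun measurableSet_Ioc fun t ht => ?_
    have ht0 : 0 < t := ht.1
    rw [← ENNReal.ofReal_mul (by positivity)]
    congr 1
    field_simp
  rw [h, setLIntegral_const, Real.volume_Ioc, sub_zero, ← ENNReal.ofReal_mul (by positivity),
    inv_mul_cancel₀ hr.ne', ENNReal.ofReal_one]

/-- Substituting `u = G y` shows that the transported kernel times `J` has integral zero, as `ψ`
does. So only the bounded, `O(ε)` function `1 - J` survives. -/
theorem integral_commKernel {A : ℝ} {ψ : 𝔼 n → ℂ} (hψ : HasDecay A ψ) (h0 : ∫ x, ψ x = 0)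
    {τ : 𝔼 n → 𝔼 n} {ε : ℝ} (hτ : IsSmallDeformation τ ε) {t : ℝ} (ht : 0 < t) (x : 𝔼 n) :
    ∫ y, commKernel ψ (warp τ) t x y =
      -kernelOp volume (transportKernel ψ (warp τ) t) (fun y => 1 - (jacobian τ y : ℂ)) x := by
  have hS := hψ.isSchur_transportKernel hτ ht
  have hi : Integrable (transportKernel ψ (warp τ) t x) := by
    refine ⟨hS.meas.of_uncurry_left.aestronglyMeasurable, ?_⟩
    rw [hasFiniteIntegral_iff_enorm]
    exact (hS.row x).trans_lt (schurConst_ne_top _).lt_top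
  have hiJ : Integrable fun y => transportKernel ψ (warp τ) t x y * (jacobian τ y : ℂ) := by
    refine hi.mul_bdd (c := (3 / 2) ^ n) (Complex.continuous_ofReal.comp
      hτ.continuous_jacobian).aestronglyMeasurable (Eventually.of_forall fun y => ?_)
    rw [Complex.norm_real, Real.norm_of_nonneg (hτ.jacobian_pos y).le]
    refine (hτ.jacobian_bounds y).2.trans ?_
    have := hτ.nonneg
    have := hτ.le_half
    gcongr
    linarith
  have e : ∫ y, transportKernel ψ (warp τ) t x y * (jacobian τ y : ℂ) = 0 := by
    rw [← hψ.integral_convKernel h0 ht (warp τ x)]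
    refine Eq.trans ?_ (hτ.integral_comp (convKernel ψ t (warp τ x)))
    simp only [transportKernel, mul_comm]
  simp only [commKernel, kernelOp, mul_sub, mul_one]
  rw [integral_sub (hψ.isStdKernel_convKernel.integrable ht x) hi, integral_sub hi hiJ, e,
    hψ.integral_convKernel h0 ht x]
  ring

end Commutator

/-! ### The Carleson bound and the commutator estimate. -/

section CommutatorEstimate

variable {n : ℕ}

theorem two_pow_eq_ofReal (m : ℕ) : (2 : ℝ≥0∞) ^ m = ENNReal.ofReal (2 ^ m) := by
  rw [ENNReal.ofReal_pow (by norm_num)]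
  simp

/-- An `L²`-bounded square function sends bounded functions to Carleson measures; here the bounded
function is `1 - J`, of size `ε`. Over a ball of radius `r`, it is cut at the doubled ball: the near
part uses the `L²` bound, the far part the decay of the kernel. -/
theorem exists_isCarleson_commKernel (n : ℕ) : ∃ D : ℝ, 0 ≤ D ∧
    ∀ (A : ℝ) (ψ : 𝔼 n → ℂ), HasDecay A ψ → ∫ x, ψ x = 0 →
    ∀ (τ : 𝔼 n → 𝔼 n) (ε : ℝ), IsSmallDeformation τ ε →
      IsCarleson (carlesonMeasure (commKernel ψ (warp τ)))
        (ENNReal.ofReal (D * (A * 2 ^ (n + 3) * 2 ^ (n + 1) * ε) ^ 2)) := by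
  obtain ⟨C, hC, htrans⟩ := exists_squareFn_transport_le n
  set v := (volume (Metric.closedBall (0 : 𝔼 n) 1)).toReal with hv
  have hvt : volume (Metric.closedBall (0 : 𝔼 n) 1) = ENNReal.ofReal v :=
    (ENNReal.ofReal_toReal measure_closedBall_lt_top.ne).symm
  set I := (envMoment n).toReal with hI
  have hIt : envMoment n = ENNReal.ofReal I := (ENNReal.ofReal_toReal (envMoment_lt_top n).ne).symm
  -- The two summands are the near and far parts; the division expresses the bound through the
  -- squared constant of the standard kernel.
  refine ⟨(2 * (C * (n * 2 ^ n) ^ 2 * 2 ^ n * v) +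
    2 * ((n * 2 ^ n) ^ 2 * (2 ^ (n + 1)) ^ 2 * I ^ 2 * v)) / (2 ^ (n + 3) * 2 ^ (n + 1)) ^ 2,
    by positivity, fun A ψ hψ h0 τ ε hτ x₀ r hr => ?_⟩
  have hA := hψ.nonneg
  have hε := hτ.nonneg
  set M : ℝ := n * 2 ^ n * ε with hM
  have hM0 : 0 ≤ M := by positivity
  set K := commKernel ψ (warp τ) with hK
  have hKstd := hψ.isStdKernel_commKernel hτ
  set b : 𝔼 n → ℂ := fun y => 1 - (jacobian τ y : ℂ) with hb
  have hbm : Measurable b :=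
    measurable_const.sub (Complex.measurable_ofReal.comp hτ.continuous_jacobian.measurable)
  have hbM : ∀ y, ‖b y‖ₑ ≤ ENNReal.ofReal M := hτ.enorm_one_sub_jacobian_le
  set S : Set (𝔼 n) := Metric.closedBall x₀ (2 * r) with hS
  have hSm : MeasurableSet S := Metric.isClosed_closedBall.measurableSet
  have hb1m : Measurable (S.indicator b) := hbm.indicator hSm
  have hb1L : ∫⁻ y, ‖S.indicator b y‖ₑ ^ 2 ≤
      ENNReal.ofReal (M ^ 2 * (2 ^ n * r ^ n * v)) := by
    have h1 : ∀ y, ‖S.indicator b y‖ₑ ^ 2 ≤ S.indicator (fun _ => ENNReal.ofReal M ^ 2) y :=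
      fun y => by
        by_cases hy : y ∈ S
        · rw [Set.indicator_of_mem hy, Set.indicator_of_mem hy]
          gcongr
          exact hbM y
        · rw [Set.indicator_of_notMem hy, Set.indicator_of_notMem hy]
          simp
    refine (lintegral_mono h1).trans_eq ?_
    rw [lintegral_indicator_const hSm, hS, volume_closedBall_eq _ (by positivity), hvt,
      ← ENNReal.ofReal_pow hM0, ← ENNReal.ofReal_mul (by positivity),
      ← ENNReal.ofReal_mul (by positivity), mul_pow 2 r]
  have hb1 : MemLp (S.indicator b) 2 volume := memLp_two_of_lintegral hb1m.aestronglyMeasurable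
    (hb1L.trans_lt ENNReal.ofReal_lt_top)
  have hpiece1 : squareFn (transportKernel ψ (warp τ)) (S.indicator b) ≤
      ENNReal.ofReal (C * A ^ 2) * ENNReal.ofReal (M ^ 2 * (2 ^ n * r ^ n * v)) :=
    (htrans A ψ hψ h0 τ ε hτ _ hb1m hb1).trans (by gcongr)
  have hpiece2 : ∀ t, 0 < t → ∀ x ∈ Metric.closedBall x₀ r,
      ‖kernelOp volume (transportKernel ψ (warp τ) t) (Sᶜ.indicator b) x‖ₑ ≤
        ENNReal.ofReal (M * (A * 2 ^ (n + 1)) * √(t / r) * I) := fun t ht x hx => by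
    have h1 : ∀ y, ‖transportKernel ψ (warp τ) t x y * Sᶜ.indicator b y‖ₑ ≤
        ENNReal.ofReal (M * (A * 2 ^ (n + 1))) *
          ENNReal.ofReal (envelope t (x - y) * √(‖x - y‖ / r)) := fun y => by
      by_cases hy : y ∈ S
      · rw [Set.indicator_of_notMem (by simpa using hy)]
        simp
      · rw [Set.indicator_of_mem (by simpa using hy), enorm_mul,
          ← ENNReal.ofReal_mul (by positivity)]
        refine (mul_le_mul' (enorm_le_ofReal (hψ.norm_transportKernel_le hτ ht x y))
          (hbM y)).trans ?_
        rw [← ENNReal.ofReal_mul (mul_nonneg (by positivity) (envelope_nonneg ht _))]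
        refine ENNReal.ofReal_le_ofReal ?_
        -- Off the doubled ball `|x - y| ≥ r`, so this factor may be inserted for free; it
        -- integrates to `√(t / r)`, whose square is integrable for `dt / t` on `(0, r]`.
        have h2 : 1 ≤ √(‖x - y‖ / r) := by
          rw [Real.one_le_sqrt, one_le_div hr]
          rw [hS, Metric.mem_closedBall, not_le] at hy
          rw [Metric.mem_closedBall, dist_comm] at hx
          have := dist_triangle y x x₀
          rw [dist_comm y x, dist_comm x x₀, dist_eq_norm x y] at this
          linarith
        have h3 := envelope_nonneg ht (x - y)
        calc A * 2 ^ (n + 1) * envelope t (x - y) * M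
            = M * (A * 2 ^ (n + 1)) * (envelope t (x - y) * 1) := by ring
          _ ≤ _ := by gcongr
    refine (enorm_integral_le_lintegral_enorm _).trans ((lintegral_mono h1).trans ?_)
    rw [lintegral_const_mul' _ _ (by simp), mul_assoc (M * _),
      ENNReal.ofReal_mul (p := M * (A * 2 ^ (n + 1))) (by positivity),
      ENNReal.ofReal_mul (p := √(t / r)) (by positivity), ← hIt]
    gcongr
    exact lintegral_envelope_sqrt_left ht hr x
  have hsplit : ∀ t, 0 < t → ∀ x ∈ Metric.closedBall x₀ r, ‖∫ y, K t x y‖ₑ ^ 2 ≤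
      2 * ‖kernelOp volume (transportKernel ψ (warp τ) t) (S.indicator b) x‖ₑ ^ 2 +
        2 * (ENNReal.ofReal ((M * (A * 2 ^ (n + 1)) * I) ^ 2) * ENNReal.ofReal (t / r)) :=
      fun t ht x hx => by
    have hSch := hψ.isSchur_transportKernel hτ ht
    have hi : Integrable (transportKernel ψ (warp τ) t x) := by
      refine ⟨hSch.meas.of_uncurry_left.aestronglyMeasurable, ?_⟩
      rw [hasFiniteIntegral_iff_enorm]
      exact (hSch.row x).trans_lt (schurConst_ne_top _).lt_top
    have hbb : ∀ U : Set (𝔼 n), MeasurableSet U →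
        Integrable fun y => transportKernel ψ (warp τ) t x y * U.indicator b y := fun U hU => by
      refine hi.mul_bdd (c := M) (hbm.indicator hU).aestronglyMeasurable
        (Eventually.of_forall fun y => ?_)
      by_cases hy : y ∈ U
      · rw [Set.indicator_of_mem hy]
        have := hbM y
        rwa [← ofReal_norm, ENNReal.ofReal_le_ofReal_iff hM0] at this
      · rw [Set.indicator_of_notMem hy]
        simpa using hM0
    have e : ∫ y, K t x y =
        -(kernelOp volume (transportKernel ψ (warp τ) t) (S.indicator b) x +
          kernelOp volume (transportKernel ψ (warp τ) t) (Sᶜ.indicator b) x) := by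
      rw [hK, integral_commKernel hψ h0 hτ ht x, kernelOp, kernelOp, kernelOp,
        ← integral_add (hbb S hSm) (hbb _ hSm.compl)]
      congr 2 with y
      rw [← mul_add, Set.indicator_self_add_compl_apply]
    rw [e, enorm_neg]
    refine (pow_le_pow_left₀ zero_le (enorm_add_le _ _) 2).trans ((add_sq_le_two_mul _ _).trans ?_)
    gcongr
    refine (pow_le_pow_left₀ zero_le (hpiece2 t ht x hx) 2).trans_eq ?_
    rw [← ENNReal.ofReal_pow (by positivity), ← ENNReal.ofReal_mul (by positivity)]
    congr 1
    have := Real.sq_sqrt (show 0 ≤ t / r by positivity)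
    calc _ = (M * (A * 2 ^ (n + 1)) * I) ^ 2 * √(t / r) ^ 2 := by ring
      _ = _ := by rw [this]
  have hkm : Measurable fun t => 2 * (∫⁻ x,
      ‖kernelOp volume (transportKernel ψ (warp τ) t) (S.indicator b) x‖ₑ ^ 2) *
        ENNReal.ofReal t⁻¹ :=
    ((measurable_lintegral_kernelOp (hψ.measurable_transportKernel hτ.measurable)
      hb1m.aestronglyMeasurable).const_mul 2).mul (by fun_prop)
  calc carlesonMeasure K (Set.Ioc 0 r ×ˢ Metric.closedBall x₀ r)
      = ∫⁻ t in Set.Ioc 0 r, ∫⁻ x in Metric.closedBall x₀ r,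
          ‖∫ y, K t x y‖ₑ ^ 2 * ENNReal.ofReal t⁻¹ := by
        have hd : Measurable fun p : ℝ × 𝔼 n => ‖∫ y, K p.1 p.2 y‖ₑ ^ 2 * ENNReal.ofReal p.1⁻¹ :=
          (hKstd.measurable_integral.enorm.pow_const 2).mul (by fun_prop)
        rw [carlesonMeasure, withDensity_apply _
          (measurableSet_Ioc.prod Metric.isClosed_closedBall.measurableSet),
          ← Measure.prod_restrict, Measure.restrict_restrict measurableSet_Ioc,
          Set.inter_eq_left.2 Set.Ioc_subset_Ioi_self, lintegral_prod _ hd.aemeasurable]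
    _ ≤ ∫⁻ t in Set.Ioc 0 r, (2 * (∫⁻ x,
          ‖kernelOp volume (transportKernel ψ (warp τ) t) (S.indicator b) x‖ₑ ^ 2) *
            ENNReal.ofReal t⁻¹ + 2 * (ENNReal.ofReal ((M * (A * 2 ^ (n + 1)) * I) ^ 2) *
              ENNReal.ofReal (r ^ n * v)) * (ENNReal.ofReal (t / r) * ENNReal.ofReal t⁻¹)) := by
        refine setLIntegral_mono' measurableSet_Ioc fun t ht => ?_
        rw [lintegral_mul_const' _ _ (by simp)]
        refine (mul_le_mul_left (setLIntegral_mono'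
          Metric.isClosed_closedBall.measurableSet (hsplit t ht.1)) _).trans ?_
        rw [lintegral_add_right _ measurable_const, setLIntegral_const,
          volume_closedBall_eq _ hr.le, hvt, ENNReal.ofReal_mul (p := r ^ n) (by positivity), add_mul]
        refine add_le_add ?_ (le_of_eq (by ring))
        rw [lintegral_const_mul' _ _ (by simp)]
        gcongr
        exact Measure.restrict_le_self
    _ ≤ 2 * squareFn (transportKernel ψ (warp τ)) (S.indicator b) +
          2 * (ENNReal.ofReal ((M * (A * 2 ^ (n + 1)) * I) ^ 2) * ENNReal.ofReal (r ^ n * v)) := by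
        rw [lintegral_add_left hkm, lintegral_const_mul' _ _ (by finiteness),
          setLIntegral_Ioc_div_mul_inv hr, mul_one, squareFn, ← lintegral_const_mul' _ _ (by simp)]
        simp only [mul_assoc]
        gcongr
        exact Set.Ioc_subset_Ioi_self
    _ ≤ 2 * (ENNReal.ofReal (C * A ^ 2) * ENNReal.ofReal (M ^ 2 * (2 ^ n * r ^ n * v))) +
          2 * (ENNReal.ofReal ((M * (A * 2 ^ (n + 1)) * I) ^ 2) * ENNReal.ofReal (r ^ n * v)) := by
        gcongr
    _ = _ := by
        have h2 : (2 : ℝ≥0∞) = ENNReal.ofReal 2 := by simp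
        rw [h2, ← ENNReal.ofReal_mul (by positivity), ← ENNReal.ofReal_mul (by positivity),
          ← ENNReal.ofReal_mul (by positivity), ← ENNReal.ofReal_mul (by positivity),
          ← ENNReal.ofReal_add (by positivity) (by positivity),
          ← ENNReal.ofReal_mul (by positivity)]
        congr 1
        rw [hM]
        field_simp

/-- Substituting `u = G y` gives `(W_t f)(G x) = ∫ ψ_t(Gx - Gy) J(y) g(y) dy`; writing `J = 1 - (1 -
J)` splits the commutator into the difference kernel on `g` and the transported kernel on `q`. -/
theorem lintegral_commutator_sq_le {A : ℝ} {ψ : 𝔼 n → ℂ} (hψ : HasDecay A ψ) {τ : 𝔼 n → 𝔼 n}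
    {ε : ℝ} (hτ : IsSmallDeformation τ ε) {f g q : 𝔼 n → ℂ} (hg : ∀ y, g y = f (warp τ y))
    (hq : ∀ y, q y = (1 - (jacobian τ y : ℂ)) * g y) (hgm : Measurable g) (hg2 : MemLp g 2 volume)
    (hq2 : MemLp q 2 volume) {t : ℝ} (ht : 0 < t) :
    ∫⁻ x, ‖kernelOp volume (convKernel ψ t) g x -
      kernelOp volume (convKernel ψ t) f (warp τ x)‖ₑ ^ 2 ≤
      2 * (∫⁻ x, ‖kernelOp volume (commKernel ψ (warp τ) t) g x‖ₑ ^ 2) +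
      2 * ∫⁻ x, ‖kernelOp volume (transportKernel ψ (warp τ) t) q x‖ₑ ^ 2 := by
  have hstd := hψ.isStdKernel_commKernel hτ
  have hm := hstd.measurable_kernelOp t hgm.aestronglyMeasurable
  rw [← lintegral_const_mul' _ _ (by simp), ← lintegral_const_mul' _ _ (by simp),
    ← lintegral_add_left ((hm.enorm.pow_const 2).const_mul 2)]
  refine lintegral_mono_ae ?_
  filter_upwards [(hstd.isSchur ht).ae_integrable (schurConst_ne_top _) hg2,
    (hψ.isStdKernel_convKernel.isSchur ht).ae_integrable (schurConst_ne_top _) hg2,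
    (hψ.isSchur_transportKernel hτ ht).ae_integrable (schurConst_ne_top _) hq2] with x hx1 hx2 hx3
  have e1 : kernelOp volume (convKernel ψ t) f (warp τ x) =
      ∫ y, (convKernel ψ t x y * g y - commKernel ψ (warp τ) t x y * g y -
        transportKernel ψ (warp τ) t x y * q y) := by
    have e0 := hτ.integral_comp fun u => convKernel ψ t (warp τ x) u * f u
    rw [kernelOp, ← e0]
    congr 1 with y
    simp only [hq, hg, commKernel, transportKernel]
    ring
  rw [integral_sub (f := fun y => convKernel ψ t x y * g y - commKernel ψ (warp τ) t x y * g y)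
    (hx2.sub hx1) hx3, integral_sub hx2 hx1] at e1
  have e : kernelOp volume (convKernel ψ t) g x - kernelOp volume (convKernel ψ t) f (warp τ x) =
      kernelOp volume (commKernel ψ (warp τ) t) g x +
        kernelOp volume (transportKernel ψ (warp τ) t) q x := by
    rw [e1]
    simp only [kernelOp]
    ring
  rw [e]
  exact (pow_le_pow_left₀ zero_le (enorm_add_le _ _) 2).trans (add_sq_le_two_mul _ _)

/-- The commutator of the wavelet transform with a small deformation. -/
theorem exists_commutator_le (n : ℕ) (hn : n ≠ 0) : ∃ C : ℝ, 0 ≤ C ∧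
    ∀ (A : ℝ) (ψ : 𝔼 n → ℂ), HasDecay A ψ → ∫ x, ψ x = 0 →
    ∀ (τ : 𝔼 n → 𝔼 n) (ε : ℝ), IsSmallDeformation τ ε →
    ∀ f : 𝔼 n → ℂ, Measurable f → MemLp f 2 volume →
      ∫⁻ t in Set.Ioi (0 : ℝ), (∫⁻ x, ‖kernelOp volume (convKernel ψ t) (fun y => f (warp τ y)) x -
          kernelOp volume (convKernel ψ t) f (warp τ x)‖ₑ ^ 2) * ENNReal.ofReal t⁻¹ ≤
        ENNReal.ofReal (C * A ^ 2 * ε ^ 2) * ∫⁻ x, ‖f x‖ₑ ^ 2 := by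
  obtain ⟨C₁, hC₁, htrans⟩ := exists_squareFn_transport_le n
  obtain ⟨D, hD, hcarl⟩ := exists_isCarleson_commKernel n
  obtain ⟨C₂, hC₂, hT1⟩ := exists_squareFn_le_of_carleson n hn D hD
  refine ⟨2 * (C₂ * (2 ^ (n + 3) * 2 ^ (n + 1)) ^ 2) * 2 ^ n +
    2 * (C₁ * (n * 2 ^ n) ^ 2) * 2 ^ n, by positivity, fun A ψ hψ h0 τ ε hτ f hf hf2 => ?_⟩
  have hA := hψ.nonneg
  have hε := hτ.nonneg
  set M : ℝ := n * 2 ^ n * ε with hM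
  have hM0 : 0 ≤ M := by positivity
  set g : 𝔼 n → ℂ := fun y => f (warp τ y) with hg
  have hgm : Measurable g := hf.comp hτ.measurable
  have hg2 : MemLp g 2 volume := hτ.memLp_comp hf hf2
  have hgL : ∫⁻ x, ‖g x‖ₑ ^ 2 ≤ 2 ^ n * ∫⁻ x, ‖f x‖ₑ ^ 2 :=
    hτ.lintegral_comp_warp_le fun u => ‖f u‖ₑ ^ 2
  have hJm : Measurable (jacobian τ) := hτ.continuous_jacobian.measurable
  set q : 𝔼 n → ℂ := fun y => (1 - (jacobian τ y : ℂ)) * g y with hq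
  have hqm : Measurable q :=
    (measurable_const.sub (Complex.measurable_ofReal.comp hJm)).mul hgm
  have hqL : ∫⁻ x, ‖q x‖ₑ ^ 2 ≤ ENNReal.ofReal (M ^ 2) * ∫⁻ x, ‖g x‖ₑ ^ 2 := by
    rw [← lintegral_const_mul' _ _ (by simp)]
    refine lintegral_mono fun x => ?_
    rw [enorm_mul, mul_pow, ENNReal.ofReal_pow hM0]
    gcongr
    exact hτ.enorm_one_sub_jacobian_le x
  have hq2 : MemLp q 2 volume := memLp_two_of_lintegral hqm.aestronglyMeasurable
    (hqL.trans_lt (ENNReal.mul_lt_top (by simp) (lintegral_enorm_sq_lt_top hg2)))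
  have hstd := hψ.isStdKernel_commKernel hτ
  have h1 := hT1 _ _ hstd (hcarl A ψ hψ h0 τ ε hτ) g hgm hg2
  have h2 := htrans A ψ hψ h0 τ ε hτ q hqm hq2
  have hsplit := fun t (ht : 0 < t) => lintegral_commutator_sq_le hψ hτ (f := f) (g := g) (q := q)
    (fun _ => rfl) (fun _ => rfl) hgm hg2 hq2 ht
  have hmeas : Measurable fun t => 2 * ((∫⁻ x, ‖kernelOp volume (commKernel ψ (warp τ) t) g x‖ₑ ^ 2) *
      ENNReal.ofReal t⁻¹) :=
    ((measurable_lintegral_kernelOp hstd.meas hgm.aestronglyMeasurable).mul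
      (by fun_prop)).const_mul 2
  calc _ ≤ ∫⁻ t in Set.Ioi (0 : ℝ),
          (2 * ((∫⁻ x, ‖kernelOp volume (commKernel ψ (warp τ) t) g x‖ₑ ^ 2) * ENNReal.ofReal t⁻¹) +
          2 * ((∫⁻ x, ‖kernelOp volume (transportKernel ψ (warp τ) t) q x‖ₑ ^ 2) *
            ENNReal.ofReal t⁻¹)) := by
        refine setLIntegral_mono' measurableSet_Ioi fun t ht => ?_
        refine (mul_le_mul_left (hsplit t ht) _).trans_eq ?_
        ring
    _ = 2 * squareFn (commKernel ψ (warp τ)) g + 2 * squareFn (transportKernel ψ (warp τ)) q := by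
        rw [lintegral_add_left hmeas, lintegral_const_mul' _ _ (by simp),
          lintegral_const_mul' _ _ (by simp)]
        rfl
    _ ≤ 2 * (ENNReal.ofReal (C₂ * (A * 2 ^ (n + 3) * 2 ^ (n + 1) * ε) ^ 2) *
            (2 ^ n * ∫⁻ x, ‖f x‖ₑ ^ 2)) +
          2 * (ENNReal.ofReal (C₁ * A ^ 2) * (ENNReal.ofReal (M ^ 2) *
            (2 ^ n * ∫⁻ x, ‖f x‖ₑ ^ 2))) := by
        gcongr
        · exact h1.trans (by gcongr)
        · exact h2.trans (by gcongr; exact hqL.trans (by gcongr))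
    _ = _ := by
        generalize ∫⁻ x, ‖f x‖ₑ ^ 2 = F
        have h2 : (2 : ℝ≥0∞) = ENNReal.ofReal 2 := by simp
        rw [two_pow_eq_ofReal, h2]
        simp only [← mul_assoc]
        rw [← add_mul, ← ENNReal.ofReal_mul (by positivity), ← ENNReal.ofReal_mul (by positivity),
          ← ENNReal.ofReal_mul (by positivity), ← ENNReal.ofReal_mul (by positivity),
          ← ENNReal.ofReal_mul (by positivity),
          ← ENNReal.ofReal_add (by positivity) (by positivity)]
        congr 2
        rw [hM]
        ring

end CommutatorEstimate

/-! ### Layers of the cascade and the measure on scales. -/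

section Layers

variable {n : ℕ}

theorem waveletTransform_eq (ψ f : 𝔼 n → ℂ) {s : ℝ} (hs : 0 < s) (x : 𝔼 n) :
    waveletTransform ψ s f x =
      ((s ^ ((n : ℝ) / 2) : ℝ) : ℂ) * kernelOp volume (convKernel ψ s) f x := by
  rw [waveletTransform, convolution, kernelOp, ← integral_const_mul]
  congr 1 with y
  simp only [ContinuousLinearMap.mul_apply', dilate, convKernel]
  have h : s ^ (-(n : ℝ) / 2) = s ^ ((n : ℝ) / 2) * (s ^ n)⁻¹ := by
    rw [← Real.rpow_natCast, ← Real.rpow_neg hs.le, ← Real.rpow_add hs]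
    congr 1
    ring
  rw [h]
  push_cast
  ring

/-- Passing from the `L²`-normalised to the `L¹`-normalised dilation contributes `s^n` to squared
norms, which turns `ds / s^{n+1}` into `ds / s`. -/
theorem scale_weight_eq {s : ℝ} (hs : 0 < s) :
    ENNReal.ofReal (s ^ ((n : ℝ) / 2)) ^ 2 * ENNReal.ofReal (1 / s ^ (n + 1)) =
      ENNReal.ofReal s⁻¹ := by
  rw [← ENNReal.ofReal_pow (by positivity), ← ENNReal.ofReal_mul (by positivity)]
  congr 1
  rw [← Real.rpow_natCast (s ^ ((n : ℝ) / 2)), ← Real.rpow_mul hs.le]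
  have : (n : ℝ) / 2 * (2 : ℕ) = n := by push_cast; ring
  rw [this, Real.rpow_natCast]
  field_simp
  ring

theorem enorm_waveletTransform_sub_sq (ψ f g : 𝔼 n → ℂ) {s : ℝ} (hs : 0 < s) (x y : 𝔼 n) :
    ‖waveletTransform ψ s f x - waveletTransform ψ s g y‖ₑ ^ 2 =
      ENNReal.ofReal (s ^ ((n : ℝ) / 2)) ^ 2 * ‖kernelOp volume (convKernel ψ s) f x -
        kernelOp volume (convKernel ψ s) g y‖ₑ ^ 2 := by
  rw [waveletTransform_eq ψ f hs, waveletTransform_eq ψ g hs, ← mul_sub, enorm_mul, mul_pow,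
    ← ofReal_norm (_ : ℂ), Complex.norm_real, Real.norm_of_nonneg (by positivity)]

/-- One layer of the scattering cascade. -/
noncomputable def layer (ψ : 𝔼 n → ℂ) (s : ℝ) (f : 𝔼 n → ℂ) (x : 𝔼 n) : ℂ :=
  ((‖waveletTransform ψ s f x‖ : ℝ) : ℂ)

theorem enorm_layer_sub_le (ψ f g : 𝔼 n → ℂ) (s : ℝ) (x y : 𝔼 n) :
    ‖layer ψ s f x - layer ψ s g y‖ₑ ≤
      ‖waveletTransform ψ s f x - waveletTransform ψ s g y‖ₑ := by
  rw [← ofReal_norm, ← ofReal_norm]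
  refine ENNReal.ofReal_le_ofReal ?_
  rw [layer, layer, ← Complex.ofReal_sub, Complex.norm_real]
  exact abs_norm_sub_norm_le _ _

theorem measurable_waveletTransform {β : Type*} [MeasurableSpace β] {ψ : 𝔼 n → ℂ}
    (hψ : Measurable ψ) {F : β → 𝔼 n → ℂ} (hF : Measurable (Function.uncurry F)) {s : β → ℝ}
    (hs : Measurable s) :
    Measurable fun p : β × 𝔼 n => waveletTransform ψ (s p.1) (F p.1) p.2 := by
  have hm : Measurable fun q : (β × 𝔼 n) × 𝔼 n =>
      F q.1.1 q.2 * dilate ψ (s q.1.1) (q.1.2 - q.2) := by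
    have h1 : Measurable fun q : (β × 𝔼 n) × 𝔼 n => F q.1.1 q.2 :=
      hF.comp (measurable_fst.fst.prodMk measurable_snd)
    have h2 : Measurable fun q : (β × 𝔼 n) × 𝔼 n => s q.1.1 := hs.comp measurable_fst.fst
    have h3 : Measurable fun q : (β × 𝔼 n) × 𝔼 n =>
        ψ ((s q.1.1)⁻¹ • (q.1.2 - q.2)) :=
      hψ.comp (h2.inv.smul (measurable_fst.snd.sub measurable_snd))
    exact h1.mul ((Complex.measurable_ofReal.comp (h2.pow_const _)).mul h3)
  exact hm.stronglyMeasurable.integral_prod_right'.measurable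

theorem measurable_layer {β : Type*} [MeasurableSpace β] {ψ : 𝔼 n → ℂ}
    (hψ : Measurable ψ) {F : β → 𝔼 n → ℂ} (hF : Measurable (Function.uncurry F)) {s : β → ℝ}
    (hs : Measurable s) :
    Measurable (Function.uncurry fun b x => layer ψ (s b) (F b) x) :=
  Complex.measurable_ofReal.comp (measurable_waveletTransform hψ hF hs).norm

theorem measurable_cascade {β : Type*} [MeasurableSpace β] {ψ : 𝔼 n → ℂ}
    (hψ : Measurable ψ) (m : ℕ) {F : β → 𝔼 n → ℂ} (hF : Measurable (Function.uncurry F))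
    {s : β → Fin m → ℝ} (hs : Measurable s) :
    Measurable fun p : β × 𝔼 n => cascade ψ m (s p.1) (F p.1) p.2 := by
  induction m generalizing F with
  | zero => exact hF
  | succ m ih =>
    exact ih (F := fun b => layer ψ (s b 0) (F b))
      (measurable_layer hψ hF (hs.eval)) (s := fun b i => s b i.succ)
      (measurable_pi_lambda _ fun i => hs.eval)

theorem measurable_layer_const {ψ : 𝔼 n → ℂ} (hψ : Measurable ψ) {f : 𝔼 n → ℂ} (hf : Measurable f)
    (s : ℝ) : Measurable (layer ψ s f) := by
  have h : Measurable (Function.uncurry fun (_ : Unit) x => layer ψ s f x) :=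
    measurable_layer hψ (F := fun _ => f) (hf.comp measurable_snd) (s := fun _ => s)
      measurable_const
  exact h.of_uncurry_left (x := ())

theorem measurable_cascade_const {ψ : 𝔼 n → ℂ} (hψ : Measurable ψ) (m : ℕ) {f : 𝔼 n → ℂ}
    (hf : Measurable f) :
    Measurable fun p : (Fin m → ℝ) × 𝔼 n => cascade ψ m p.1 f p.2 :=
  measurable_cascade hψ m (F := fun _ => f) (hf.comp measurable_snd) measurable_id

theorem cascade_zero (ψ : 𝔼 n → ℂ) (m : ℕ) (s : Fin m → ℝ) : cascade ψ m s 0 = 0 := by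
  induction m with
  | zero => rfl
  | succ m ih =>
    have : (fun x => ((‖waveletTransform ψ (s 0) 0 x‖ : ℝ) : ℂ)) = 0 := by
      funext x
      simp [waveletTransform]
    rw [cascade, this]
    exact ih _

/-- The positive orthant of scales. -/
def posScales (m : ℕ) : Set (Fin m → ℝ) := {s | ∀ i, 0 < s i}

/-- The density `∏ᵢ sᵢ⁻⁽ⁿ⁺¹⁾` of the scale measure. -/
noncomputable def scaleWeight (n : ℕ) {m : ℕ} (s : Fin m → ℝ) : ℝ≥0∞ :=
  ENNReal.ofReal (∏ i, 1 / s i ^ (n + 1))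

theorem measurableSet_posScales (m : ℕ) : MeasurableSet (posScales m) := by
  have : posScales m = ⋂ i, {s : Fin m → ℝ | 0 < s i} := by ext s; simp [posScales]
  rw [this]
  exact MeasurableSet.iInter fun i => measurableSet_lt measurable_const (measurable_pi_apply i)

theorem measurable_scaleWeight (n m : ℕ) : Measurable (scaleWeight n (m := m)) := by
  unfold scaleWeight
  fun_prop

theorem scaleWeight_cons {a : ℝ} (ha : 0 < a) {m : ℕ} (s : Fin m → ℝ) :
    scaleWeight n (Fin.cons a s : Fin (m + 1) → ℝ) =
      ENNReal.ofReal (1 / a ^ (n + 1)) * scaleWeight n s := by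
  rw [scaleWeight, Fin.prod_univ_succ, ENNReal.ofReal_mul (by simp only [Fin.cons_zero]; positivity)]
  simp [scaleWeight]

theorem setLIntegral_posScales_zero (H : (Fin 0 → ℝ) → ℝ≥0∞) :
    ∫⁻ s in posScales 0, H s = H default := by
  have : posScales 0 = Set.univ := by ext s; simp [posScales]
  have hv : (volume : Measure (Fin 0 → ℝ)) Set.univ = 1 := by
    rw [volume_pi, Measure.pi_of_empty]
    simp
  rw [this, setLIntegral_univ, lintegral_unique, hv, mul_one]
  exact congrArg H (Subsingleton.elim _ _)

theorem setLIntegral_posScales_succ {m : ℕ} {H : (Fin (m + 1) → ℝ) → ℝ≥0∞} (hH : Measurable H) :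
    ∫⁻ s in posScales (m + 1), H s =
      ∫⁻ a in Set.Ioi (0 : ℝ), ∫⁻ s in posScales m, H (Fin.cons a s) := by
  have e := (volume_preserving_piFinSuccAbove (fun _ : Fin (m + 1) => ℝ) 0).symm
  have hpre : (MeasurableEquiv.piFinSuccAbove (fun _ : Fin (m + 1) => ℝ) 0).symm ⁻¹'
      posScales (m + 1) = Set.Ioi 0 ×ˢ posScales m := by
    ext ⟨a, s⟩
    simp [posScales, MeasurableEquiv.piFinSuccAbove, Fin.forall_fin_succ, Fin.insertNthEquiv]
  rw [← e.setLIntegral_comp_preimage (measurableSet_posScales _) hH, hpre, Measure.volume_eq_prod,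
    ← Measure.prod_restrict]
  have hm : Measurable fun p : ℝ × (Fin m → ℝ) =>
      H ((MeasurableEquiv.piFinSuccAbove (fun _ : Fin (m + 1) => ℝ) 0).symm p) :=
    hH.comp (MeasurableEquiv.measurable _)
  rw [lintegral_prod _ hm.aemeasurable]
  simp [MeasurableEquiv.piFinSuccAbove, Fin.insertNthEquiv]

theorem cascade_cons (ψ f : 𝔼 n → ℂ) {m : ℕ} (a : ℝ) (s : Fin m → ℝ) :
    cascade ψ (m + 1) (Fin.cons a s) f = cascade ψ m s (layer ψ a f) := by
  rw [cascade]
  simp only [Fin.cons_succ, Fin.cons_zero]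
  rfl

theorem HasDecay.memLp_layer {A : ℝ} {ψ : 𝔼 n → ℂ} (hψ : HasDecay A ψ) {f : 𝔼 n → ℂ}
    (hf : Measurable f) (hf2 : MemLp f 2 volume) {s : ℝ} (hs : 0 < s) :
    MemLp (layer ψ s f) 2 volume := by
  have h1 := (hψ.isStdKernel_convKernel.isSchur hs).memLp_kernelOp (schurConst_ne_top _) hf2
  have h2 : MemLp (waveletTransform ψ s f) 2 volume := by
    have : waveletTransform ψ s f = fun x =>
        ((s ^ ((n : ℝ) / 2) : ℝ) : ℂ) * kernelOp volume (convKernel ψ s) f x :=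
      funext fun x => waveletTransform_eq ψ f hs x
    rw [this]
    exact h1.const_mul _
  refine h2.congr_norm (measurable_layer_const hψ.measurable hf s).aestronglyMeasurable
    (Eventually.of_forall fun x => ?_)
  simp [layer]

theorem HasDecay.memLp_cascade {A : ℝ} {ψ : 𝔼 n → ℂ} (hψ : HasDecay A ψ) {m : ℕ} {f : 𝔼 n → ℂ}
    (hf : Measurable f) (hf2 : MemLp f 2 volume) {s : Fin m → ℝ} (hs : s ∈ posScales m) :
    MemLp (cascade ψ m s f) 2 volume := by
  induction m generalizing f with
  | zero => exact hf2
  | succ m ih =>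
    exact ih (f := layer ψ (s 0) f) (measurable_layer_const hψ.measurable hf _)
      (hψ.memLp_layer hf hf2 (hs 0)) (fun i => hs i.succ)

end Layers

/-! ### Energy estimates for the cascade, by induction on the layers. -/

section Energy

variable {n : ℕ}

theorem lintegral_layer_sub_le (ψ f g : 𝔼 n → ℂ) (w : 𝔼 n → 𝔼 n) {s : ℝ} (hs : 0 < s) :
    ENNReal.ofReal (1 / s ^ (n + 1)) * ∫⁻ x, ‖layer ψ s g x - layer ψ s f (w x)‖ₑ ^ 2 ≤
      (∫⁻ x, ‖kernelOp volume (convKernel ψ s) g x -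
        kernelOp volume (convKernel ψ s) f (w x)‖ₑ ^ 2) * ENNReal.ofReal s⁻¹ := by
  have h : ∫⁻ x, ‖layer ψ s g x - layer ψ s f (w x)‖ₑ ^ 2 ≤
      ENNReal.ofReal (s ^ ((n : ℝ) / 2)) ^ 2 * ∫⁻ x, ‖kernelOp volume (convKernel ψ s) g x -
        kernelOp volume (convKernel ψ s) f (w x)‖ₑ ^ 2 := by
    rw [← lintegral_const_mul' _ _ (by simp)]
    refine lintegral_mono fun x => ?_
    rw [← enorm_waveletTransform_sub_sq ψ g f hs]
    gcongr
    exact enorm_layer_sub_le ψ g f s x (w x)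
  refine (mul_le_mul_right h _).trans_eq ?_
  rw [← scale_weight_eq hs]
  ring

/-- The integral over all scales of the squared `L²` norm of a family indexed by the scales. -/
noncomputable def scaleEnergy {m : ℕ} (h : (Fin m → ℝ) → 𝔼 n → ℂ) : ℝ≥0∞ :=
  ∫⁻ s in posScales m, (∫⁻ x, ‖h s x‖ₑ ^ 2) * scaleWeight n s

theorem measurable_lintegral_enorm_sq {β : Type*} [MeasurableSpace β] {h : β → 𝔼 n → ℂ}
    (hh : Measurable (Function.uncurry h)) : Measurable fun b => ∫⁻ x, ‖h b x‖ₑ ^ 2 :=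
  (hh.enorm.pow_const 2).lintegral_prod_right'

theorem scaleEnergy_zero (h : (Fin 0 → ℝ) → 𝔼 n → ℂ) :
    scaleEnergy h = ∫⁻ x, ‖h default x‖ₑ ^ 2 := by
  rw [scaleEnergy, setLIntegral_posScales_zero]
  simp [scaleWeight]

theorem scaleEnergy_succ {m : ℕ} {h : (Fin (m + 1) → ℝ) → 𝔼 n → ℂ}
    (hh : Measurable (Function.uncurry h)) :
    scaleEnergy h = ∫⁻ a in Set.Ioi (0 : ℝ),
      ENNReal.ofReal (1 / a ^ (n + 1)) * scaleEnergy fun s => h (Fin.cons a s) := by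
  have hm : Measurable fun s => (∫⁻ x, ‖h s x‖ₑ ^ 2) * scaleWeight n s :=
    (measurable_lintegral_enorm_sq hh).mul (measurable_scaleWeight n _)
  rw [scaleEnergy, setLIntegral_posScales_succ hm]
  refine setLIntegral_congr_fun measurableSet_Ioi fun a ha => ?_
  rw [scaleEnergy, ← lintegral_const_mul' _ _ (by simp)]
  congr 1 with s
  rw [scaleWeight_cons ha]
  ring

theorem scaleEnergy_add_le {m : ℕ} {g h : (Fin m → ℝ) → 𝔼 n → ℂ}
    (hg : Measurable (Function.uncurry g)) :
    scaleEnergy (fun s x => g s x + h s x) ≤ 2 * scaleEnergy g + 2 * scaleEnergy h := by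
  have hgs : ∀ s, Measurable fun x => 2 * ‖g s x‖ₑ ^ 2 := fun s =>
    (hg.of_uncurry_left.enorm.pow_const 2).const_mul 2
  have hge : Measurable fun s => 2 * ((∫⁻ x, ‖g s x‖ₑ ^ 2) * scaleWeight n s) :=
    ((measurable_lintegral_enorm_sq hg).mul (measurable_scaleWeight n m)).const_mul 2
  have hin : ∀ s, ∫⁻ x, ‖g s x + h s x‖ₑ ^ 2 ≤
      2 * (∫⁻ x, ‖g s x‖ₑ ^ 2) + 2 * ∫⁻ x, ‖h s x‖ₑ ^ 2 := fun s => by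
    rw [← lintegral_const_mul' _ _ (by simp), ← lintegral_const_mul' _ _ (by simp),
      ← lintegral_add_left (hgs s)]
    refine lintegral_mono fun x => ?_
    refine le_trans ?_ (add_sq_le_two_mul _ _)
    gcongr
    exact enorm_add_le _ _
  simp only [scaleEnergy]
  rw [← lintegral_const_mul' _ _ (by simp), ← lintegral_const_mul' _ _ (by simp),
    ← lintegral_add_left hge]
  refine lintegral_mono fun s => ?_
  refine (mul_le_mul_left (hin s) _).trans_eq ?_
  ring

theorem kernelOp_sub_ae {A : ℝ} {ψ : 𝔼 n → ℂ} (hψ : HasDecay A ψ) {f g : 𝔼 n → ℂ}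
    (hf : MemLp f 2 volume) (hg : MemLp g 2 volume) {s : ℝ} (hs : 0 < s) :
    kernelOp volume (convKernel ψ s) (f - g) =ᵐ[volume]
      fun x => kernelOp volume (convKernel ψ s) f x - kernelOp volume (convKernel ψ s) g x := by
  have hk := hψ.isStdKernel_convKernel.isSchur hs
  filter_upwards [hk.ae_integrable (schurConst_ne_top _) hf,
    hk.ae_integrable (schurConst_ne_top _) hg] with x h1 h2
  simp only [kernelOp]
  rw [← integral_sub h1 h2]
  simp only [Pi.sub_apply, mul_sub]

/-- A layer is nonlinear, but the modulus is nonexpansive, so differences reduce to the linear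
square function of `f - g`. -/
theorem exists_layer_sub_le (n : ℕ) (A : ℝ) : ∃ C : ℝ, 0 ≤ C ∧ ∀ ψ : 𝔼 n → ℂ, HasDecay A ψ →
    ∫ x, ψ x = 0 → ∀ f g : 𝔼 n → ℂ, MemLp f 2 volume → MemLp g 2 volume →
    ∫⁻ s in Set.Ioi (0 : ℝ), ENNReal.ofReal (1 / s ^ (n + 1)) *
      ∫⁻ x, ‖layer ψ s f x - layer ψ s g x‖ₑ ^ 2 ≤
        ENNReal.ofReal C * ∫⁻ x, ‖f x - g x‖ₑ ^ 2 := by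
  obtain ⟨C, hC, H⟩ := exists_squareFn_le_of_cancel n
  refine ⟨C * (A * 2 ^ (n + 1)) ^ 2, by positivity, fun ψ hψ h0 f g hf hg => ?_⟩
  refine le_trans ?_ (H (convKernel ψ) _ hψ.isStdKernel_convKernel
    (fun t ht x => hψ.integral_convKernel h0 ht x) (f - g) (hf.sub hg))
  refine setLIntegral_mono' measurableSet_Ioi fun s hs => ?_
  refine (lintegral_layer_sub_le ψ g f id hs).trans_eq ?_
  congr 1
  refine lintegral_congr_ae ?_
  filter_upwards [kernelOp_sub_ae hψ hf hg hs] with x hx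
  rw [hx, id]

theorem exists_layer_comp_sub_le {n : ℕ} (hn : n ≠ 0) (A : ℝ) : ∃ C : ℝ, 0 ≤ C ∧
    ∀ ψ : 𝔼 n → ℂ, HasDecay A ψ → ∫ x, ψ x = 0 → ∀ (τ : 𝔼 n → 𝔼 n) (ε : ℝ),
    IsSmallDeformation τ ε → ∀ f : 𝔼 n → ℂ, Measurable f → MemLp f 2 volume →
    ∫⁻ s in Set.Ioi (0 : ℝ), ENNReal.ofReal (1 / s ^ (n + 1)) *
      ∫⁻ x, ‖layer ψ s (fun y => f (warp τ y)) x - layer ψ s f (warp τ x)‖ₑ ^ 2 ≤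
        ENNReal.ofReal (C * ε ^ 2) * ∫⁻ x, ‖f x‖ₑ ^ 2 := by
  obtain ⟨C, hC, H⟩ := exists_commutator_le n hn
  refine ⟨C * A ^ 2, by positivity, fun ψ hψ h0 τ ε hτ f hf hf2 => ?_⟩
  exact (setLIntegral_mono' measurableSet_Ioi fun s hs =>
    lintegral_layer_sub_le ψ f _ (warp τ) hs).trans (H A ψ hψ h0 τ ε hτ f hf hf2)

theorem measurable_cascade_uncurry {ψ : 𝔼 n → ℂ} (hψ : Measurable ψ) (m : ℕ) {f : 𝔼 n → ℂ}
    (hf : Measurable f) : Measurable (Function.uncurry fun s => cascade ψ m s f) :=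
  measurable_cascade_const hψ m hf

theorem measurable_cascade_comp {ψ : 𝔼 n → ℂ} (hψ : Measurable ψ) (m : ℕ) {f : 𝔼 n → ℂ}
    (hf : Measurable f) {w : 𝔼 n → 𝔼 n} (hw : Measurable w) :
    Measurable (Function.uncurry fun s x => cascade ψ m s f (w x)) :=
  (measurable_cascade_const hψ m hf).comp (measurable_fst.prodMk (hw.comp measurable_snd))

/-- The induction peels off the layer that acts first: the hypothesis is applied to the two
first-layer outputs, whose distance the one-layer bound integrates over the first scale. -/
theorem exists_cascade_sub_le (n m : ℕ) (A : ℝ) : ∃ C : ℝ, 0 ≤ C ∧ ∀ ψ : 𝔼 n → ℂ, HasDecay A ψ →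
    ∫ x, ψ x = 0 → ∀ f g : 𝔼 n → ℂ, Measurable f → Measurable g → MemLp f 2 volume →
    MemLp g 2 volume →
    scaleEnergy (fun (s : Fin m → ℝ) x => cascade ψ m s f x - cascade ψ m s g x) ≤
      ENNReal.ofReal C * ∫⁻ x, ‖f x - g x‖ₑ ^ 2 := by
  induction m with
  | zero =>
    refine ⟨1, zero_le_one, fun ψ _ _ f g _ _ _ _ => ?_⟩
    rw [scaleEnergy_zero, ENNReal.ofReal_one, one_mul]
    rfl
  | succ m ih =>
    obtain ⟨C, hC, H⟩ := ih
    obtain ⟨D, hD, K⟩ := exists_layer_sub_le n A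
    refine ⟨C * D, by positivity, fun ψ hψ h0 f g hf hg hf2 hg2 => ?_⟩
    rw [scaleEnergy_succ ((measurable_cascade_uncurry hψ.measurable _ hf).sub
      (measurable_cascade_uncurry hψ.measurable _ hg)), ENNReal.ofReal_mul hC, mul_assoc]
    refine le_trans ?_ (mul_le_mul_right (K ψ hψ h0 f g hf2 hg2) _)
    rw [← lintegral_const_mul' _ _ (by simp)]
    refine setLIntegral_mono' measurableSet_Ioi fun a ha => ?_
    simp only [cascade_cons]
    rw [mul_left_comm]
    gcongr
    exact H ψ hψ h0 _ _ (measurable_layer_const hψ.measurable hf a)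
      (measurable_layer_const hψ.measurable hg a) (hψ.memLp_layer hf hf2 ha)
      (hψ.memLp_layer hg hg2 ha)

theorem layer_zero (ψ : 𝔼 n → ℂ) (s : ℝ) : layer ψ s 0 = 0 := by
  funext x
  simp [layer, waveletTransform]

theorem measurable_layer_family {ψ : 𝔼 n → ℂ} (hψ : Measurable ψ) {f : 𝔼 n → ℂ}
    (hf : Measurable f) : Measurable (Function.uncurry fun a => layer ψ a f) :=
  measurable_layer hψ (F := fun _ => f) (hf.comp measurable_snd) (s := fun a => a) measurable_id

/-- Telescoping: the deformation is first commuted past one layer, at the cost of the commutator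
estimate and the Lipschitz bound for the remaining cascade, then past the rest by induction. -/
theorem exists_cascade_comp_sub_le {n : ℕ} (hn : n ≠ 0) (m : ℕ) (A : ℝ) : ∃ C : ℝ, 0 ≤ C ∧
    ∀ ψ : 𝔼 n → ℂ, HasDecay A ψ → ∫ x, ψ x = 0 → ∀ (τ : 𝔼 n → 𝔼 n) (ε : ℝ),
    IsSmallDeformation τ ε → ∀ f : 𝔼 n → ℂ, Measurable f → MemLp f 2 volume →
    scaleEnergy (fun (s : Fin m → ℝ) x =>
      cascade ψ m s (fun y => f (warp τ y)) x - cascade ψ m s f (warp τ x)) ≤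
        ENNReal.ofReal (C * ε ^ 2) * ∫⁻ x, ‖f x‖ₑ ^ 2 := by
  induction m with
  | zero =>
    refine ⟨0, le_rfl, fun ψ _ _ τ ε _ f _ _ => ?_⟩
    rw [scaleEnergy_zero]
    simp [cascade]
  | succ m ih =>
    obtain ⟨C, hC, H⟩ := ih
    obtain ⟨C', hC', H'⟩ := exists_cascade_sub_le n m A
    obtain ⟨D, hD, K⟩ := exists_layer_comp_sub_le hn A
    obtain ⟨D', hD', K'⟩ := exists_layer_sub_le n A
    refine ⟨2 * C' * D + 2 * C * D', by positivity, fun ψ hψ h0 τ ε hτ f hf hf2 => ?_⟩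
    have hψm := hψ.measurable
    have hfw : Measurable fun y => f (warp τ y) := hf.comp hτ.measurable
    have hfw2 := hτ.memLp_comp hf hf2
    rw [scaleEnergy_succ ((measurable_cascade_uncurry hψm _ hfw).sub
      (measurable_cascade_comp hψm _ hf hτ.measurable))]
    have hstep : ∀ a ∈ Set.Ioi (0 : ℝ), ENNReal.ofReal (1 / a ^ (n + 1)) *
        scaleEnergy (fun (s : Fin m → ℝ) x =>
          cascade ψ (m + 1) (Fin.cons a s) (fun y => f (warp τ y)) x -
            cascade ψ (m + 1) (Fin.cons a s) f (warp τ x)) ≤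
        ENNReal.ofReal (2 * C') * (ENNReal.ofReal (1 / a ^ (n + 1)) *
          ∫⁻ x, ‖layer ψ a (fun y => f (warp τ y)) x - layer ψ a f (warp τ x)‖ₑ ^ 2) +
        ENNReal.ofReal (2 * (C * ε ^ 2)) * (ENNReal.ofReal (1 / a ^ (n + 1)) *
          ∫⁻ x, ‖layer ψ a f x‖ₑ ^ 2) := fun a ha => by
      have hl := measurable_layer_const hψm hf a
      have hlw : Measurable fun y => layer ψ a f (warp τ y) := hl.comp hτ.measurable
      have hl2 := hψ.memLp_layer hf hf2 ha
      have hlv := measurable_layer_const hψm hfw a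
      have e1 := H' ψ hψ h0 _ _ hlv hlw (hψ.memLp_layer hfw hfw2 ha) (hτ.memLp_comp hl hl2)
      have e2 := H ψ hψ h0 τ ε hτ _ hl hl2
      -- The intermediate term is the remaining cascade applied to `(layer ψ a f) ∘ G`.
      have e3 := scaleEnergy_add_le (g := fun (s : Fin m → ℝ) x =>
        cascade ψ m s (layer ψ a fun y => f (warp τ y)) x -
          cascade ψ m s (fun y => layer ψ a f (warp τ y)) x) (h := fun (s : Fin m → ℝ) x =>
        cascade ψ m s (fun y => layer ψ a f (warp τ y)) x -
          cascade ψ m s (layer ψ a f) (warp τ x))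
        ((measurable_cascade_uncurry hψm m hlv).sub (measurable_cascade_uncurry hψm m hlw))
      simp only [sub_add_sub_cancel] at e3
      simp only [cascade_cons]
      refine (mul_le_mul_right (e3.trans (add_le_add (mul_le_mul_right e1 _)
        (mul_le_mul_right e2 _))) _).trans_eq ?_
      rw [ENNReal.ofReal_mul zero_le_two, ENNReal.ofReal_mul (p := 2) zero_le_two,
        ENNReal.ofReal_ofNat]
      ring
    refine (setLIntegral_mono' measurableSet_Ioi hstep).trans ?_
    have hmw : Measurable fun a : ℝ => ENNReal.ofReal (1 / a ^ (n + 1)) := by fun_prop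
    have hml : Measurable fun a : ℝ => ENNReal.ofReal (2 * (C * ε ^ 2)) *
        (ENNReal.ofReal (1 / a ^ (n + 1)) * ∫⁻ x, ‖layer ψ a f x‖ₑ ^ 2) :=
      (hmw.mul (measurable_lintegral_enorm_sq (measurable_layer_family hψm hf))).const_mul _
    have hK' := K' ψ hψ h0 f 0 hf2 MemLp.zero
    simp only [layer_zero, Pi.zero_apply, sub_zero] at hK'
    rw [lintegral_add_right _ hml, lintegral_const_mul' _ _ ENNReal.ofReal_ne_top,
      lintegral_const_mul' _ _ ENNReal.ofReal_ne_top]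
    refine (add_le_add (mul_le_mul_right (K ψ hψ h0 τ ε hτ f hf hf2) _)
      (mul_le_mul_right hK' _)).trans_eq ?_
    rw [← mul_assoc, ← mul_assoc, ← add_mul, ← ENNReal.ofReal_mul (by positivity),
      ← ENNReal.ofReal_mul (by positivity), ← ENNReal.ofReal_add (by positivity) (by positivity)]
    congr 2
    ring

end Energy

/-! ### From cascades to the scattering transform. -/

section Stability

variable {n : ℕ} {τ : 𝔼 n → 𝔼 n} {ε : ℝ}

/-- The cross term is split by Young's inequality with weight `ε`, because `‖w - z‖²` will integrate
to `O(ε²)`, making every term `O(ε)`. -/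
theorem abs_mul_norm_sq_sub_norm_sq_le {z w : ℂ} {J K : ℝ} (hε : 0 < ε) (hJ : |1 - J| ≤ K * ε) :
    |J * ‖z‖ ^ 2 - ‖w‖ ^ 2| ≤ (K + 1) * ε * (‖z‖ ^ 2 + ‖w‖ ^ 2) + ε⁻¹ * ‖w - z‖ ^ 2 := by
  have h1 : |(J - 1) * ‖z‖ ^ 2| ≤ K * ε * ‖z‖ ^ 2 := by
    rw [abs_mul, abs_sub_comm, abs_of_nonneg (sq_nonneg ‖z‖)]
    gcongr
  have h2 : |‖z‖ ^ 2 - ‖w‖ ^ 2| ≤ ε * (‖z‖ ^ 2 + ‖w‖ ^ 2) + ε⁻¹ * ‖w - z‖ ^ 2 := by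
    have h3 : |‖z‖ - ‖w‖| ≤ ‖w - z‖ := by
      rw [norm_sub_rev]
      exact abs_norm_sub_norm_le _ _
    have h4 : 2 * (‖w - z‖ * (‖z‖ + ‖w‖)) ≤ ε * (‖z‖ + ‖w‖) ^ 2 + ε⁻¹ * ‖w - z‖ ^ 2 := by
      have h5 := mul_nonneg (inv_nonneg.2 hε.le) (sq_nonneg (ε * (‖z‖ + ‖w‖) - ‖w - z‖))
      have h6 : ε⁻¹ * (ε * (‖z‖ + ‖w‖) - ‖w - z‖) ^ 2 = ε * (‖z‖ + ‖w‖) ^ 2 +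
          ε⁻¹ * ‖w - z‖ ^ 2 - 2 * (‖w - z‖ * (‖z‖ + ‖w‖)) := by
        field_simp
        ring
      linarith
    have h7 : ε * (‖z‖ + ‖w‖) ^ 2 ≤ ε * (2 * (‖z‖ ^ 2 + ‖w‖ ^ 2)) :=
      mul_le_mul_of_nonneg_left (add_sq_le) hε.le
    have h8 : 0 ≤ ε⁻¹ * ‖w - z‖ ^ 2 := by positivity
    calc |‖z‖ ^ 2 - ‖w‖ ^ 2| = |‖z‖ - ‖w‖| * (‖z‖ + ‖w‖) := by
          rw [sq_sub_sq, abs_mul, abs_of_nonneg (by positivity : 0 ≤ ‖z‖ + ‖w‖), mul_comm]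
      _ ≤ ‖w - z‖ * (‖z‖ + ‖w‖) := by gcongr
      _ ≤ _ := by linarith
  have h9 : J * ‖z‖ ^ 2 - ‖w‖ ^ 2 = (J - 1) * ‖z‖ ^ 2 + (‖z‖ ^ 2 - ‖w‖ ^ 2) := by ring
  have h10 : 0 ≤ K * ε * ‖w‖ ^ 2 := mul_nonneg ((abs_nonneg _).trans hJ) (sq_nonneg _)
  rw [h9]
  refine (abs_add_le _ _).trans ?_
  linarith

theorem enorm_mul_norm_sq_sub_norm_sq_le {z w : ℂ} {J K : ℝ} (hK : 0 ≤ K) (hε : 0 < ε)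
    (hJ : |1 - J| ≤ K * ε) :
    ‖J * ‖z‖ ^ 2 - ‖w‖ ^ 2‖ₑ ≤
      ENNReal.ofReal ((K + 1) * ε) * (‖z‖ₑ ^ 2 + ‖w‖ₑ ^ 2) +
        ENNReal.ofReal ε⁻¹ * ‖w - z‖ₑ ^ 2 := by
  rw [Real.enorm_eq_ofReal_abs]
  refine (ENNReal.ofReal_le_ofReal (abs_mul_norm_sq_sub_norm_sq_le hε hJ)).trans_eq ?_
  simp only [← ofReal_norm]
  rw [ENNReal.ofReal_add (by positivity) (by positivity), ENNReal.ofReal_mul (by positivity),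
    ENNReal.ofReal_mul (p := ε⁻¹) (by positivity), ENNReal.ofReal_add (by positivity)
    (by positivity), ENNReal.ofReal_pow (by positivity), ENNReal.ofReal_pow (by positivity),
    ENNReal.ofReal_pow (by positivity)]

namespace IsSmallDeformation

theorem integral_comp_real (h : IsSmallDeformation τ ε) (F : 𝔼 n → ℝ) :
    ∫ x, jacobian τ x * F (warp τ x) = ∫ x, F x := by
  have := integral_image_eq_integral_abs_det_fderiv_smul volume MeasurableSet.univ
    (fun x _ => (h.hasFDerivAt x).hasFDerivWithinAt) h.injective.injOn F
  rw [Set.image_univ, h.surjective.range_eq, setIntegral_univ, setIntegral_univ] at this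
  exact this.symm

theorem integrable_comp_real (h : IsSmallDeformation τ ε) {F : 𝔼 n → ℝ} (hF : Integrable F) :
    Integrable fun x => jacobian τ x * F (warp τ x) := by
  have := integrableOn_image_iff_integrableOn_abs_det_fderiv_smul volume MeasurableSet.univ
    (fun x _ => (h.hasFDerivAt x).hasFDerivWithinAt) h.injective.injOn F
  rw [Set.image_univ, h.surjective.range_eq, integrableOn_univ, integrableOn_univ] at this
  exact this.1 hF

/-- Only the integral of `‖u‖²` is changed by `G`, so the comparison is between `u ∘ G` and `v`,
exactly where the cascade commutator is small. -/
theorem enorm_integral_sub_le (h : IsSmallDeformation τ ε) (hε : 0 < ε) {u v : 𝔼 n → ℂ}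
    (hu : Measurable u) (hv : Measurable v) (hu2 : MemLp u 2 volume) (hv2 : MemLp v 2 volume) :
    ‖(∫ x, ‖u x‖ ^ 2) - ∫ x, ‖v x‖ ^ 2‖ₑ ≤
      ENNReal.ofReal ((n * 2 ^ n + 1) * ε) *
        ((∫⁻ x, ‖u (warp τ x)‖ₑ ^ 2) + ∫⁻ x, ‖v x‖ₑ ^ 2) +
        ENNReal.ofReal ε⁻¹ * ∫⁻ x, ‖v x - u (warp τ x)‖ₑ ^ 2 := by
  have hui : Integrable fun x => ‖u x‖ ^ 2 := hu2.integrable_norm_pow two_ne_zero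
  have hvi : Integrable fun x => ‖v x‖ ^ 2 := hv2.integrable_norm_pow two_ne_zero
  rw [← h.integral_comp_real fun x => ‖u x‖ ^ 2,
    ← integral_sub (h.integrable_comp_real hui) hvi]
  refine (enorm_integral_le_lintegral_enorm _).trans ?_
  have huw : Measurable fun x => ‖u (warp τ x)‖ₑ ^ 2 := (hu.comp h.measurable).enorm.pow_const 2
  have hs : Measurable fun x => ENNReal.ofReal ((n * 2 ^ n + 1) * ε) *
      (‖u (warp τ x)‖ₑ ^ 2 + ‖v x‖ₑ ^ 2) := (huw.add (hv.enorm.pow_const 2)).const_mul _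
  rw [← lintegral_add_left huw, ← lintegral_const_mul' _ _ ENNReal.ofReal_ne_top,
    ← lintegral_const_mul' _ _ ENNReal.ofReal_ne_top, ← lintegral_add_left hs]
  exact lintegral_mono fun x => enorm_mul_norm_sq_sub_norm_sq_le (by positivity) hε
    (h.abs_jacobian_sub_one_le x)

theorem quasiMeasurePreserving (h : IsSmallDeformation τ ε) :
    Measure.QuasiMeasurePreserving (warp τ) volume volume := by
  refine ⟨h.measurable, Measure.AbsolutelyContinuous.mk fun s hs h0 => ?_⟩
  rw [Measure.map_apply h.measurable hs, ← lintegral_indicator_one (h.measurable hs)]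
  refine le_antisymm ((h.lintegral_comp_warp_le (s.indicator 1)).trans ?_) zero_le
  rw [lintegral_indicator_one hs, h0, mul_zero]

end IsSmallDeformation

theorem scaleNorm_eq {m : ℕ} (F : (Fin m → ℝ) → ℝ) :
    scaleNorm n F = ∫⁻ s in posScales m, ‖F s‖ₑ * scaleWeight n s := rfl

theorem scaleEnergy_comp_warp_le (hτ : IsSmallDeformation τ ε) {m : ℕ}
    (h : (Fin m → ℝ) → 𝔼 n → ℂ) :
    scaleEnergy (fun s x => h s (warp τ x)) ≤ 2 ^ n * scaleEnergy h := by
  rw [scaleEnergy, scaleEnergy, ← lintegral_const_mul' _ _ (by finiteness)]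
  refine lintegral_mono fun s => ?_
  rw [← mul_assoc]
  gcongr
  exact hτ.lintegral_comp_warp_le fun x => ‖h s x‖ₑ ^ 2

/-- The energies of both cascades are bounded and carry a factor `ε`; the commutator energy is
`O(ε²)` and carries `ε⁻¹`. -/
theorem exists_scaleNorm_scattering_sub_le {n : ℕ} (hn : n ≠ 0) (m : ℕ) (A : ℝ) :
    ∃ C : ℝ, 0 ≤ C ∧ ∀ ψ : 𝔼 n → ℂ, HasDecay A ψ → ∫ x, ψ x = 0 →
    ∀ (τ : 𝔼 n → 𝔼 n) (ε : ℝ), IsSmallDeformation τ ε → 0 < ε →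
    ∀ f : 𝔼 n → ℂ, Measurable f → MemLp f 2 volume →
    scaleNorm n (fun s : Fin m → ℝ => scattering ψ m f s - scattering ψ m (deform τ f) s) ≤
      ENNReal.ofReal (C * ε) * ∫⁻ x, ‖f x‖ₑ ^ 2 := by
  obtain ⟨P, hP, HP⟩ := exists_cascade_sub_le n m A
  obtain ⟨Q, hQ, HQ⟩ := exists_cascade_comp_sub_le hn m A
  refine ⟨(n * 2 ^ n + 1) * (2 ^ n * P + 2 ^ n * P) + Q, by positivity,
    fun ψ hψ h0 τ ε hτ hε f hf hf2 => ?_⟩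
  have hψm := hψ.measurable
  have hd : deform τ f = fun y => f (warp τ y) := rfl
  have hfw : Measurable fun y => f (warp τ y) := hf.comp hτ.measurable
  have hfw2 := hτ.memLp_comp hf hf2
  have hP0 : ∀ g : 𝔼 n → ℂ, Measurable g → MemLp g 2 volume →
      scaleEnergy (fun s : Fin m → ℝ => cascade ψ m s g) ≤
        ENNReal.ofReal P * ∫⁻ x, ‖g x‖ₑ ^ 2 := fun g hg hg2 => by
    have := HP ψ hψ h0 g 0 hg measurable_zero hg2 MemLp.zero
    simpa only [cascade_zero, Pi.zero_apply, sub_zero] using this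
  have hc := (scaleEnergy_comp_warp_le hτ fun s : Fin m → ℝ => cascade ψ m s f).trans
    (mul_le_mul_right (hP0 f hf hf2) _)
  have hb := (hP0 _ hfw hfw2).trans
    (mul_le_mul_right (hτ.lintegral_comp_warp_le fun x => ‖f x‖ₑ ^ 2) _)
  have hq := HQ ψ hψ h0 τ ε hτ f hf hf2
  have hmc : Measurable fun s : Fin m → ℝ =>
      (∫⁻ x, ‖cascade ψ m s f (warp τ x)‖ₑ ^ 2) * scaleWeight n s :=
    (measurable_lintegral_enorm_sq (measurable_cascade_comp hψm m hf hτ.measurable)).mul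
      (measurable_scaleWeight n m)
  have hmb : Measurable fun s : Fin m → ℝ =>
      (∫⁻ x, ‖cascade ψ m s (fun y => f (warp τ y)) x‖ₑ ^ 2) * scaleWeight n s :=
    (measurable_lintegral_enorm_sq (measurable_cascade_uncurry hψm m hfw)).mul
      (measurable_scaleWeight n m)
  have hms : Measurable fun s : Fin m → ℝ => ENNReal.ofReal ((n * 2 ^ n + 1) * ε) *
      ((∫⁻ x, ‖cascade ψ m s f (warp τ x)‖ₑ ^ 2) * scaleWeight n s +
        (∫⁻ x, ‖cascade ψ m s (fun y => f (warp τ y)) x‖ₑ ^ 2) * scaleWeight n s) :=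
    (hmc.add hmb).const_mul _
  have key : scaleNorm n (fun s : Fin m → ℝ =>
      scattering ψ m f s - scattering ψ m (deform τ f) s) ≤
      ENNReal.ofReal ((n * 2 ^ n + 1) * ε) *
        (scaleEnergy (fun (s : Fin m → ℝ) x => cascade ψ m s f (warp τ x)) +
          scaleEnergy (fun s : Fin m → ℝ => cascade ψ m s fun y => f (warp τ y))) +
        ENNReal.ofReal ε⁻¹ * scaleEnergy (fun (s : Fin m → ℝ) x =>
          cascade ψ m s (fun y => f (warp τ y)) x - cascade ψ m s f (warp τ x)) := by
    simp only [scaleEnergy]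
    rw [← lintegral_add_left hmc, ← lintegral_const_mul' _ _ ENNReal.ofReal_ne_top,
      ← lintegral_const_mul' _ _ ENNReal.ofReal_ne_top, ← lintegral_add_left hms, scaleNorm_eq]
    refine setLIntegral_mono' (measurableSet_posScales m) fun s hs => ?_
    have hmeas : ∀ g : 𝔼 n → ℂ, Measurable g → Measurable (cascade ψ m s g) := fun g hg =>
      (measurable_cascade_uncurry hψm m hg).of_uncurry_left
    refine (mul_le_mul_left (hτ.enorm_integral_sub_le hε (hmeas f hf) (hmeas _ hfw)
      (hψ.memLp_cascade hf hf2 hs) (hψ.memLp_cascade hfw hfw2 hs)) _).trans_eq ?_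
    ring
  refine key.trans ((add_le_add (mul_le_mul_right (add_le_add hc hb) _)
    (mul_le_mul_right hq _)).trans_eq ?_)
  rw [two_pow_eq_ofReal, mul_left_comm (ENNReal.ofReal P), ← mul_assoc _ (ENNReal.ofReal P),
    ← ENNReal.ofReal_mul (by positivity), ← add_mul, ← mul_assoc, ← mul_assoc, ← add_mul,
    ← ENNReal.ofReal_add (by positivity) (by positivity), ← ENNReal.ofReal_mul (by positivity),
    ← ENNReal.ofReal_mul (by positivity), ← ENNReal.ofReal_add (by positivity) (by positivity)]
  congr 2
  field_simp

theorem scattering_congr_ae (ψ : 𝔼 n → ℂ) (m : ℕ) {f g : 𝔼 n → ℂ} (h : f =ᵐ[volume] g)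
    (s : Fin m → ℝ) : scattering ψ m f s = scattering ψ m g s := by
  cases m with
  | zero =>
    refine integral_congr_ae ?_
    filter_upwards [h] with x hx
    simp only [cascade, hx]
  | succ m =>
    have : waveletTransform ψ (s 0) f = waveletTransform ψ (s 0) g := by
      funext x
      refine integral_congr_ae ?_
      filter_upwards [h] with y hy
      rw [hy]
    simp only [scattering, cascade, this]

/-- Cauchy–Schwarz over columns and summation over rows each cost `√n`. -/
theorem norm_le_card_mul_of_entries {T : 𝔼 n →L[ℝ] 𝔼 n} {δ : ℝ} (hδ : 0 ≤ δ)
    (h : ∀ i j, ‖(T (EuclideanSpace.single j 1)) i‖ ≤ δ) : ‖T‖ ≤ n * δ := by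
  refine T.opNorm_le_bound (by positivity) fun v => ?_
  have hv : v = ∑ j, v j • EuclideanSpace.single j (1 : ℝ) := by
    ext i
    simp [Finset.sum_apply, Pi.single_apply]
  have hi : ∀ i, ‖(T v) i‖ ≤ δ * ∑ j, ‖v j‖ := fun i => by
    conv_lhs => rw [hv]
    rw [map_sum, WithLp.ofLp_sum, Finset.sum_apply, Finset.mul_sum]
    refine (norm_sum_le _ _).trans (Finset.sum_le_sum fun j _ => ?_)
    rw [map_smul, PiLp.smul_apply, norm_smul, mul_comm]
    gcongr
    exact h i j
  have hs : (∑ j, ‖v j‖) ^ 2 ≤ n * ‖v‖ ^ 2 := by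
    rw [EuclideanSpace.norm_sq_eq]
    simpa using sq_sum_le_card_mul_sum_sq (s := Finset.univ) (f := fun j => ‖v j‖)
  refine le_of_sq_le_sq ?_ (by positivity)
  calc ‖T v‖ ^ 2 = ∑ i, ‖(T v) i‖ ^ 2 := EuclideanSpace.norm_sq_eq _
    _ ≤ ∑ _i : Fin n, (δ * ∑ j, ‖v j‖) ^ 2 :=
        Finset.sum_le_sum fun i _ => pow_le_pow_left₀ (norm_nonneg _) (hi i) 2
    _ = n * δ ^ 2 * (∑ j, ‖v j‖) ^ 2 := by simp; ring
    _ ≤ n * δ ^ 2 * (n * ‖v‖ ^ 2) := by gcongr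
    _ = _ := by ring

theorem isSmallDeformation_of_supJacobian_le (hτ : ContDiff ℝ 2 τ) {δ : ℝ} (hδ : 0 ≤ δ)
    (h : supJacobian τ ≤ ENNReal.ofReal δ) (hε : n * δ ≤ ε) (hε2 : ε ≤ 1 / 2) :
    IsSmallDeformation τ ε where
  contDiff := hτ.of_le (by norm_num)
  nonneg := le_trans (by positivity) hε
  le_half := hε2
  norm_fderiv_le x := by
    refine (norm_le_card_mul_of_entries hδ fun i j => ?_).trans hε
    have h1 : ‖(fderiv ℝ τ x (EuclideanSpace.single j 1)) i‖ₑ ≤ ENNReal.ofReal δ :=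
      le_trans (le_iSup_of_le x (le_iSup_of_le i 
        (le_iSup (fun j : Fin n => ‖(fderiv ℝ τ x (EuclideanSpace.single j 1)) i‖ₑ) j))) h
    rwa [← ofReal_norm, ENNReal.ofReal_le_ofReal_iff hδ] at h1

/-- The deformation estimate with a bound that is linear in `‖Dτ‖_∞`. -/
theorem exists_scaleNorm_le_supJacobian {n : ℕ} (hn : n ≠ 0) (m : ℕ) (A : ℝ) :
    ∃ C : ℝ, 0 ≤ C ∧ ∀ ψ : 𝔼 n → ℂ, HasDecay A ψ → ∫ x, ψ x = 0 →
    ∀ τ : 𝔼 n → 𝔼 n, ContDiff ℝ 2 τ → supJacobian τ ≤ ENNReal.ofReal (1 / (2 * (n : ℝ))) →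
    ∀ f : 𝔼 n → ℂ, MemLp f 2 volume →
    scaleNorm n (fun s : Fin m → ℝ => scattering ψ m f s - scattering ψ m (deform τ f) s) ≤
      ENNReal.ofReal C * supJacobian τ * eLpNorm f 2 volume ^ 2 := by
  obtain ⟨C, hC, H⟩ := exists_scaleNorm_scattering_sub_le hn m A
  refine ⟨C * n, by positivity, fun ψ hψ h0 τ hτ hsup f hf => ?_⟩
  have hn0 : (0 : ℝ) < n := by positivity
  obtain ⟨δ, hδ, hδe⟩ : ∃ δ : ℝ, 0 ≤ δ ∧ supJacobian τ = ENNReal.ofReal δ :=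
    ⟨_, ENNReal.toReal_nonneg, (ENNReal.ofReal_toReal (hsup.trans_lt ENNReal.ofReal_lt_top).ne).symm⟩
  have hδn : n * δ ≤ 1 / 2 := by
    rw [hδe, ENNReal.ofReal_le_ofReal_iff (by positivity)] at hsup
    calc n * δ ≤ n * (1 / (2 * (n : ℝ))) := by gcongr
      _ = 1 / 2 := by field_simp
  have hbound : ∀ ε, 0 < ε → n * δ ≤ ε → ε ≤ 1 / 2 →
      scaleNorm n (fun s : Fin m → ℝ => scattering ψ m f s - scattering ψ m (deform τ f) s) ≤
        ENNReal.ofReal (C * ε) * eLpNorm f 2 volume ^ 2 := fun ε hε hε1 hε2 => by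
    have hS := isSmallDeformation_of_supJacobian_le hτ hδ hδe.le hε1 hε2
    -- The earlier estimates ask for a measurable function; a representative may be used since `G`
    -- pulls null sets back to null sets.
    obtain ⟨g, hgm, hg⟩ : ∃ g : 𝔼 n → ℂ, Measurable g ∧ f =ᵐ[volume] g :=
      ⟨_, hf.1.stronglyMeasurable_mk.measurable, hf.1.ae_eq_mk⟩
    have hgd : deform τ f =ᵐ[volume] deform τ g :=
      hS.quasiMeasurePreserving.ae_eq_comp hg
    have := H ψ hψ h0 τ ε hS hε _ hgm (hf.ae_eq hg)
    simp only [scattering_congr_ae ψ m hg, scattering_congr_ae ψ m hgd]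
    rwa [eLpNorm_congr_ae hg, eLpNorm_two_sq]
  -- Young's inequality needed `ε > 0`. If `Dτ = 0`, every `ε ∈ (0, 1/2]` is admissible and `ε → 0`
  -- gives the bound zero.
  rcases hδ.eq_or_lt with rfl | hpos
  · have hX : eLpNorm f 2 volume ^ 2 ≠ ⊤ := ENNReal.pow_ne_top hf.2.ne
    have ht : Tendsto (fun ε : ℝ => ENNReal.ofReal (C * ε) * eLpNorm f 2 volume ^ 2) (𝓝[>] 0)
        (𝓝 (ENNReal.ofReal (C * 0) * eLpNorm f 2 volume ^ 2)) := by
      refine ENNReal.Tendsto.mul_const ?_ (Or.inr hX)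
      refine ENNReal.tendsto_ofReal (Tendsto.mono_left ?_ nhdsWithin_le_nhds)
      exact tendsto_id.const_mul C
    rw [hδe, ENNReal.ofReal_zero, mul_zero]
    rw [mul_zero, ENNReal.ofReal_zero] at ht
    refine ge_of_tendsto ht ?_
    filter_upwards [Ioc_mem_nhdsGT (by norm_num : (0 : ℝ) < 1 / 2)] with ε hε
    exact hbound ε hε.1 (by rw [mul_zero]; exact hε.1.le) hε.2
  · refine (hbound (n * δ) (by positivity) le_rfl hδn).trans_eq ?_
    rw [hδe, ← ENNReal.ofReal_mul (by positivity), mul_assoc C]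

end Stability

end WaveletScattering

theorem mainTheorem1 (n m : ℕ) (hn : 1 ≤ n) (hm : 1 ≤ m) (A : ℝ) :
    ∃ C : ℝ, 0 < C ∧
      ∀ ψ : EuclideanSpace ℝ (Fin n) → ℂ,
        WaveletScattering.HasDecay A ψ → (∫ x, ψ x) = 0 →
      ∀ τ : EuclideanSpace ℝ (Fin n) → EuclideanSpace ℝ (Fin n),
        ContDiff ℝ 2 τ →
        WaveletScattering.supJacobian τ ≤ ENNReal.ofReal (1 / (2 * (n : ℝ))) →
      ∀ f : EuclideanSpace ℝ (Fin n) → ℂ, MemLp f 2 volume →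
        WaveletScattering.scaleNorm n (fun s : Fin m → ℝ =>
            WaveletScattering.scattering ψ m f s -
              WaveletScattering.scattering ψ m (WaveletScattering.deform τ f) s) ≤
          ENNReal.ofReal C *
            (WaveletScattering.supJacobian τ +
              (WaveletScattering.supJacobian τ * WaveletScattering.logFactor τ +
                WaveletScattering.supHessian τ) ^ 2) *
            eLpNorm f 2 volume ^ 2 := by
  obtain ⟨C, hC, H⟩ :=
    WaveletScattering.exists_scaleNorm_le_supJacobian (Nat.one_le_iff_ne_zero.1 hn) m A
  -- The linear estimate only provides `C ≥ 0`; adding `1` makes the constant positive.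
  refine ⟨C + 1, by positivity, fun ψ hψ h0 τ hτ hsup f hf => ?_⟩
  refine (H ψ hψ h0 τ hτ hsup f hf).trans ?_
  gcongr
  · linarith
  -- The squared logarithmic and Hessian term is nonnegative and only enlarges the bound.
  · exact le_self_add
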